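/- Let $\alpha>0$. There is a constant $C>0$, depending only on $\alpha$, such that the following holds for every separable complex Hilbert space $\mathcal H$ (inner product linear in the first variable) and every analytic function $\varphi:\mathbb D\to\mathcal H$ on the open unit disc $\mathbb D$. Notation. For an analytic function $f$ on $\mathbb D$ with values in a complex Banach space, $\hat f(n)$ denotes its $n$th Taylor coefficient at $0$, and $D^\beta f(z)=\sum_{n\ge0}(1+n)^\beta\hat f(n)z^n$ for $\beta\in\mathbb R$. For $\mathcal X\in\{\mathcal H,\mathbb C\}$, the Hardy space $H^2(\mathcal X)$ consists of all analytic $f:\mathbb D\to\mathcal X$ with $\|f\|_{H^2(\mathcal X)}^2=\sup_{0<r<1}\frac1{2\pi}\int_0^{2\pi}\|f(re^{i\theta})\|_{\mathcal X}^2\,d\theta<\infty$; write $H^2=H^2(\mathbb C)$. Let $\mathcal O(\mathcal H)$ be the set of $\mathcal H$-valued functions on $\mathbb D$ having an analytic extension to a larger disc centered at $0$, and $\mathcal O_1(\mathcal H)=\{f\in\mathcal O(\mathcal H):\|f\|_{H^2(\mathcal H)}=1\}$. Let $\varphi^\#(z)=\varphi(\bar z)^*$, where $x^*$ is the functional $y\mapsto\langle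 y,x\rangle$; thus $\widehat{\varphi^\#}(n)=\hat\varphi(n)^*$. For $f\in\mathcal O(\mathcal H)$ set $$\Gamma_{\varphi^\#}f(z)=\sum_{n=0}^\infty\Big(\sum_{m=0}^\infty\big\langle\hat f(m),\hat\varphi(m+n)\big\rangle_{\mathcal H}\Big)z^n,\qquad z\in\mathbb D.$$ The operator $D^\alpha\Gamma_{\varphi^\#}$, defined on $\mathcal O(\mathcal H)$, is called bounded if it extends to a bounded linear operator $H^2(\mathcal H)\to H^2$, and $$\|D^\alpha\Gamma_{\varphi^\#}\|=\sup_{f\in\mathcal O_1(\mathcal H)}\|D^\alpha\Gamma_{\varphi^\#}f\|_{H^2}\in[0,\infty].$$ Let $dA$ be area measure, and put $$N(\varphi)=\sup_{f\in\mathcal O_1(\mathcal H)}\int_{\mathbb D}\big|\big\langle f(z),(D^{1+\alpha}\varphi)(z)\big\rangle_{\mathcal H}\big|^2(1-|z|^2)\,dA(z)\in[0,\infty]$$ (suprema over the empty set, which occur only for $\mathcal H=\{0\}$, are $0$). Claim. $D^\alpha\Gamma_{\varphi^\#}$ is bounded from $H^2(\mathcal H)$ to $H^2$ if and only if $N(\varphi)<\infty$.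 Moreover, $N(\varphi)\le C\,\|D^\alpha\Gamma_{\varphi^\#}\|^2$ and $\|D^\alpha\Gamma_{\varphi^\#}\|^2\le C\,N(\varphi)$. -/

import Mathlib

open MeasureTheory
open scoped ENNReal NNReal InnerProductSpace

noncomputable section

/- Functions on the open unit disc `𝔻 = Metric.ball 0 1` are represented by functions on `ℂ`
whose values off the disc are irrelevant: every notion below only sees the values on `𝔻`. -/

/-- `Hol(E)`: analytic `E`-valued functions on the open unit disc. -/
def IsHol {E : Type*} [NormedAddCommGroup E] [NormedSpace ℂ E] (f : ℂ → E) : Prop :=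
  DifferentiableOn ℂ f (Metric.ball 0 1)

/-- `𝒪(E)`: functions on the unit disc that have an analytic extension to a larger disc
centered at the origin. -/
def ExtendsAnalytically {E : Type*} [NormedAddCommGroup E] [NormedSpace ℂ E]
    (f : ℂ → E) : Prop :=
  ∃ R : ℝ, 1 < R ∧ ∃ g : ℂ → E,
    DifferentiableOn ℂ g (Metric.ball 0 R) ∧ Set.EqOn f g (Metric.ball 0 1)

/-- The `n`th Taylor coefficient of `f` at the origin. -/
def taylorCoeff {E : Type*} [NormedAddCommGroup E] [NormedSpace ℂ E] (f : ℂ → E) (n : ℕ) : E :=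
  ((n.factorial : ℂ)⁻¹) • iteratedDeriv n f 0

/-- Fractional differentiation `D^α f (z) = ∑ (1 + n)^α f̂(n) z^n`. -/
def fracD {E : Type*} [NormedAddCommGroup E] [NormedSpace ℂ E] (α : ℝ) (f : ℂ → E) : ℂ → E :=
  fun z => ∑' n : ℕ, (((1 + (n : ℝ)) ^ α : ℝ) : ℂ) • z ^ n • taylorCoeff f n

/-- The Hankel operator with operator-valued symbol `Φ`:
`Γ_Φ f (z) = ∑ₙ (∑ₘ Φ̂(m + n) f̂(m)) z^n`. -/
def hankel {E F : Type*} [NormedAddCommGroup E] [NormedSpace ℂ E]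
    [NormedAddCommGroup F] [NormedSpace ℂ F] (Φ : ℂ → E →L[ℂ] F) (f : ℂ → E) : ℂ → F :=
  fun z => ∑' n : ℕ, z ^ n • ∑' m : ℕ, taylorCoeff Φ (m + n) (taylorCoeff f m)

/-- `φ^#(z) = φ(z̄)^*`, where `x^*` is the functional `y ↦ ⟨y, x⟩` (linear in `y`), the adjoint of
the operator `ℂ → H, c ↦ c x`. -/
def sharp {H : Type*} [NormedAddCommGroup H] [InnerProductSpace ℂ H] (φ : ℂ → H) :
    ℂ → H →L[ℂ] ℂ :=
  fun z => innerSL ℂ (φ (starRingEnd ℂ z))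

/-- Normalized Lebesgue measure on the circle, in the angular variable `θ ∈ (0, 2π]`. -/
def angleMeasure : Measure ℝ :=
  ENNReal.ofReal (2 * Real.pi)⁻¹ • volume.restrict (Set.Ioc 0 (2 * Real.pi))

/-- The norm of the Hardy space `H²(E)`, with value `∞` when `f` is not in `H²(E)`:
the supremum over `0 < r < 1` of the `L²`-norm on the unit circle of `ζ ↦ f (r ζ)`. -/
def hardyNorm {E : Type*} [NormedAddCommGroup E] (f : ℂ → E) : ℝ≥0∞ :=
  ⨆ r ∈ Set.Ioo (0 : ℝ) 1, eLpNorm (fun θ : ℝ => f (circleMap 0 r θ)) 2 angleMeasure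

theorem IsHol.aestronglyMeasurable_circle {E : Type*} [NormedAddCommGroup E] [NormedSpace ℂ E]
    {f : ℂ → E} (hf : IsHol f) {r : ℝ} (hr : r ∈ Set.Ioo (0 : ℝ) 1) :
    AEStronglyMeasurable (fun θ : ℝ => f (circleMap 0 r θ)) angleMeasure := by
  have hc : Continuous (fun θ : ℝ => f (circleMap 0 r θ)) := by
    refine hf.continuousOn.comp_continuous (continuous_circleMap 0 r) (fun θ => ?_)
    simp [abs_of_pos hr.1, hr.2]
  exact hc.aestronglyMeasurable

theorem hardyNorm_add_le {E : Type*} [NormedAddCommGroup E] [NormedSpace ℂ E]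
    {f g : ℂ → E} (hf : IsHol f) (hg : IsHol g) :
    hardyNorm (f + g) ≤ hardyNorm f + hardyNorm g := by
  refine iSup₂_le fun r hr => ?_
  refine (eLpNorm_add_le (hf.aestronglyMeasurable_circle hr) (hg.aestronglyMeasurable_circle hr)
    one_le_two).trans ?_
  exact add_le_add
    (le_iSup₂ (f := fun (r : ℝ) (_ : r ∈ Set.Ioo (0 : ℝ) 1) =>
      eLpNorm (fun θ : ℝ => f (circleMap 0 r θ)) 2 angleMeasure) r hr)
    (le_iSup₂ (f := fun (r : ℝ) (_ : r ∈ Set.Ioo (0 : ℝ) 1) =>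
      eLpNorm (fun θ : ℝ => g (circleMap 0 r θ)) 2 angleMeasure) r hr)

theorem hardyNorm_smul_le {E : Type*} [NormedAddCommGroup E] [NormedSpace ℂ E]
    (c : ℂ) (f : ℂ → E) : hardyNorm (c • f) ≤ ‖c‖ₑ * hardyNorm f := by
  refine iSup₂_le fun r hr => ?_
  refine (eLpNorm_const_smul_le (c := c)
    (f := fun θ : ℝ => f (circleMap 0 r θ)) (p := 2) (μ := angleMeasure)).trans ?_
  gcongr
  exact le_iSup₂ (f := fun (r : ℝ) (_ : r ∈ Set.Ioo (0 : ℝ) 1) =>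
      eLpNorm (fun θ : ℝ => f (circleMap 0 r θ)) 2 angleMeasure) r hr

/-- The Hardy space `H²(E)`. -/
def hardySpace (E : Type*) [NormedAddCommGroup E] [NormedSpace ℂ E] : Submodule ℂ (ℂ → E) where
  carrier := {f | IsHol f ∧ hardyNorm f < ∞}
  zero_mem' := ⟨differentiableOn_const 0, by simp [hardyNorm]⟩
  add_mem' := fun hf hg => ⟨hf.1.add hg.1,
    (hardyNorm_add_le hf.1 hg.1).trans_lt (ENNReal.add_lt_top.2 ⟨hf.2, hg.2⟩)⟩
  smul_mem' := fun c f hf => ⟨hf.1.const_smul c,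
    (hardyNorm_smul_le c f).trans_lt (ENNReal.mul_lt_top enorm_lt_top hf.2)⟩

/-- `𝒪₁(E)`: the functions in `𝒪(E)` with `H²(E)`-norm one. -/
def unitAnalytic (E : Type*) [NormedAddCommGroup E] [NormedSpace ℂ E] : Set (ℂ → E) :=
  {f | ExtendsAnalytically f ∧ hardyNorm f = 1}

/-- An operator `S`, given on `𝒪(E)`, is bounded from `H²(E)` to `H²(F)`: it extends to a bounded
linear operator between these spaces. -/
def IsHardyBounded {E F : Type*} [NormedAddCommGroup E] [NormedSpace ℂ E]
    [NormedAddCommGroup F] [NormedSpace ℂ F] (S : (ℂ → E) → ℂ → F) : Prop :=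
  ∃ T : hardySpace E →ₗ[ℂ] hardySpace F,
    (∃ M : ℝ≥0, ∀ f : hardySpace E, hardyNorm (T f : ℂ → F) ≤ M * hardyNorm (f : ℂ → E)) ∧
    ∀ f : hardySpace E, ExtendsAnalytically (f : ℂ → E) →
      Set.EqOn (T f : ℂ → F) (S f) (Metric.ball 0 1)

/-- The operator norm `H²(E) → H²(F)` of an operator given on `𝒪(E)`; it is `∞` if the operator
is unbounded. -/
def hardyOpNorm {E F : Type*} [NormedAddCommGroup E] [NormedSpace ℂ E]
    [NormedAddCommGroup F] [NormedSpace ℂ F] (S : (ℂ → E) → ℂ → F) : ℝ≥0∞ :=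
  ⨆ f ∈ unitAnalytic E, hardyNorm (S f)

/-- The supremum over `f ∈ 𝒪₁(H)` of `∫_𝔻 |⟨f(z), (D^{1+α} φ)(z)⟩|² (1 - |z|²) dA(z)`,
with `dA` the area measure. -/
def carlesonSup {H : Type*} [NormedAddCommGroup H] [InnerProductSpace ℂ H]
    (α : ℝ) (φ : ℂ → H) : ℝ≥0∞ :=
  ⨆ f ∈ unitAnalytic H, ∫⁻ z in Metric.ball (0 : ℂ) 1,
    ‖⟪fracD (1 + α) φ z, f z⟫_ℂ‖ₑ ^ 2 * ENNReal.ofReal (1 - ‖z‖ ^ 2)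

end

/-! Put x = log(1/|z|²) and let f = ∑ aₘzᵐ, p = ∑ pₙzⁿ. Since ∫ |z|^{2k} x^α dA =
πΓ(α+1)(1+k)^{-1-α} over the disc, the Hankel form ∑ pₙ⟨φ(m+n), aₘ⟩ is, up to the factor πΓ(α+1),
the integral of p⟨D^{1+α}φ, f⟩x^α dA; the resulting bound is `enorm_hankelForm_le`. Both
inequalities follow from it, with constants independent of the space because H enters only through
Parseval and Cauchy-Schwarz.

Carleson to Hankel (`exists_hankel_le_carleson`) is duality. Cauchy-Schwarz splits the integral into
the Carleson integral of f and a weighted Bergman norm of p, which is comparable to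
∑(1+n)^{-2α}|pₙ|², the norm dual to that of D^αΓf. The extremal p gives the bound.

Hankel to Carleson (`exists_carleson_le_hankel`) is harder. Testing on geometric sequences gives the
Bloch bound |⟨D^{1+α}φ(w), x⟩| ≲ ‖x‖/(1-|w|²) (`HankelBound.bloch`). For fixed z, ⟨D^{1+α}φ(z),
f(z)⟩ is then compared with the antianalytic function `coHankel`, whose weighted Bergman norm is at
most a multiple of ‖D^αΓf‖ (`lintegral_coHankel_le`). The difference is the Hankel form of the pair
consisting of D^{1+α} of the kernel 1/(1-z̄w) and the increment f(z)-f(w). The kernel derivative is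
d(w)/(1-z̄w) with smaller coefficients d, and the free denominator is moved to the increment,
producing the quotient (f(z)-f(w))/(1-z̄w). The Bloch bound and Cauchy-Schwarz now remove φ
(`exists_enorm_sub_coHankel_le`), leaving a double integral of the squared quotient. On each circle
in z, its Taylor coefficients in w are orthogonal series in the aₘ, so the double integral is
diagonal in aₘ and is bounded by ‖f‖² through an explicit estimate (`exists_tsum_diffWeight_le`).

The passage from coefficients to operators on Hardy spaces is by scaling and by truncation. -/

noncomputable section

universe u

/-! ### Power series with vector coefficients -/

section PowerSeries

variable {E : Type*} [NormedAddCommGroup E]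

/-- The power series with coefficients `c` has radius of convergence at least `R`. -/
def ConvergesTo (c : ℕ → E) (R : ℝ) : Prop :=
  ∀ r : ℝ, 0 ≤ r → r < R → Summable fun n => ‖c n‖ * r ^ n

theorem ConvergesTo.mono {c : ℕ → E} {R R' : ℝ} (h : ConvergesTo c R) (hR : R' ≤ R) :
    ConvergesTo c R' := fun r h0 hr => h r h0 (hr.trans_le hR)

/-- Abel's lemma: at an intermediate radius s the terms are dominated by a geometric series of ratio
r/s. -/
theorem ConvergesTo.of_bounded {c : ℕ → E} {R : ℝ}
    (h : ∀ r : ℝ, 0 ≤ r → r < R → ∃ A, ∀ n, ‖c n‖ * r ^ n ≤ A) : ConvergesTo c R := by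
  intro r h0 hr
  obtain ⟨s, hs1, hs2⟩ := exists_between hr
  have hs0 : 0 < s := h0.trans_lt hs1
  obtain ⟨A, hA⟩ := h s hs0.le hs2
  have hg : Summable fun n : ℕ => A * (r / s) ^ n :=
    (summable_geometric_of_lt_one (by positivity) ((div_lt_one hs0).2 hs1)).mul_left A
  refine Summable.of_nonneg_of_le (fun n => by positivity) (fun n => ?_) hg
  have : ‖c n‖ * r ^ n = (‖c n‖ * s ^ n) * (r / s) ^ n := by
    rw [div_pow]; field_simp
  rw [this]
  exact mul_le_mul_of_nonneg_right (hA n) (by positivity)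

theorem ConvergesTo.bounded {c : ℕ → E} {R : ℝ} (h : ConvergesTo c R) {r : ℝ} (h0 : 0 ≤ r)
    (hr : r < R) : ∃ A, 0 ≤ A ∧ ∀ n, ‖c n‖ * r ^ n ≤ A :=
  ⟨∑' n, ‖c n‖ * r ^ n, tsum_nonneg fun _ => by positivity,
    fun n => (h r h0 hr).le_tsum n fun _ _ => by positivity⟩

variable [NormedSpace ℂ E]

/-- The sum of the power series with coefficients `c`. -/
def powerSum (c : ℕ → E) (z : ℂ) : E := ∑' n : ℕ, z ^ n • c n

theorem ConvergesTo.summable_norm {c : ℕ → E} {R : ℝ} (h : ConvergesTo c R) {z : ℂ}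
    (hz : ‖z‖ < R) : Summable fun n => ‖z ^ n • c n‖ := by
  simpa [norm_smul, mul_comm] using h ‖z‖ (norm_nonneg z) hz

theorem ConvergesTo.hasSum [CompleteSpace E] {c : ℕ → E} {R : ℝ} (h : ConvergesTo c R) {z : ℂ}
    (hz : ‖z‖ < R) : HasSum (fun n => z ^ n • c n) (powerSum c z) :=
  (h.summable_norm hz).of_norm.hasSum

theorem exists_rpow_mul_pow_le (β : ℝ) {q : ℝ} (h0 : 0 ≤ q) (h1 : q < 1) :
    ∃ A, ∀ n : ℕ, (1 + (n : ℝ)) ^ β * q ^ n ≤ A := by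
  obtain ⟨k, hk⟩ := exists_nat_ge β
  have hs : Summable fun n : ℕ => (n : ℝ) ^ k * q ^ n := by
    refine summable_pow_mul_geometric_of_norm_lt_one k ?_
    rwa [Real.norm_of_nonneg h0]
  have hs2 : Summable fun n : ℕ => (2 : ℝ) ^ k * ((n : ℝ) ^ k * q ^ n) + (2 : ℝ) ^ k * q ^ n :=
    (hs.mul_left _).add ((summable_geometric_of_lt_one h0 h1).mul_left _)
  refine ⟨∑' n : ℕ, ((2 : ℝ) ^ k * ((n : ℝ) ^ k * q ^ n) + (2 : ℝ) ^ k * q ^ n), fun n => ?_⟩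
  refine le_trans ?_ (hs2.le_tsum n fun _ _ => by positivity)
  have h3 : (1 + (n : ℝ)) ^ β ≤ (1 + (n : ℝ)) ^ k := by
    rw [← Real.rpow_natCast]
    exact Real.rpow_le_rpow_of_exponent_le (by linarith [n.cast_nonneg (α := ℝ)]) hk
  have h4 : (1 + (n : ℝ)) ^ k ≤ 2 ^ k * (n : ℝ) ^ k + 2 ^ k := by
    rcases Nat.eq_zero_or_pos n with rfl | hn
    · have : (1 : ℝ) ≤ 2 ^ k := one_le_pow₀ (by norm_num)
      have h5 : (0 : ℝ) ≤ 2 ^ k * ((0 : ℕ) : ℝ) ^ k := by positivity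
      simp only [Nat.cast_zero, add_zero, one_pow] at *
      linarith
    · have hn' : (1 : ℝ) ≤ n := by exact_mod_cast hn
      have : (1 + (n : ℝ)) ^ k ≤ (2 * n) ^ k := pow_le_pow_left₀ (by positivity) (by linarith) k
      rw [mul_pow] at this
      have h2 : (0 : ℝ) ≤ 2 ^ k := by positivity
      linarith
  calc (1 + (n : ℝ)) ^ β * q ^ n ≤ (2 ^ k * (n : ℝ) ^ k + 2 ^ k) * q ^ n :=
        mul_le_mul_of_nonneg_right (h3.trans h4) (by positivity)
    _ = _ := by ring

/-- Multiplying the coefficients by a sequence of polynomial growth preserves convergence. -/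
theorem ConvergesTo.smul_of_le {c : ℕ → E} {R : ℝ} (h : ConvergesTo c R) {m : ℕ → ℂ} {β A : ℝ}
    (hm : ∀ n, ‖m n‖ ≤ A * (1 + (n : ℝ)) ^ β) : ConvergesTo (fun n => m n • c n) R := by
  refine ConvergesTo.of_bounded fun r h0 hr => ?_
  obtain ⟨s, hs1, hs2⟩ := exists_between hr
  have hs0 : 0 < s := h0.trans_lt hs1
  obtain ⟨B, hB0, hB⟩ := h.bounded hs0.le hs2
  obtain ⟨D, hD⟩ := exists_rpow_mul_pow_le β (q := r / s) (by positivity) ((div_lt_one hs0).2 hs1)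
  have hA : 0 ≤ A := by
    have := (norm_nonneg _).trans (hm 0)
    simpa using this
  refine ⟨A * (B * D), fun n => ?_⟩
  have e : r ^ n = s ^ n * (r / s) ^ n := by rw [div_pow]; field_simp
  calc ‖m n • c n‖ * r ^ n ≤ (A * (1 + (n : ℝ)) ^ β * ‖c n‖) * r ^ n := by
        rw [norm_smul]; gcongr; exact hm n
    _ = A * ((‖c n‖ * s ^ n) * ((1 + (n : ℝ)) ^ β * (r / s) ^ n)) := by rw [e]; ring
    _ ≤ A * (B * D) := by
        gcongr
        · exact hB n
        · exact hD n

theorem ConvergesTo.rpow_smul {c : ℕ → E} {R : ℝ} (h : ConvergesTo c R) (β : ℝ) :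
    ConvergesTo (fun n => (((1 + (n : ℝ)) ^ β : ℝ) : ℂ) • c n) R :=
  h.smul_of_le (A := 1) (β := β) fun n => by
    rw [Complex.norm_real, Real.norm_of_nonneg (by positivity), one_mul]

theorem ConvergesTo.differentiableOn [CompleteSpace E] {c : ℕ → E} {R : ℝ}
    (h : ConvergesTo c R) : DifferentiableOn ℂ (powerSum c) (Metric.ball 0 R) := by
  intro z hz
  have hz' : ‖z‖ < R := by simpa using hz
  obtain ⟨s, hs1, hs2⟩ := exists_between hz'
  have hd : DifferentiableOn ℂ (powerSum c) (Metric.ball 0 s) := by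
    refine Complex.differentiableOn_tsum_of_summable_norm
      (h s ((norm_nonneg z).trans hs1.le) hs2) (fun i => ?_) Metric.isOpen_ball fun i w hw => ?_
    · exact ((differentiable_pow i).smul_const (c i)).differentiableOn
    · have hw' : ‖w‖ ≤ s := by simpa using (Metric.mem_ball.1 hw).le
      rw [norm_smul, norm_pow, mul_comm]
      gcongr
  exact ((hd z (by simpa using hs1)).differentiableAt
    (Metric.isOpen_ball.mem_nhds (by simpa using hs1))).differentiableWithinAt

theorem IsHol.hasSum [CompleteSpace E] {f : ℂ → E} {R : ℝ}
    (hf : DifferentiableOn ℂ f (Metric.ball 0 R)) {z : ℂ} (hz : ‖z‖ < R) :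
    HasSum (fun n => z ^ n • taylorCoeff f n) (f z) := by
  have := Complex.hasSum_taylorSeries_on_ball hf (z := z) (by simpa using hz)
  convert this using 2 with n
  rw [taylorCoeff, sub_zero, smul_comm]

theorem convergesTo_taylorCoeff [CompleteSpace E] {f : ℂ → E} {R : ℝ}
    (hf : DifferentiableOn ℂ f (Metric.ball 0 R)) : ConvergesTo (taylorCoeff f) R := by
  refine ConvergesTo.of_bounded fun r h0 hr => ?_
  have hs := (IsHol.hasSum hf (z := (r : ℂ))
    (by rwa [Complex.norm_real, Real.norm_of_nonneg h0])).summable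
  obtain ⟨A, hA⟩ := hs.tendsto_atTop_zero.norm.bddAbove_range
  refine ⟨A, fun n => ?_⟩
  have := hA ⟨n, rfl⟩
  simp only [norm_smul, norm_pow, Complex.norm_real, Real.norm_of_nonneg h0] at this
  rwa [mul_comm]

theorem IsHol.eq_powerSum [CompleteSpace E] {f : ℂ → E} {R : ℝ}
    (hf : DifferentiableOn ℂ f (Metric.ball 0 R)) {z : ℂ} (hz : ‖z‖ < R) :
    f z = powerSum (taylorCoeff f) z := (IsHol.hasSum hf hz).tsum_eq.symm

/-- Uniqueness of Taylor coefficients. -/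
theorem taylorCoeff_eq_of_hasSum [CompleteSpace E] {f : ℂ → E} {c : ℕ → E} {R : ℝ} (hR : 0 < R)
    (hc : ConvergesTo c R) (h : Set.EqOn f (powerSum c) (Metric.ball 0 R)) :
    taylorCoeff f = c := by
  have hf : DifferentiableOn ℂ f (Metric.ball 0 R) := hc.differentiableOn.congr h
  let p (d : ℕ → E) : FormalMultilinearSeries ℂ ℂ E :=
    fun n => ContinuousMultilinearMap.mkPiRing ℂ (Fin n) (d n)
  have hp : ∀ d n, (p d).coeff n = d n := fun d n => by
    simp [p, FormalMultilinearSeries.coeff]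
  have key : ∀ d : ℕ → E, (∀ z : ℂ, ‖z‖ < R → HasSum (fun n => z ^ n • d n) (f z)) →
      HasFPowerSeriesAt f (p d) 0 := by
    intro d hd
    rw [hasFPowerSeriesAt_iff]
    filter_upwards [Metric.ball_mem_nhds (0 : ℂ) hR] with z hz
    simpa [hp] using hd z (by simpa using hz)
  have e := (key (taylorCoeff f) fun z hz => IsHol.hasSum hf hz).eq_formalMultilinearSeries
    (key c fun z hz => by rw [h (by simpa using hz)]; exact hc.hasSum hz)
  funext n
  rw [← hp (taylorCoeff f) n, e, hp]

theorem taylorCoeff_powerSum [CompleteSpace E] {c : ℕ → E} {R : ℝ} (hR : 0 < R)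
    (hc : ConvergesTo c R) : taylorCoeff (powerSum c) = c :=
  taylorCoeff_eq_of_hasSum hR hc fun _ _ => rfl

theorem taylorCoeff_congr {f g : ℂ → E} (h : Set.EqOn f g (Metric.ball 0 1)) :
    taylorCoeff f = taylorCoeff g := by
  funext n
  rw [taylorCoeff, taylorCoeff, Filter.EventuallyEq.iteratedDeriv_eq]
  exact h.eventuallyEq_of_mem (Metric.ball_mem_nhds _ one_pos)

theorem ExtendsAnalytically.isHol {f : ℂ → E} (h : ExtendsAnalytically f) : IsHol f := by
  obtain ⟨R, hR, g, hg, e⟩ := h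
  exact (hg.mono (Metric.ball_subset_ball hR.le)).congr e

theorem ExtendsAnalytically.convergesTo [CompleteSpace E] {f : ℂ → E}
    (h : ExtendsAnalytically f) : ∃ R, 1 < R ∧ ConvergesTo (taylorCoeff f) R := by
  obtain ⟨R, hR, g, hg, e⟩ := h
  exact ⟨R, hR, by rw [taylorCoeff_congr e]; exact convergesTo_taylorCoeff hg⟩

theorem fracD_eq (β : ℝ) (f : ℂ → E) :
    fracD β f = powerSum fun n => (((1 + (n : ℝ)) ^ β : ℝ) : ℂ) • taylorCoeff f n := by
  funext z
  simp only [fracD, powerSum]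
  congr 1
  funext n
  rw [smul_comm]

end PowerSeries

/-! ### Parseval's identity on the circle -/

instance isProbabilityMeasure_angleMeasure : IsProbabilityMeasure angleMeasure := by
  constructor
  have h : (0 : ℝ) < 2 * Real.pi := by positivity
  rw [angleMeasure, Measure.smul_apply, Measure.restrict_apply_univ, Real.volume_Ioc, sub_zero,
    smul_eq_mul, ← ENNReal.ofReal_mul (by positivity), inv_mul_cancel₀ h.ne', ENNReal.ofReal_one]

theorem integral_exp_angleMeasure (k : ℤ) :
    ∫ θ : ℝ, Complex.exp (k * θ * Complex.I) ∂angleMeasure = if k = 0 then 1 else 0 := by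
  split_ifs with h
  · simp [h]
  · have hc : (k : ℂ) * Complex.I ≠ 0 := mul_ne_zero (by exact_mod_cast h) Complex.I_ne_zero
    rw [angleMeasure, integral_smul_measure,
      ← intervalIntegral.integral_of_le (by positivity : (0 : ℝ) ≤ 2 * Real.pi)]
    have e : ∀ θ : ℝ, Complex.exp (k * θ * Complex.I) = Complex.exp (k * Complex.I * θ) :=
      fun θ => by congr 1; ring
    simp_rw [e]
    rw [integral_exp_mul_complex hc]
    have : Complex.exp (k * Complex.I * ((2 * Real.pi : ℝ) : ℂ)) = 1 := by
      rw [← Complex.exp_int_mul_two_pi_mul_I k]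
      congr 1; push_cast; ring
    rw [this]
    simp

section Parseval

variable {E : Type*} [NormedAddCommGroup E] [InnerProductSpace ℂ E] [CompleteSpace E]
  {ι ι' : Type*}

theorem norm_exp_int_mul (k : ℤ) (θ : ℝ) : ‖Complex.exp (k * θ * Complex.I)‖ = 1 := by
  have : (k : ℂ) * θ * Complex.I = ((k * θ : ℝ) : ℂ) * Complex.I := by push_cast; ring
  rw [this, Complex.norm_exp_ofReal_mul_I]

theorem continuous_trigSeries (κ : ι → ℤ) {c : ι → E} (hc : Summable fun i => ‖c i‖) :
    Continuous fun θ : ℝ => ∑' i, Complex.exp (κ i * θ * Complex.I) • c i := by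
  refine continuous_tsum (fun i => by fun_prop) hc fun i θ => ?_
  rw [norm_smul, norm_exp_int_mul, one_mul]

variable [Countable ι] [Countable ι']

/-- Sesquilinear Parseval identity for absolutely convergent trigonometric series. -/
theorem integral_inner_trigSeries {κ : ι → ℤ} (hκ : Function.Injective κ) {c : ι → E}
    (hc : Summable fun i => ‖c i‖) (l : ι' → ι) {d : ι' → E} (hd : Summable fun j => ‖d j‖) :
    ∫ θ : ℝ, ⟪∑' i, Complex.exp (κ i * θ * Complex.I) • c i,
      ∑' j, Complex.exp (κ (l j) * θ * Complex.I) • d j⟫_ℂ ∂angleMeasure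
      = ∑' j, ⟪c (l j), d j⟫_ℂ := by
  classical
  -- The map `l` need not be injective: the second series may repeat frequencies, so that a product
  -- of power series can be used without regrouping it by degree.
  let F : ι' × ι → ℝ → ℂ := fun p θ =>
    Complex.exp (((κ (l p.1) - κ p.2 : ℤ) : ℂ) * θ * Complex.I) * ⟪c p.2, d p.1⟫_ℂ
  have hFn : ∀ p θ, ‖F p θ‖ = ‖⟪c p.2, d p.1⟫_ℂ‖ := fun p θ => by
    simp only [F, norm_mul, norm_exp_int_mul, one_mul]
  have hS : Summable fun p : ι' × ι => ‖⟪c p.2, d p.1⟫_ℂ‖ := by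
    refine Summable.of_nonneg_of_le (fun _ => norm_nonneg _) (fun p => ?_)
      (hd.mul_of_nonneg hc (fun _ => norm_nonneg _) fun _ => norm_nonneg _)
    rw [mul_comm]
    exact norm_inner_le_norm _ _
  have hpt : ∀ θ : ℝ, ⟪∑' i, Complex.exp (κ i * θ * Complex.I) • c i,
      ∑' j, Complex.exp (κ (l j) * θ * Complex.I) • d j⟫_ℂ = ∑' p, F p θ := by
    intro θ
    have hsF : Summable fun p => F p θ := Summable.of_norm (by simpa only [hFn] using hS)
    have h1 : Summable fun i => Complex.exp (κ i * θ * Complex.I) • c i :=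
      Summable.of_norm (by simpa only [norm_smul, norm_exp_int_mul, one_mul] using hc)
    have h2 : Summable fun j => Complex.exp (κ (l j) * θ * Complex.I) • d j :=
      Summable.of_norm (by simpa only [norm_smul, norm_exp_int_mul, one_mul] using hd)
    rw [hsF.tsum_prod, ← innerSL_apply_apply ℂ, ContinuousLinearMap.map_tsum _ h2]
    refine tsum_congr fun j => ?_
    rw [innerSL_apply_apply, ← inner_conj_symm, ← innerSL_apply_apply ℂ,
      ContinuousLinearMap.map_tsum _ h1, Complex.conj_tsum]
    refine tsum_congr fun i => ?_
    simp only [innerSL_apply_apply, F]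
    rw [inner_conj_symm, inner_smul_left, inner_smul_right, ← mul_assoc, ← Complex.exp_conj,
      ← Complex.exp_add]
    congr 2
    simp only [map_mul, Complex.conj_I, Complex.conj_ofReal, map_intCast]
    push_cast
    ring
  have hcont : ∀ p, Continuous (F p) := fun p => by fun_prop
  have hint : ∀ p, Integrable (F p) angleMeasure := fun p =>
    Integrable.of_bound (hcont p).aestronglyMeasurable ‖⟪c p.2, d p.1⟫_ℂ‖
      (Filter.Eventually.of_forall fun θ => (hFn p θ).le)
  have h := hasSum_integral_of_summable_integral_norm hint (by simpa [hFn] using hS)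
  simp_rw [hpt]
  rw [← h.tsum_eq]
  have hval : ∀ p : ι' × ι, ∫ θ, F p θ ∂angleMeasure
      = if p.2 = l p.1 then ⟪c p.2, d p.1⟫_ℂ else 0 := by
    intro p
    simp only [F]
    rw [integral_mul_const, integral_exp_angleMeasure]
    have : κ (l p.1) - κ p.2 = 0 ↔ p.2 = l p.1 := by
      rw [sub_eq_zero]; exact ⟨fun h => (hκ h).symm, fun h => by rw [h]⟩
    simp only [this, ite_mul, one_mul, zero_mul]
  simp_rw [hval]
  rw [Summable.tsum_prod]
  · refine tsum_congr fun j => ?_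
    simp
  · refine Summable.of_norm (Summable.of_nonneg_of_le (fun _ => norm_nonneg _) (fun p => ?_) hS)
    split_ifs <;> simp

theorem tsum_enorm_sq_eq {ι E : Type*} [NormedAddCommGroup E] {c : ι → E}
    (h : Summable fun i => ‖c i‖ ^ 2) :
    ∑' i, ‖c i‖ₑ ^ 2 = ENNReal.ofReal (∑' i, ‖c i‖ ^ 2) := by
  rw [ENNReal.ofReal_tsum_of_nonneg (fun _ => by positivity) h]
  refine tsum_congr fun i => ?_
  rw [ENNReal.ofReal_pow (norm_nonneg _), ofReal_norm]

/-- Parseval's identity for absolutely convergent trigonometric series. -/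
theorem lintegral_enorm_sq_trigSeries {κ : ι → ℤ} (hκ : Function.Injective κ) {c : ι → E}
    (hc : Summable fun i => ‖c i‖) :
    ∫⁻ θ : ℝ, ‖∑' i, Complex.exp (κ i * θ * Complex.I) • c i‖ₑ ^ 2 ∂angleMeasure
      = ∑' i, ‖c i‖ₑ ^ 2 := by
  set G : ℝ → E := fun θ => ∑' i, Complex.exp (κ i * θ * Complex.I) • c i with hG
  have hcont : Continuous G := continuous_trigSeries κ hc
  have hb : ∀ θ, ‖G θ‖ ≤ ∑' i, ‖c i‖ := fun θ => by
    have h1 : Summable fun i => ‖Complex.exp (κ i * θ * Complex.I) • c i‖ := by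
      simpa only [norm_smul, norm_exp_int_mul, one_mul] using hc
    refine (norm_tsum_le_tsum_norm h1).trans (le_of_eq ?_)
    simp only [norm_smul, norm_exp_int_mul, one_mul]
  have h2 : Summable fun i => ‖c i‖ ^ 2 := by
    have h0 := hc.tendsto_cofinite_zero.eventually (gt_mem_nhds one_pos)
    refine Summable.of_norm_bounded_eventually hc ?_
    filter_upwards [h0] with i hi
    rw [norm_pow, norm_norm]
    nlinarith [norm_nonneg (c i)]
  have hint : Integrable (fun θ => ‖G θ‖ ^ 2) angleMeasure :=
    Integrable.of_bound (by fun_prop) ((∑' i, ‖c i‖) ^ 2)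
      (Filter.Eventually.of_forall fun θ => by
        rw [norm_pow, norm_norm]; exact pow_le_pow_left₀ (norm_nonneg _) (hb θ) 2)
  have e := integral_inner_trigSeries hκ hc (fun i : ι => i) hc
  rw [tsum_enorm_sq_eq h2]
  have : ∫ θ, ‖G θ‖ ^ 2 ∂angleMeasure = ∑' i, ‖c i‖ ^ 2 := by
    have e2 : (∫ θ, (((‖G θ‖ ^ 2 : ℝ)) : ℂ) ∂angleMeasure) = ((∑' i, ‖c i‖ ^ 2 : ℝ) : ℂ) := by
      rw [Complex.ofReal_tsum]
      simpa [inner_self_eq_norm_sq_to_K] using e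
    rw [integral_complex_ofReal] at e2
    exact_mod_cast e2
  rw [← this, ofReal_integral_eq_lintegral_ofReal hint
    (Filter.Eventually.of_forall fun θ => by positivity)]
  refine lintegral_congr fun θ => ?_
  rw [ENNReal.ofReal_pow (norm_nonneg _), ofReal_norm]

end Parseval

/-! ### Integration over the disc in exponential polar coordinates -/

theorem norm_circleMap_zero_of_nonneg {r : ℝ} (hr : 0 ≤ r) (θ : ℝ) : ‖circleMap 0 r θ‖ = r := by
  simp [abs_of_nonneg hr]

theorem circleMap_exp_mem_ball {x : ℝ} (hx : 0 < x) (θ : ℝ) :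
    circleMap 0 (Real.exp (-x / 2)) θ ∈ Metric.ball (0 : ℂ) 1 := by
  rw [mem_ball_zero_iff, norm_circleMap_zero_of_nonneg (Real.exp_pos _).le]
  exact Real.exp_lt_one_iff.2 (by linarith)

/-- The polar chart has angles in (-π, π) while `angleMeasure` lives on (0, 2π]; the shift by π is
the change of sign of z. -/
theorem setLIntegral_circle_eq (g : ℂ → ℝ≥0∞) (r : ℝ) :
    ∫⁻ θ in Set.Ioo (-Real.pi) Real.pi, g (-(Complex.polarCoord.symm (r, θ)))
      = ENNReal.ofReal (2 * Real.pi) * ∫⁻ θ, g (circleMap 0 r θ) ∂angleMeasure := by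
  have hp : (0 : ℝ) < 2 * Real.pi := by positivity
  rw [angleMeasure, lintegral_smul_measure, smul_eq_mul, ← mul_assoc, ← ENNReal.ofReal_mul hp.le,
    mul_inv_cancel₀ hp.ne', ENNReal.ofReal_one, one_mul,
    ← Measure.restrict_congr_set (Ioo_ae_eq_Ioc (a := 0) (b := 2 * Real.pi)),
    ← (measurePreserving_add_right volume Real.pi).setLIntegral_comp_preimage_emb
      (measurableEmbedding_addRight Real.pi) (fun θ => g (circleMap 0 r θ))]
  have : (fun x : ℝ => x + Real.pi) ⁻¹' Set.Ioo 0 (2 * Real.pi) = Set.Ioo (-Real.pi) Real.pi := by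
    ext x
    simp only [Set.mem_preimage, Set.mem_Ioo]
    constructor <;> rintro ⟨h1, h2⟩ <;> constructor <;> linarith
  rw [this]
  refine lintegral_congr fun θ => ?_
  congr 1
  rw [Complex.polarCoord_symm_apply, circleMap, zero_add, Complex.ofReal_add, add_mul,
    Complex.exp_add, Complex.exp_pi_mul_I, Complex.exp_mul_I]
  simp
  ring

theorem image_exp_neg_half : (fun x : ℝ => Real.exp (-x / 2)) '' Set.Ioi 0 = Set.Ioo 0 1 := by
  ext r
  constructor
  · rintro ⟨x, hx, rfl⟩
    exact ⟨Real.exp_pos _, Real.exp_lt_one_iff.2 (by have := Set.mem_Ioi.1 hx; linarith)⟩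
  · rintro ⟨h0, h1⟩
    refine ⟨-2 * Real.log r, ?_, ?_⟩
    · have := Real.log_neg h0 h1
      rw [Set.mem_Ioi]; linarith
    · show Real.exp (-(-2 * Real.log r) / 2) = r
      rw [show -(-2 * Real.log r) / 2 = Real.log r by ring, Real.exp_log h0]

/-- The substitution r = exp(-x/2) gives |z|² = exp(-x) and r dr = exp(-x) dx/2, up to orientation.
Powers of |z|² become exponentials, so all radial moments below are Gamma integrals. -/
theorem lintegral_ball_eq {g : ℂ → ℝ≥0∞}
    (hg : Measurable fun z : Metric.ball (0 : ℂ) 1 => g z) :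
    ∫⁻ z in Metric.ball (0 : ℂ) 1, g z = ENNReal.ofReal Real.pi *
      ∫⁻ x in Set.Ioi (0 : ℝ), ENNReal.ofReal (Real.exp (-x)) *
        ∫⁻ θ, g (circleMap 0 (Real.exp (-x / 2)) θ) ∂angleMeasure := by
  -- Measurability is known on the disc only; extension by zero gives a measurable function on the
  -- plane.
  set G : ℂ → ℝ≥0∞ := (Metric.ball (0 : ℂ) 1).indicator g with hG
  have hmeas : Measurable G := by
    refine measurable_of_restrict_of_restrict_compl
      (Metric.isOpen_ball (x := (0 : ℂ)) (ε := 1)).measurableSet ?_ ?_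
    · convert hg using 1
      funext z
      simp only [G, Set.domRestrict_apply]
      exact Set.indicator_of_mem z.2 g
    · convert measurable_const (a := (0 : ℝ≥0∞)) using 1
      funext z
      simp only [G, Set.domRestrict_apply]
      exact Set.indicator_of_notMem z.2 g
  have h1 : ∫⁻ z in Metric.ball (0 : ℂ) 1, g z = ∫⁻ z, G (-z) := by
    rw [← lintegral_indicator Metric.isOpen_ball.measurableSet]
    exact (lintegral_neg_eq_self (μ := (volume : Measure ℂ)) G).symm
  have hpm : Measurable fun p : ℝ × ℝ => Complex.polarCoord.symm p := by
    have : (fun p : ℝ × ℝ => Complex.polarCoord.symm p)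
        = fun p : ℝ × ℝ => (p.1 : ℂ) * (Real.cos p.2 + Real.sin p.2 * Complex.I) :=
      funext fun p => Complex.polarCoord_symm_apply p
    rw [this]
    fun_prop
  rw [h1, ← Complex.lintegral_comp_polarCoord_symm, polarCoord_target,
    Measure.volume_eq_prod, ← Measure.prod_restrict, lintegral_prod]
  swap
  · exact ((by fun_prop : Measurable fun p : ℝ × ℝ => ENNReal.ofReal p.1).smul
      (hmeas.comp hpm.neg)).aemeasurable
  have h2 : ∀ r : ℝ, ∫⁻ θ in Set.Ioo (-Real.pi) Real.pi,
      ENNReal.ofReal r • G (-(Complex.polarCoord.symm (r, θ)))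
      = ENNReal.ofReal r * (ENNReal.ofReal (2 * Real.pi) *
        ∫⁻ θ, G (circleMap 0 r θ) ∂angleMeasure) := by
    intro r
    rw [← setLIntegral_circle_eq]
    simp only [smul_eq_mul]
    exact lintegral_const_mul _ (hmeas.comp (hpm.comp measurable_prodMk_left).neg)
  simp_rw [h2]
  have h3 : ∫⁻ r in Set.Ioi (0 : ℝ), ENNReal.ofReal r * (ENNReal.ofReal (2 * Real.pi) *
        ∫⁻ θ, G (circleMap 0 r θ) ∂angleMeasure)
      = ∫⁻ r in Set.Ioo (0 : ℝ) 1, ENNReal.ofReal r * (ENNReal.ofReal (2 * Real.pi) *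
        ∫⁻ θ, G (circleMap 0 r θ) ∂angleMeasure) := by
    have hS : Set.Iio (1 : ℝ) ∩ Set.Ioi 0 = Set.Ioo 0 1 := by rw [Set.inter_comm]; rfl
    rw [← hS, ← setLIntegral_indicator measurableSet_Iio]
    refine setLIntegral_congr_fun measurableSet_Ioi fun r h0 => ?_
    by_cases hr : r ∈ Set.Iio (1 : ℝ)
    · rw [Set.indicator_of_mem hr]
    rw [Set.indicator_of_notMem hr]
    have : ∀ θ, G (circleMap 0 r θ) = 0 := fun θ => by
      refine Set.indicator_of_notMem ?_ g
      rw [mem_ball_zero_iff, norm_circleMap_zero_of_nonneg (le_of_lt h0)]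
      exact hr
    simp [this]
  rw [h3, ← image_exp_neg_half, lintegral_image_eq_lintegral_abs_deriv_mul measurableSet_Ioi
    (f' := fun x => Real.exp (-x / 2) * (-1 / 2)) (fun x _ => by
      have : HasDerivAt (fun x : ℝ => -x / 2) (-1 / 2) x := (hasDerivAt_id x).neg.div_const 2
      exact this.exp.hasDerivWithinAt)
    (fun x _ y _ h => by have := Real.exp_injective h; linarith),
    ← lintegral_const_mul' _ _ ENNReal.ofReal_ne_top]
  refine setLIntegral_congr_fun measurableSet_Ioi fun x hx => ?_
  have h4 : ∀ θ, G (circleMap 0 (Real.exp (-x / 2)) θ) = g (circleMap 0 (Real.exp (-x / 2)) θ) :=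
    fun θ => Set.indicator_of_mem (circleMap_exp_mem_ball hx θ) g
  simp only [h4]
  rw [← mul_assoc, ← mul_assoc, ← mul_assoc, ← ENNReal.ofReal_mul (abs_nonneg _),
    ← ENNReal.ofReal_mul (by positivity), ← ENNReal.ofReal_mul (by positivity)]
  congr 2
  rw [abs_mul, abs_of_pos (Real.exp_pos _)]
  have : Real.exp (-x) = Real.exp (-x / 2) * Real.exp (-x / 2) := by
    rw [← Real.exp_add]; congr 1; ring
  rw [this]
  norm_num
  ring

theorem lintegral_rpow_mul_exp {β r : ℝ} (hβ : -1 < β) (hr : 0 < r) :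
    ∫⁻ x in Set.Ioi (0 : ℝ), ENNReal.ofReal (x ^ β * Real.exp (-(r * x)))
      = ENNReal.ofReal (Real.Gamma (β + 1) * r ^ (-(β + 1))) := by
  have h := Real.integral_rpow_mul_exp_neg_mul_Ioi (a := β + 1) (r := r) (by linarith) hr
  simp only [add_sub_cancel_right] at h
  have hpos : 0 < (1 / r) ^ (β + 1) * Real.Gamma (β + 1) :=
    mul_pos (by positivity) (Real.Gamma_pos_of_pos (by linarith))
  have hi : IntegrableOn (fun x => x ^ β * Real.exp (-(r * x))) (Set.Ioi 0) := by
    -- A nonintegrable function has integral 0 by convention, contradicting the positive value in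
    -- `h`.
    by_contra hc
    rw [integral_undef hc] at h
    exact hpos.ne h
  rw [← ofReal_integral_eq_lintegral_ofReal hi, h, mul_comm, one_div,
    Real.inv_rpow hr.le, Real.rpow_neg hr.le]
  filter_upwards [ae_restrict_mem measurableSet_Ioi] with x hx
  have : 0 < x := hx
  positivity

theorem circleMap_pow (r θ : ℝ) (n : ℕ) :
    circleMap 0 r θ ^ n = (r : ℂ) ^ n * Complex.exp (((n : ℤ) : ℂ) * θ * Complex.I) := by
  rw [circleMap, zero_add, mul_pow, ← Complex.exp_nat_mul]
  congr 2
  push_cast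
  ring

section

variable {E : Type*} [NormedAddCommGroup E] [InnerProductSpace ℂ E] [CompleteSpace E]

theorem lintegral_circle_powerSum {c : ℕ → E} {R : ℝ} (hc : ConvergesTo c R) {r : ℝ} (h0 : 0 ≤ r)
    (hr : r < R) : ∫⁻ θ, ‖powerSum c (circleMap 0 r θ)‖ₑ ^ 2 ∂angleMeasure
      = ∑' n, ENNReal.ofReal (r ^ (2 * n)) * ‖c n‖ₑ ^ 2 := by
  have hs : Summable fun n => ‖(r : ℂ) ^ n • c n‖ :=
    hc.summable_norm (z := (r : ℂ)) (by rwa [Complex.norm_real, Real.norm_of_nonneg h0])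
  have h := lintegral_enorm_sq_trigSeries (κ := fun n : ℕ => (n : ℤ)) Nat.cast_injective hs
  simp only [powerSum, circleMap_pow]
  rw [show (fun n => ENNReal.ofReal (r ^ (2 * n)) * ‖c n‖ₑ ^ 2)
    = fun n => ‖(r : ℂ) ^ n • c n‖ₑ ^ 2 from ?_, ← h]
  · refine lintegral_congr fun θ => ?_
    congr 3
    funext n
    rw [smul_smul, mul_comm]
  · funext n
    have : ‖(r : ℂ)‖ₑ = ENNReal.ofReal r := by
      rw [← ofReal_norm, Complex.norm_real, Real.norm_of_nonneg h0]
    rw [enorm_smul, mul_pow, enorm_pow, ← pow_mul, mul_comm 2 n, ENNReal.ofReal_pow h0, this]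

theorem measurable_powerSum {c : ℕ → E} (hc : ConvergesTo c 1) :
    Measurable fun z : Metric.ball (0 : ℂ) 1 => ‖powerSum c z‖ₑ := by
  have h : Continuous fun z : Metric.ball (0 : ℂ) 1 => powerSum c z :=
    hc.differentiableOn.continuousOn.domRestrict
  exact h.enorm.measurable

theorem neg_two_mul_log_norm_circleMap (x θ : ℝ) :
    -2 * Real.log ‖circleMap 0 (Real.exp (-x / 2)) θ‖ = x := by
  rw [norm_circleMap_zero_of_nonneg (Real.exp_pos _).le, Real.log_exp]
  ring

/-- Monomials are orthogonal for every radial weight. In the variable x the squared norm of zⁿ is π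
times the Laplace transform of the weight at 1 + n. -/
theorem lintegral_ball_powerSum {c : ℕ → E} (hc : ConvergesTo c 1) {W : ℝ → ℝ≥0∞}
    (hW : Measurable W) :
    ∫⁻ z in Metric.ball (0 : ℂ) 1, ‖powerSum c z‖ₑ ^ 2 * W (-2 * Real.log ‖z‖)
      = ENNReal.ofReal Real.pi * ∑' n : ℕ, ‖c n‖ₑ ^ 2 *
        ∫⁻ x in Set.Ioi (0 : ℝ), ENNReal.ofReal (Real.exp (-((1 + n) * x))) * W x := by
  have hm : Measurable fun z : Metric.ball (0 : ℂ) 1 =>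
      ‖powerSum c z‖ₑ ^ 2 * W (-2 * Real.log ‖(z : ℂ)‖) :=
    ((measurable_powerSum hc).pow_const 2).mul (hW.comp (by fun_prop))
  rw [lintegral_ball_eq hm]
  congr 1
  have hterm : ∀ n : ℕ, Measurable fun x : ℝ =>
      ENNReal.ofReal (Real.exp (-((1 + n) * x))) * W x := fun n =>
    (by fun_prop : Measurable fun x : ℝ => ENNReal.ofReal (Real.exp (-((1 + n) * x)))).mul hW
  simp_rw [← lintegral_const_mul _ (hterm _)]
  rw [← lintegral_tsum fun n => ((hterm n).const_mul _).aemeasurable]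
  refine setLIntegral_congr_fun measurableSet_Ioi fun x hx => ?_
  have hx' : (0 : ℝ) < x := hx
  simp only [neg_two_mul_log_norm_circleMap]
  have hlt : Real.exp (-x / 2) < 1 := Real.exp_lt_one_iff.2 (by linarith)
  have hc' : Continuous fun θ : ℝ => powerSum c (circleMap 0 (Real.exp (-x / 2)) θ) :=
    hc.differentiableOn.continuousOn.comp_continuous (continuous_circleMap _ _)
      fun θ => circleMap_exp_mem_ball hx' θ
  rw [lintegral_mul_const _ (hc'.enorm.measurable.pow_const 2),
    lintegral_circle_powerSum hc (Real.exp_pos _).le hlt, ← ENNReal.tsum_mul_right,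
    ← ENNReal.tsum_mul_left]
  refine tsum_congr fun n => ?_
  have e : Real.exp (-((1 + n) * x)) = Real.exp (-x) * Real.exp (-x / 2) ^ (2 * n) := by
    rw [← Real.exp_nat_mul, ← Real.exp_add]
    congr 1
    push_cast
    ring
  rw [e, ENNReal.ofReal_mul (Real.exp_pos _).le]
  ring

/-- The Hardy norm in terms of Taylor coefficients. -/
theorem hardyNorm_sq {f : ℂ → E} (hf : IsHol f) :
    hardyNorm f ^ 2 = ∑' n, ‖taylorCoeff f n‖ₑ ^ 2 := by
  have hc : ConvergesTo (taylorCoeff f) 1 := convergesTo_taylorCoeff hf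
  have h1 : ∀ r ∈ Set.Ioo (0 : ℝ) 1, eLpNorm (fun θ : ℝ => f (circleMap 0 r θ)) 2 angleMeasure ^ 2
      = ∑' n, ENNReal.ofReal (r ^ (2 * n)) * ‖taylorCoeff f n‖ₑ ^ 2 := by
    intro r hr
    rw [← lintegral_circle_powerSum hc hr.1.le hr.2]
    have := eLpNorm_nnreal_pow_eq_lintegral (f := fun θ : ℝ => f (circleMap 0 r θ))
      (μ := angleMeasure) (p := 2) two_ne_zero
    simp only [NNReal.coe_ofNat, ENNReal.coe_ofNat, ENNReal.rpow_ofNat] at this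
    rw [this]
    refine lintegral_congr fun θ => ?_
    rw [IsHol.eq_powerSum hf]
    rw [norm_circleMap_zero_of_nonneg hr.1.le]
    exact hr.2
  apply le_antisymm
  · rw [← ENNReal.rpow_ofNat, ← ENNReal.le_rpow_inv_iff two_pos]
    refine iSup₂_le fun r hr => ?_
    rw [ENNReal.le_rpow_inv_iff two_pos, ENNReal.rpow_ofNat, h1 r hr]
    refine ENNReal.tsum_le_tsum fun n => ?_
    refine mul_le_of_le_one_left' ?_
    rw [← ENNReal.ofReal_one]
    exact ENNReal.ofReal_le_ofReal (pow_le_one₀ hr.1.le hr.2.le)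
  -- For the lower bound r tends to 1 in each finite partial sum.
  · rw [ENNReal.tsum_eq_iSup_sum]
    refine iSup_le fun s => ?_
    have h2 : ∀ r ∈ Set.Ioo (0 : ℝ) 1,
        ∑ n ∈ s, ENNReal.ofReal (r ^ (2 * n)) * ‖taylorCoeff f n‖ₑ ^ 2 ≤ hardyNorm f ^ 2 := by
      intro r hr
      refine (ENNReal.sum_le_tsum s).trans ?_
      rw [← h1 r hr]
      gcongr
      exact le_iSup₂ (f := fun (r : ℝ) (_ : r ∈ Set.Ioo (0 : ℝ) 1) =>
        eLpNorm (fun θ : ℝ => f (circleMap 0 r θ)) 2 angleMeasure) r hr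
    have h3 : Filter.Tendsto
        (fun r : ℝ => ∑ n ∈ s, ENNReal.ofReal (r ^ (2 * n)) * ‖taylorCoeff f n‖ₑ ^ 2)
        (nhdsWithin 1 (Set.Iio 1)) (nhds (∑ n ∈ s, ‖taylorCoeff f n‖ₑ ^ 2)) := by
      refine tendsto_finsetSum s fun n _ => ?_
      have : Filter.Tendsto (fun r : ℝ => ENNReal.ofReal (r ^ (2 * n)))
          (nhdsWithin 1 (Set.Iio 1)) (nhds 1) := by
        have := (ENNReal.continuous_ofReal.comp (continuous_pow (2 * n))).tendsto (1 : ℝ)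
        simp only [Function.comp_apply, one_pow, ENNReal.ofReal_one] at this
        exact this.mono_left nhdsWithin_le_nhds
      simpa using ENNReal.Tendsto.mul_const this (Or.inl one_ne_zero)
    refine le_of_tendsto h3 ?_
    filter_upwards [Ioo_mem_nhdsLT (show (0 : ℝ) < 1 by norm_num)] with r hr using h2 r hr

end

/-! ### The Hankel form and its reproducing formula -/

/-- Cauchy-Schwarz, in a form where the splitting of h² into two factors is needed only almost
everywhere. -/
theorem lintegral_sq_le_mul {X : Type*} [MeasurableSpace X] {μ : Measure X} {h F G : X → ℝ≥0∞}
    (hF : AEMeasurable F μ) (hG : AEMeasurable G μ) (hle : ∀ᵐ x ∂μ, h x ^ 2 ≤ F x * G x) :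
    (∫⁻ x, h x ∂μ) ^ 2 ≤ (∫⁻ x, F x ∂μ) * ∫⁻ x, G x ∂μ := by
  have h2 : (0 : ℝ) < 2 := two_pos
  have e : ∀ y : ℝ≥0∞, (y ^ (1 / 2 : ℝ)) ^ (2 : ℝ) = y := fun y => by
    rw [← ENNReal.rpow_mul]; norm_num
  have key := ENNReal.lintegral_mul_le_Lp_mul_Lq μ Real.HolderConjugate.two_two
    (hF.pow_const (1 / 2 : ℝ)) (hG.pow_const (1 / 2 : ℝ))
  simp only [e] at key
  have h1 : ∫⁻ x, h x ∂μ ≤ (∫⁻ x, F x ∂μ) ^ (1 / 2 : ℝ) * (∫⁻ x, G x ∂μ) ^ (1 / 2 : ℝ) := by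
    refine (lintegral_mono_ae ?_).trans key
    filter_upwards [hle] with x hx
    rw [Pi.mul_apply, ← ENNReal.mul_rpow_of_nonneg _ _ (by norm_num : (0 : ℝ) ≤ 1 / 2), one_div,
      ENNReal.le_rpow_inv_iff h2, ENNReal.rpow_ofNat]
    exact hx
  rw [← ENNReal.mul_rpow_of_nonneg _ _ (by norm_num : (0 : ℝ) ≤ 1 / 2), one_div,
    ENNReal.le_rpow_inv_iff h2, ENNReal.rpow_ofNat] at h1
  exact h1

/-- The coefficients of φ may grow, but more slowly than r^k for every r > 1. Since r^{m+n} factors,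
the geometric decay of both `a` and `p` absorbs it once r < R. -/
theorem summable_hankelForm {H : Type*} [NormedAddCommGroup H] {φ a : ℕ → H} {p : ℕ → ℂ}
    (hφ : ConvergesTo φ 1) {R : ℝ} (hR : 1 < R)
    (ha : ConvergesTo a R) (hp : ConvergesTo p R) :
    Summable fun q : ℕ × ℕ => ‖p q.2‖ * (‖φ (q.1 + q.2)‖ * ‖a q.1‖) := by
  obtain ⟨r, h1, h2⟩ := exists_between hR
  have hr0 : 0 < r := one_pos.trans h1
  obtain ⟨A, hA0, hA⟩ := hφ.bounded (r := r⁻¹) (by positivity) (inv_lt_one_of_one_lt₀ h1)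
  have hA' : ∀ k, ‖φ k‖ ≤ A * r ^ k := fun k => by
    have := hA k
    rwa [inv_pow, ← div_eq_mul_inv, div_le_iff₀ (by positivity)] at this
  have hs := ((ha r hr0.le h2).mul_of_nonneg (hp r hr0.le h2) (fun _ => by positivity)
    (fun _ => by positivity)).mul_left A
  refine Summable.of_nonneg_of_le (fun _ => by positivity) (fun q => ?_) hs
  calc ‖p q.2‖ * (‖φ (q.1 + q.2)‖ * ‖a q.1‖)
      ≤ ‖p q.2‖ * (A * r ^ (q.1 + q.2) * ‖a q.1‖) := by gcongr; exact hA' _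
    _ = _ := by rw [pow_add]; ring

section

variable {H : Type*} [NormedAddCommGroup H] [InnerProductSpace ℂ H]

/-- The Taylor coefficients of the image of `∑ aₘ zᵐ` under the Hankel operator with symbol
`φ^#`. -/
def hankelCoeff (φ a : ℕ → H) (n : ℕ) : ℂ := ∑' m, ⟪φ (m + n), a m⟫_ℂ

/-- The coefficients of the fractional derivative of order `β`. -/
def fracCoeff {E : Type*} [NormedAddCommGroup E] [NormedSpace ℂ E] (β : ℝ) (c : ℕ → E) (n : ℕ) :
    E := (((1 + (n : ℝ)) ^ β : ℝ) : ℂ) • c n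

theorem summable_inner_hankelForm {φ a : ℕ → H} {p : ℕ → ℂ} (hφ : ConvergesTo φ 1) {R : ℝ}
    (hR : 1 < R) (ha : ConvergesTo a R) (hp : ConvergesTo p R) :
    Summable fun q : ℕ × ℕ => ‖p q.2 * ⟪φ (q.1 + q.2), a q.1⟫_ℂ‖ := by
  refine Summable.of_nonneg_of_le (fun _ => norm_nonneg _) (fun q => ?_)
    (summable_hankelForm hφ hR ha hp)
  rw [norm_mul]
  gcongr
  exact norm_inner_le_norm _ _

theorem tsum_hankelForm {φ a : ℕ → H} {p : ℕ → ℂ} (hφ : ConvergesTo φ 1) {R : ℝ}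
    (hR : 1 < R) (ha : ConvergesTo a R) (hp : ConvergesTo p R) :
    ∑' q : ℕ × ℕ, p q.2 * ⟪φ (q.1 + q.2), a q.1⟫_ℂ = ∑' n, p n * hankelCoeff φ a n := by
  have hs := (summable_inner_hankelForm hφ hR ha hp).of_norm
  rw [← (Equiv.prodComm ℕ ℕ).tsum_eq]
  refine (Summable.tsum_prod ((Equiv.prodComm ℕ ℕ).summable_iff.2 hs)).trans ?_
  refine tsum_congr fun n => ?_
  simp only [Function.comp_apply, Equiv.prodComm_apply, Prod.swap_prod_mk, hankelCoeff]
  rw [tsum_mul_left]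

theorem measurable_inner_powerSum [CompleteSpace H] {c d : ℕ → H} (hc : ConvergesTo c 1)
    (hd : ConvergesTo d 1) :
    Measurable fun z : Metric.ball (0 : ℂ) 1 => ‖⟪powerSum c z, powerSum d z⟫_ℂ‖ₑ := by
  have h1 : Continuous fun z : Metric.ball (0 : ℂ) 1 => powerSum c z :=
    hc.differentiableOn.continuousOn.domRestrict
  have h2 : Continuous fun z : Metric.ball (0 : ℂ) 1 => powerSum d z :=
    hd.differentiableOn.continuousOn.domRestrict
  exact (h1.inner h2).enorm.measurable

/-- Angular integral of a product `⟨ψ, p a⟩` of power series. -/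
theorem integral_circle_inner_smul [CompleteSpace H] {ψ a : ℕ → H} {p : ℕ → ℂ}
    (hψ : ConvergesTo ψ 1) (ha : ConvergesTo a 1) (hp : ConvergesTo p 1) {r : ℝ} (h0 : 0 ≤ r)
    (hr : r < 1) :
    ∫ θ, powerSum p (circleMap 0 r θ) *
        ⟪powerSum ψ (circleMap 0 r θ), powerSum a (circleMap 0 r θ)⟫_ℂ ∂angleMeasure
      = ∑' q : ℕ × ℕ, ((r ^ (2 * (q.1 + q.2)) : ℝ) : ℂ) *
        (p q.2 * ⟪ψ (q.1 + q.2), a q.1⟫_ℂ) := by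
  have hrn : ‖(r : ℂ)‖ < 1 := by rwa [Complex.norm_real, Real.norm_of_nonneg h0]
  have hd : Summable fun q : ℕ × ℕ => ‖((r : ℂ) ^ q.2 • p q.2) • ((r : ℂ) ^ q.1 • a q.1)‖ := by
    have := ((ha.summable_norm hrn).mul_of_nonneg (hp.summable_norm hrn)
      (fun _ => norm_nonneg _) (fun _ => norm_nonneg _))
    refine this.congr fun q => ?_
    rw [norm_smul (_ • _), mul_comm]
  -- The product p·a is kept as a double series in (m, n) with frequency m + n, which need not be
  -- injective.
  have key := integral_inner_trigSeries (κ := fun n : ℕ => (n : ℤ)) Nat.cast_injective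
    (hψ.summable_norm hrn) (fun q : ℕ × ℕ => q.1 + q.2) hd
  calc _ = _ := ?_
    _ = _ := key
    _ = _ := ?_
  · refine integral_congr_ae (Filter.Eventually.of_forall fun θ => ?_)
    have hz : ‖circleMap 0 r θ‖ < 1 := by rwa [norm_circleMap_zero_of_nonneg h0]
    have hsum := ((hp.hasSum hz).smul (ha.hasSum hz) (by
      have := ((hp.summable_norm hz).mul_of_nonneg (ha.summable_norm hz)
        (fun _ => norm_nonneg _) (fun _ => norm_nonneg _))
      refine Summable.of_norm (this.congr fun q => ?_)
      rw [norm_smul (_ • _)])).tsum_eq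
    simp only
    rw [← inner_smul_right, ← hsum, ← (Equiv.prodComm ℕ ℕ).tsum_eq]
    congr 1
    · exact tsum_congr fun n => by rw [circleMap_pow, smul_smul, mul_comm]
    · refine tsum_congr fun q => ?_
      simp only [Equiv.prodComm_apply, Prod.snd_swap, Prod.fst_swap, circleMap_pow, smul_smul,
        smul_eq_mul]
      congr 1
      push_cast
      rw [add_mul, add_mul, Complex.exp_add]
      ring
  · refine tsum_congr fun q => ?_
    rw [inner_smul_left, smul_smul, inner_smul_right]
    simp only [map_pow, Complex.conj_ofReal, smul_eq_mul]
    push_cast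
    rw [pow_mul, pow_add, pow_add]
    ring

/-- The Hankel form is represented by a weighted area integral; this is the resulting bound. -/
theorem enorm_hankelForm_le [CompleteSpace H] {α : ℝ} (hα : 0 < α) {φ a : ℕ → H} {p : ℕ → ℂ}
    (hφ : ConvergesTo φ 1) {R : ℝ} (hR : 1 < R) (ha : ConvergesTo a R) (hp : ConvergesTo p R) :
    ENNReal.ofReal (Real.pi * Real.Gamma (α + 1)) *
        ‖∑' q : ℕ × ℕ, p q.2 * ⟪φ (q.1 + q.2), a q.1⟫_ℂ‖ₑ
      ≤ ∫⁻ z in Metric.ball (0 : ℂ) 1,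
        ‖powerSum p z‖ₑ * ‖⟪powerSum (fracCoeff (1 + α) φ) z, powerSum a z⟫_ℂ‖ₑ *
          ENNReal.ofReal ((-2 * Real.log ‖z‖) ^ α) := by
  have ha1 := ha.mono hR.le
  have hp1 := hp.mono hR.le
  have hψ : ConvergesTo (fracCoeff (1 + α) φ) 1 := hφ.rpow_smul (1 + α)
  have hG : 0 < Real.Gamma (α + 1) := Real.Gamma_pos_of_pos (by linarith)
  rw [lintegral_ball_eq, ENNReal.ofReal_mul Real.pi_pos.le, mul_assoc]
  swap
  · exact ((measurable_powerSum hp1).mul (measurable_inner_powerSum hψ ha1)).mul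
      (by fun_prop)
  gcongr
  set y : ℕ × ℕ → ℂ := fun q => p q.2 * ⟪φ (q.1 + q.2), a q.1⟫_ℂ with hy
  have hys : Summable fun q => ‖y q‖ := summable_inner_hankelForm hφ hR ha hp
  -- The factor (1+m+n)^{1+α}, the coefficient of D^{1+α}, normalizes every weight to the same
  -- integral Γ(α+1). Integrating the series in x therefore returns the Hankel form times Γ(α+1).
  let w : ℕ × ℕ → ℝ → ℝ := fun q x =>
    (1 + ((q.1 + q.2 : ℕ) : ℝ)) ^ (1 + α) * (x ^ α * Real.exp (-((1 + ((q.1 + q.2 : ℕ) : ℝ)) * x)))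
  have hwint : ∀ q, ∫ x in Set.Ioi (0 : ℝ), w q x = Real.Gamma (α + 1) := by
    intro q
    have hk : (0 : ℝ) < 1 + ((q.1 + q.2 : ℕ) : ℝ) := by positivity
    have := Real.integral_rpow_mul_exp_neg_mul_Ioi (a := α + 1) (by linarith) hk
    simp only [add_sub_cancel_right] at this
    simp only [w]
    rw [integral_const_mul, this, ← mul_assoc, add_comm 1 α,
      ← Real.mul_rpow hk.le (by positivity), mul_one_div_cancel hk.ne', Real.one_rpow, one_mul]
  have hw0 : ∀ q, ∀ x ∈ Set.Ioi (0 : ℝ), 0 ≤ w q x := fun q x hx => by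
    have : (0 : ℝ) < x := hx
    positivity
  have hwi : ∀ q, IntegrableOn (w q) (Set.Ioi 0) := fun q => by
    by_contra hc
    have := hwint q
    rw [integral_undef hc] at this
    exact hG.ne this
  have hFi : ∀ q, IntegrableOn (fun x => ((w q x : ℝ) : ℂ) * y q) (Set.Ioi 0) := fun q =>
    (hwi q).ofReal.mul_const _
  have hFn : ∀ q, ∫ x in Set.Ioi (0 : ℝ), ‖((w q x : ℝ) : ℂ) * y q‖
      = Real.Gamma (α + 1) * ‖y q‖ := fun q => by
    rw [← hwint q, ← integral_mul_const]
    refine setIntegral_congr_fun measurableSet_Ioi fun x hx => ?_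
    rw [norm_mul, Complex.norm_real, Real.norm_of_nonneg (hw0 q x hx)]
  have hsum := hasSum_integral_of_summable_integral_norm hFi
    (by simp_rw [hFn]; exact hys.mul_left _)
  have hval : ∀ q, ∫ x in Set.Ioi (0 : ℝ), ((w q x : ℝ) : ℂ) * y q
      = ((Real.Gamma (α + 1) : ℝ) : ℂ) * y q := fun q => by
    rw [integral_mul_const, integral_complex_ofReal, hwint]
  simp_rw [hval] at hsum
  have e1 : ENNReal.ofReal (Real.Gamma (α + 1)) * ‖∑' q, y q‖ₑ
      = ‖∫ x in Set.Ioi (0 : ℝ), ∑' q, ((w q x : ℝ) : ℂ) * y q‖ₑ := by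
    rw [← hsum.tsum_eq, tsum_mul_left, enorm_mul]
    congr 1
    rw [← ofReal_norm, Complex.norm_real, Real.norm_of_nonneg hG.le]
  rw [e1]
  refine (enorm_integral_le_lintegral_enorm _).trans ?_
  refine setLIntegral_mono' measurableSet_Ioi fun x hx => ?_
  have hx' : (0 : ℝ) < x := hx
  have hlt : Real.exp (-x / 2) < 1 := Real.exp_lt_one_iff.2 (by linarith)
  -- At fixed x the weighted series is an angular mean of p⟨D^{1+α}φ, f⟩ on the circle |z|² =
  -- exp(-x).
  have e2 : ∑' q, ((w q x : ℝ) : ℂ) * y q = ((x ^ α * Real.exp (-x) : ℝ) : ℂ) *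
      ∫ θ, powerSum p (circleMap 0 (Real.exp (-x / 2)) θ) *
        ⟪powerSum (fracCoeff (1 + α) φ) (circleMap 0 (Real.exp (-x / 2)) θ),
          powerSum a (circleMap 0 (Real.exp (-x / 2)) θ)⟫_ℂ ∂angleMeasure := by
    rw [integral_circle_inner_smul hψ ha1 hp1 (Real.exp_pos _).le hlt, ← tsum_mul_left]
    refine tsum_congr fun q => ?_
    simp only [w, y, fracCoeff]
    have e : Real.exp (-((1 + ((q.1 + q.2 : ℕ) : ℝ)) * x))
        = Real.exp (-x) * Real.exp (-x / 2) ^ (2 * (q.1 + q.2)) := by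
      rw [← Real.exp_nat_mul, ← Real.exp_add]
      congr 1
      push_cast
      ring
    rw [e, inner_smul_left, Complex.conj_ofReal]
    push_cast
    ring
  rw [e2, enorm_mul, ← ofReal_norm, Complex.norm_real, Real.norm_of_nonneg (by positivity),
    ENNReal.ofReal_mul (by positivity), mul_comm (ENNReal.ofReal (x ^ α)), mul_assoc]
  gcongr
  simp only [neg_two_mul_log_norm_circleMap]
  rw [lintegral_mul_const' _ _ ENNReal.ofReal_ne_top, mul_comm]
  gcongr
  exact (enorm_integral_le_lintegral_enorm _).trans
    (le_of_eq (lintegral_congr fun θ => enorm_mul _ _))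

end

/-! ### The Carleson embedding controls the Hankel operator -/

theorem lintegral_exp_mul_rpow {β : ℝ} (hβ : -1 < β) (n : ℕ) :
    ∫⁻ x in Set.Ioi (0 : ℝ), ENNReal.ofReal (Real.exp (-((1 + n) * x))) * ENNReal.ofReal (x ^ β)
      = ENNReal.ofReal (Real.Gamma (β + 1) * (1 + n) ^ (-(β + 1))) := by
  rw [← lintegral_rpow_mul_exp hβ (by positivity)]
  refine lintegral_congr fun x => ?_
  rw [← ENNReal.ofReal_mul (Real.exp_pos _).le, mul_comm]

theorem inv_one_sub_exp_neg_le {x : ℝ} (hx : 0 < x) : (1 - Real.exp (-x))⁻¹ ≤ 1 + x⁻¹ := by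
  have h1 : 0 < 1 - Real.exp (-x) := by
    have := Real.exp_lt_one_iff.2 (show -x < 0 by linarith)
    linarith
  rw [inv_le_iff_one_le_mul₀ h1]
  have h2 : x + 1 ≤ Real.exp x := Real.add_one_le_exp x
  have h3 : Real.exp (-x) * Real.exp x = 1 := by rw [← Real.exp_add]; simp
  have h4 : (1 + x) * Real.exp (-x) ≤ 1 := by nlinarith [Real.exp_pos (-x)]
  have h5 : (1 + x⁻¹) * (1 - Real.exp (-x)) = x⁻¹ * ((1 + x) - (1 + x) * Real.exp (-x)) := by
    field_simp
    ring
  rw [h5]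
  calc (1 : ℝ) = x⁻¹ * x := by field_simp
    _ ≤ _ := by gcongr; linarith

theorem norm_sq_eq_exp_of_mem_ball {z : ℂ} (hz : z ≠ 0) :
    ‖z‖ ^ 2 = Real.exp (-(-2 * Real.log ‖z‖)) := by
  have h : 0 < ‖z‖ := norm_pos_iff.2 hz
  rw [show -(-2 * Real.log ‖z‖) = Real.log ‖z‖ + Real.log ‖z‖ by ring, Real.exp_add,
    Real.exp_log h, sq]

theorem neg_two_mul_log_norm_pos {z : ℂ} (hz : z ≠ 0) (h1 : ‖z‖ < 1) :
    0 < -2 * Real.log ‖z‖ := by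
  have := Real.log_neg (norm_pos_iff.2 hz) h1
  linarith

/-- The origin is discarded because `Real.log 0 = 0` breaks |z|² = exp(-x) there. -/
theorem ae_ball_ne_zero : ∀ᵐ z : ℂ ∂volume.restrict (Metric.ball 0 1), ‖z‖ < 1 ∧ z ≠ 0 := by
  filter_upwards [ae_restrict_mem Metric.isOpen_ball.measurableSet,
    ae_restrict_of_ae (Measure.ae_ne volume (0 : ℂ))] with z h1 h2
  exact ⟨by simpa using h1, h2⟩

theorem convergesTo_of_finite {E : Type*} [NormedAddCommGroup E] {c : ℕ → E} {K : ℕ}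
    (h : ∀ n, K ≤ n → c n = 0) (R : ℝ) : ConvergesTo c R := fun r _ _ =>
  summable_of_ne_finset_zero (s := Finset.range K) fun n hn => by
    rw [h n (by simpa using hn), norm_zero, zero_mul]

/-- The weight dominates x^{2α}/(1-exp(-x)), the cofactor of 1-|z|² in Cauchy-Schwarz. Its moments
are of order (1+n)^{-2α}, the other term having the smaller order (1+n)^{-2α-1}. -/
theorem carleson_weight_le {α : ℝ} (hα : 0 < α) {p : ℕ → ℂ} (hp : ConvergesTo p 1) :
    ∫⁻ z in Metric.ball (0 : ℂ) 1, ‖powerSum p z‖ₑ ^ 2 *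
        ENNReal.ofReal ((-2 * Real.log ‖z‖) ^ (2 * α) + (-2 * Real.log ‖z‖) ^ (2 * α - 1))
      ≤ ENNReal.ofReal (Real.pi * (Real.Gamma (2 * α + 1) + Real.Gamma (2 * α))) *
        ∑' n : ℕ, ENNReal.ofReal ((1 + n) ^ (-(2 * α))) * ‖p n‖ₑ ^ 2 := by
  rw [lintegral_ball_powerSum (W := fun x => ENNReal.ofReal (x ^ (2 * α) + x ^ (2 * α - 1))) hp
    (by fun_prop), ENNReal.ofReal_mul Real.pi_pos.le, mul_assoc]
  gcongr
  rw [← ENNReal.tsum_mul_left]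
  refine ENNReal.tsum_le_tsum fun n => ?_
  rw [mul_comm, ← mul_assoc]
  gcongr
  have hG1 := Real.Gamma_pos_of_pos (show 0 < 2 * α + 1 by linarith)
  have hG2 := Real.Gamma_pos_of_pos (show 0 < 2 * α by linarith)
  calc ∫⁻ x in Set.Ioi (0 : ℝ), ENNReal.ofReal (Real.exp (-((1 + n) * x))) *
        ENNReal.ofReal (x ^ (2 * α) + x ^ (2 * α - 1))
      ≤ ∫⁻ x in Set.Ioi (0 : ℝ),
        (ENNReal.ofReal (Real.exp (-((1 + n) * x))) * ENNReal.ofReal (x ^ (2 * α))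
        + ENNReal.ofReal (Real.exp (-((1 + n) * x))) * ENNReal.ofReal (x ^ (2 * α - 1))) := by
        refine lintegral_mono fun x => ?_
        simp only
        rw [← mul_add]
        gcongr
        exact ENNReal.ofReal_add_le
    _ = ENNReal.ofReal (Real.Gamma (2 * α + 1) * (1 + n) ^ (-(2 * α + 1)))
        + ENNReal.ofReal (Real.Gamma (2 * α) * (1 + n) ^ (-(2 * α))) := by
        rw [lintegral_add_left (by fun_prop), lintegral_exp_mul_rpow (by linarith),
          lintegral_exp_mul_rpow (by linarith), sub_add_cancel]
    _ ≤ _ := by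
        rw [← ENNReal.ofReal_add (by positivity) (by positivity),
          ← ENNReal.ofReal_mul (by positivity)]
        apply ENNReal.ofReal_le_ofReal
        rw [add_mul]
        gcongr <;> linarith [n.cast_nonneg (α := ℝ)]

/-- Duality between the weights (1+n)^{2α} and (1+n)^{-2α}, combined with the area formula for the
Hankel form. The constant is chosen before the space, which makes it universal. -/
theorem exists_hankel_le_carleson {α : ℝ} (hα : 0 < α) : ∃ C : ℝ≥0,
    ∀ {H : Type u} [NormedAddCommGroup H] [InnerProductSpace ℂ H] [CompleteSpace H]
      {φ a : ℕ → H} {R : ℝ}, ConvergesTo φ 1 → 1 < R → ConvergesTo a R →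
      ∑' n, ‖fracCoeff α (hankelCoeff φ a) n‖ₑ ^ 2 ≤ C * ∫⁻ z in Metric.ball (0 : ℂ) 1,
        ‖⟪powerSum (fracCoeff (1 + α) φ) z, powerSum a z⟫_ℂ‖ₑ ^ 2 *
          ENNReal.ofReal (1 - ‖z‖ ^ 2) := by
  have hG := Real.Gamma_pos_of_pos (show 0 < α + 1 by linarith)
  have hG1 := Real.Gamma_pos_of_pos (show 0 < 2 * α + 1 by linarith)
  have hG2 := Real.Gamma_pos_of_pos (show 0 < 2 * α by linarith)
  have hpi := Real.pi_pos
  set c₀ : ℝ := Real.pi * Real.Gamma (α + 1) with hc₀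
  set c₁ : ℝ := Real.pi * (Real.Gamma (2 * α + 1) + Real.Gamma (2 * α)) with hc₁
  have hc₀p : 0 < c₀ := by positivity
  have hc₁p : 0 < c₁ := by positivity
  refine ⟨(c₁ / c₀ ^ 2).toNNReal, fun {H} _ _ _ {φ a R} hφ hR ha => ?_⟩
  set N := ∫⁻ z in Metric.ball (0 : ℂ) 1,
        ‖⟪powerSum (fracCoeff (1 + α) φ) z, powerSum a z⟫_ℂ‖ₑ ^ 2 *
          ENNReal.ofReal (1 - ‖z‖ ^ 2) with hN
  set b := hankelCoeff φ a with hb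
  have ha1 := ha.mono hR.le
  have hψ : ConvergesTo (fracCoeff (1 + α) φ) 1 := hφ.rpow_smul (1 + α)
  rw [ENNReal.tsum_eq_iSup_nat]
  refine iSup_le fun K => ?_
  -- The extremal dual sequence. With it the Hankel form and the dual norm squared both equal S;
  -- truncation at K makes p a polynomial and S finite.
  let p : ℕ → ℂ := fun n => if n < K then (((1 + (n : ℝ)) ^ (2 * α) : ℝ) : ℂ) * star (b n) else 0
  have hp : ∀ R, ConvergesTo p R := convergesTo_of_finite (K := K) fun n hn => by
    simp [p, not_lt.2 hn]
  set S : ℝ := ∑ n ∈ Finset.range K, (1 + (n : ℝ)) ^ (2 * α) * ‖b n‖ ^ 2 with hS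
  have hS0 : 0 ≤ S := Finset.sum_nonneg fun _ _ => by positivity
  have e0 : ∑ n ∈ Finset.range K, ‖fracCoeff α b n‖ₑ ^ 2 = ENNReal.ofReal S := by
    rw [hS, ENNReal.ofReal_sum_of_nonneg fun _ _ => by positivity]
    refine Finset.sum_congr rfl fun n _ => ?_
    rw [← ofReal_norm, ← ENNReal.ofReal_pow (norm_nonneg _), fracCoeff, norm_smul,
      Complex.norm_real, Real.norm_of_nonneg (by positivity), mul_pow, ← Real.rpow_natCast,
      ← Real.rpow_mul (by positivity)]
    congr 3
    push_cast
    ring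
  have e1 : ∑' q : ℕ × ℕ, p q.2 * ⟪φ (q.1 + q.2), a q.1⟫_ℂ = (S : ℂ) := by
    rw [tsum_hankelForm hφ hR ha (hp R), tsum_eq_sum (s := Finset.range K), hS,
      Complex.ofReal_sum]
    · refine Finset.sum_congr rfl fun n hn => ?_
      simp only [p, if_pos (Finset.mem_range.1 hn)]
      rw [mul_assoc, ← hb, Complex.star_def, Complex.conj_mul']
      push_cast
      rfl
    · intro n hn
      simp only [p, if_neg (fun h => hn (Finset.mem_range.2 h)), zero_mul]
  have e2 : ∑' n : ℕ, ENNReal.ofReal ((1 + n) ^ (-(2 * α))) * ‖p n‖ₑ ^ 2 = ENNReal.ofReal S := by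
    rw [tsum_eq_sum (s := Finset.range K), hS,
      ENNReal.ofReal_sum_of_nonneg fun _ _ => by positivity]
    · refine Finset.sum_congr rfl fun n hn => ?_
      simp only [p, if_pos (Finset.mem_range.1 hn)]
      rw [← ofReal_norm, ← ENNReal.ofReal_pow (norm_nonneg _), norm_mul, Complex.norm_real,
        Real.norm_of_nonneg (by positivity), norm_star, ← ENNReal.ofReal_mul (by positivity)]
      congr 1
      rw [Real.rpow_neg (by positivity)]
      have : 0 < (1 + (n : ℝ)) ^ (2 * α) := by positivity
      field_simp
    · intro n hn
      simp only [p, if_neg (fun h => hn (Finset.mem_range.2 h))]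
      simp
  have key := enorm_hankelForm_le hα hφ hR ha (hp R)
  rw [e1, ← ofReal_norm, Complex.norm_real, Real.norm_of_nonneg hS0] at key
  have cs := lintegral_sq_le_mul (μ := volume.restrict (Metric.ball (0 : ℂ) 1))
    (h := fun z => ‖powerSum p z‖ₑ * ‖⟪powerSum (fracCoeff (1 + α) φ) z, powerSum a z⟫_ℂ‖ₑ *
          ENNReal.ofReal ((-2 * Real.log ‖z‖) ^ α))
    (F := fun z => ‖⟪powerSum (fracCoeff (1 + α) φ) z, powerSum a z⟫_ℂ‖ₑ ^ 2 *
          ENNReal.ofReal (1 - ‖z‖ ^ 2))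
    (G := fun z => ‖powerSum p z‖ₑ ^ 2 * ENNReal.ofReal
      ((-2 * Real.log ‖z‖) ^ (2 * α) + (-2 * Real.log ‖z‖) ^ (2 * α - 1)))
    (aemeasurable_restrict_of_measurable_subtype Metric.isOpen_ball.measurableSet
      (((measurable_inner_powerSum hψ ha1).pow_const 2).mul (by fun_prop)))
    (aemeasurable_restrict_of_measurable_subtype Metric.isOpen_ball.measurableSet
      (((measurable_powerSum (hp 1)).pow_const 2).mul (by fun_prop))) ?_
  · have h1 := (pow_le_pow_left₀ zero_le key 2).trans (cs.trans
      (mul_le_mul' le_rfl (carleson_weight_le hα (hp 1))))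
    rw [e2, ← hN] at h1
    rw [e0]
    rcases hS0.eq_or_lt with h | h
    · rw [← h]; simp
    -- Cauchy-Schwarz reads c₀²S² ≤ N c₁ S, and finiteness of S allows one factor to be cancelled,
    -- whence the constant c₁/c₀².
    · have hSne : ENNReal.ofReal S ≠ 0 := by simpa using h
      have h2 : ENNReal.ofReal S * (ENNReal.ofReal c₀ ^ 2 * ENNReal.ofReal S)
          ≤ ENNReal.ofReal S * (N * ENNReal.ofReal c₁) := by
        calc _ = (ENNReal.ofReal c₀ * ENNReal.ofReal S) ^ 2 := by ring
          _ ≤ _ := h1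
          _ = _ := by ring
      have h3 := (ENNReal.mul_le_mul_iff_right hSne ENNReal.ofReal_ne_top).1 h2
      have h4 : (((c₁ / c₀ ^ 2).toNNReal : ℝ≥0) : ℝ≥0∞)
          = (ENNReal.ofReal c₀ ^ 2)⁻¹ * ENNReal.ofReal c₁ := by
        rw [← ENNReal.ofReal_pow hc₀p.le, ← ENNReal.ofReal_inv_of_pos (by positivity),
          ← ENNReal.ofReal_mul (by positivity), ENNReal.ofReal]
        congr 2
        ring
      have hc0ne : ENNReal.ofReal c₀ ^ 2 ≠ 0 := by
        simpa using hc₀p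
      have hc0top : ENNReal.ofReal c₀ ^ 2 ≠ ⊤ := by simp
      calc ENNReal.ofReal S
          = (ENNReal.ofReal c₀ ^ 2)⁻¹ * (ENNReal.ofReal c₀ ^ 2 * ENNReal.ofReal S) := by
            rw [← mul_assoc, ENNReal.inv_mul_cancel hc0ne hc0top, one_mul]
        _ ≤ (ENNReal.ofReal c₀ ^ 2)⁻¹ * (N * ENNReal.ofReal c₁) := by gcongr
        _ = _ := by rw [h4]; ring
  · filter_upwards [ae_ball_ne_zero] with z hz
    have hω := neg_two_mul_log_norm_pos hz.2 hz.1
    have hsq := norm_sq_eq_exp_of_mem_ball hz.2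
    set x := -2 * Real.log ‖z‖ with hx
    have h1 : 0 < 1 - Real.exp (-x) := by
      have := Real.exp_lt_one_iff.2 (show -x < 0 by linarith)
      linarith
    rw [hsq]
    -- This is 1/(1-exp(-x)) ≤ 1 + 1/x multiplied by x^{2α}(1-exp(-x)).
    have h2 : ENNReal.ofReal (x ^ α) ^ 2 ≤ ENNReal.ofReal (1 - Real.exp (-x)) *
        ENNReal.ofReal (x ^ (2 * α) + x ^ (2 * α - 1)) := by
      rw [← ENNReal.ofReal_pow (by positivity), ← ENNReal.ofReal_mul h1.le]
      apply ENNReal.ofReal_le_ofReal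
      have h3 := inv_one_sub_exp_neg_le hω
      rw [inv_le_iff_one_le_mul₀ h1] at h3
      have h4 : x ^ (2 * α - 1) = x ^ (2 * α) * x⁻¹ := by
        rw [Real.rpow_sub hω, Real.rpow_one, div_eq_mul_inv]
      have h5 : (x ^ α) ^ 2 = x ^ (2 * α) := by
        rw [← Real.rpow_natCast, ← Real.rpow_mul hω.le]
        congr 1; push_cast; ring
      rw [h4, h5]
      have h6 : 0 < x ^ (2 * α) := by positivity
      nlinarith
    calc _ = (‖powerSum p z‖ₑ ^ 2 * ‖⟪powerSum (fracCoeff (1 + α) φ) z, powerSum a z⟫_ℂ‖ₑ ^ 2) *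
          ENNReal.ofReal (x ^ α) ^ 2 := by ring
      _ ≤ (‖powerSum p z‖ₑ ^ 2 * ‖⟪powerSum (fracCoeff (1 + α) φ) z, powerSum a z⟫_ℂ‖ₑ ^ 2) *
          (ENNReal.ofReal (1 - Real.exp (-x)) *
        ENNReal.ofReal (x ^ (2 * α) + x ^ (2 * α - 1))) := by gcongr
      _ = _ := by ring

/-! ### The Bloch type bound implied by boundedness of the Hankel operator -/

theorem tsum_mul_sq_le (f g : ℕ → ℝ≥0∞) :
    (∑' n, f n * g n) ^ 2 ≤ (∑' n, f n ^ 2) * ∑' n, g n ^ 2 := by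
  have := lintegral_sq_le_mul (μ := (Measure.count : Measure ℕ)) (h := fun n => f n * g n)
    (F := fun n => f n ^ 2) (G := fun n => g n ^ 2) (Measurable.of_discrete).aemeasurable
    (Measurable.of_discrete).aemeasurable (Filter.Eventually.of_forall fun n => by
      rw [mul_pow])
  simpa only [lintegral_count] using this

theorem convergesTo_geometric {E : Type*} [NormedAddCommGroup E] [NormedSpace ℂ E] {w : ℂ} {R : ℝ}
    (hw : ‖w‖ * R ≤ 1) (x : E) : ConvergesTo (fun m : ℕ => w ^ m • x) R := by
  intro r h0 hr
  have h1 : ‖w‖ * r < 1 := by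
    rcases (norm_nonneg w).eq_or_lt with h | h
    · rw [← h]; simp
    · exact lt_of_lt_of_le (mul_lt_mul_of_pos_left hr h) hw
  have := (summable_geometric_of_lt_one (by positivity) h1).mul_left ‖x‖
  refine this.congr fun m => ?_
  rw [norm_smul, norm_pow, mul_pow]
  ring

theorem exists_one_lt_mul_le {t : ℝ} (h1 : t < 1) (h0 : 0 ≤ t) : ∃ R : ℝ, 1 < R ∧ t * R ≤ 1 :=
  ⟨2 / (1 + t), by rw [lt_div_iff₀ (by linarith)]; linarith, by
    rw [← mul_div_assoc, div_le_one (by linarith)]; linarith⟩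

/-- Regrouping along antidiagonals leaves partial sums of d, so a sequence of differences d recovers
the original weight. -/
theorem tsum_prod_add {d g : ℕ → ℂ} (hs : Summable fun q : ℕ × ℕ => d q.2 * g (q.1 + q.2)) :
    ∑' q : ℕ × ℕ, d q.2 * g (q.1 + q.2) = ∑' k, (∑ n ∈ Finset.range (k + 1), d n) * g k := by
  have h2 := (Finset.HasAntidiagonal.sigmaAntidiagonalEquivProd (A := ℕ)).summable_iff.2 hs
  rw [← (Finset.HasAntidiagonal.sigmaAntidiagonalEquivProd (A := ℕ)).tsum_eq]
  refine h2.tsum_sigma.trans (tsum_congr fun k => ?_)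
  rw [tsum_fintype]
  change ∑ b : Finset.HasAntidiagonal.antidiagonal k, d (b : ℕ × ℕ).2 *
    g ((b : ℕ × ℕ).1 + (b : ℕ × ℕ).2) = _
  rw [Finset.sum_coe_sort (Finset.HasAntidiagonal.antidiagonal k)
    (fun q : ℕ × ℕ => d q.2 * g (q.1 + q.2))]
  rw [Finset.sum_congr rfl (g := fun q : ℕ × ℕ => d q.2 * g k) fun q hq => by
    rw [Finset.HasAntidiagonal.mem_antidiagonal.1 hq]]
  rw [← Finset.sum_mul, Finset.Nat.sum_antidiagonal_eq_sum_range_succ (fun _ j => d j),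
    ← Finset.sum_range_reflect d (k + 1)]
  simp only [Nat.add_sub_cancel]

/-- The differences of the sequence `(1 + n) ^ (1 + α)`. -/
def rpowDiff (α : ℝ) (n : ℕ) : ℝ := (1 + (n : ℝ)) ^ (1 + α) - (n : ℝ) ^ (1 + α)

theorem sum_rpowDiff {α : ℝ} (hα : 0 < α) (k : ℕ) :
    ∑ n ∈ Finset.range (k + 1), rpowDiff α n = (1 + (k : ℝ)) ^ (1 + α) := by
  have h := Finset.sum_range_sub (fun n : ℕ => (n : ℝ) ^ (1 + α)) (k + 1)
  simp only [Nat.cast_zero, Real.zero_rpow (show 1 + α ≠ 0 by linarith), sub_zero] at h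
  rw [show (1 + (k : ℝ)) = ((k + 1 : ℕ) : ℝ) by push_cast; ring, ← h]
  refine Finset.sum_congr rfl fun n _ => ?_
  rw [rpowDiff]
  push_cast
  rw [add_comm 1 (n : ℝ)]

theorem rpowDiff_nonneg {α : ℝ} (hα : 0 < α) (n : ℕ) : 0 ≤ rpowDiff α n :=
  sub_nonneg.2 (Real.rpow_le_rpow (by positivity) (by linarith) (by linarith))

/-- Bernoulli's inequality for (1 - 1/(1+n))^{1+α}, multiplied by (1+n)^{1+α}. -/
theorem rpowDiff_le {α : ℝ} (hα : 0 < α) (n : ℕ) :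
    rpowDiff α n ≤ (1 + α) * (1 + (n : ℝ)) ^ α := by
  have hn : (0 : ℝ) < 1 + n := by positivity
  have h := one_add_mul_self_le_rpow_one_add (s := -(1 + (n : ℝ))⁻¹) (p := 1 + α)
    (by rw [neg_le_neg_iff]; exact inv_le_one_of_one_le₀ (by linarith [n.cast_nonneg (α := ℝ)]))
    (by linarith)
  have e : 1 + -(1 + (n : ℝ))⁻¹ = n / (1 + n) := by field_simp; ring
  rw [e, Real.div_rpow (by positivity) hn.le, le_div_iff₀ (by positivity)] at h
  have e2 : (1 + (n : ℝ)) ^ (1 + α) = (1 + n) * (1 + (n : ℝ)) ^ α := by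
    rw [Real.rpow_add hn, Real.rpow_one]
  have e3 : (1 + (1 + α) * -(1 + (n : ℝ))⁻¹) * (1 + (n : ℝ)) ^ (1 + α)
      = (1 + (n : ℝ)) ^ (1 + α) - (1 + α) * (1 + (n : ℝ)) ^ α := by
    rw [e2]; field_simp; ring
  rw [e3] at h
  rw [rpowDiff]
  linarith

theorem tsum_ofReal_geometric {t : ℝ} (h0 : 0 ≤ t) (h1 : t < 1) :
    ∑' n : ℕ, ENNReal.ofReal (t ^ n) = ENNReal.ofReal (1 - t)⁻¹ := by
  rw [← ENNReal.ofReal_tsum_of_nonneg (fun _ => by positivity) (summable_geometric_of_lt_one h0 h1),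
    tsum_geometric_of_lt_one h0 h1]

section

variable {H : Type*} [NormedAddCommGroup H] [InnerProductSpace ℂ H]

/-- The bound `M` for the square of the norm of `D^α Γ`, in terms of Taylor coefficients. -/
def HankelBound (α : ℝ) (φ : ℕ → H) (M : ℝ≥0∞) : Prop :=
  ∀ (a : ℕ → H) (R : ℝ), 1 < R → ConvergesTo a R →
    ∑' n, ‖fracCoeff α (hankelCoeff φ a) n‖ₑ ^ 2 ≤ M * ∑' m, ‖a m‖ₑ ^ 2

theorem summable_mul_hankelCoeff {φ a : ℕ → H} {p : ℕ → ℂ} (hφ : ConvergesTo φ 1) {R : ℝ}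
    (hR : 1 < R) (ha : ConvergesTo a R) (hp : ConvergesTo p R) :
    Summable fun n => ‖p n * hankelCoeff φ a n‖ := by
  have hs := (Equiv.prodComm ℕ ℕ).summable_iff.2 (summable_inner_hankelForm hφ hR ha hp)
  refine Summable.of_nonneg_of_le (fun _ => norm_nonneg _) (fun n => ?_) hs.prod
  rw [hankelCoeff, ← tsum_mul_left]
  exact norm_tsum_le_tsum_norm (hs.prod_factor n)

/-- Cauchy-Schwarz in n after inserting (1+n)^{-α}(1+n)^α = 1. -/
theorem enorm_tsum_hankelForm_sq_le {α : ℝ} {φ a : ℕ → H} {p : ℕ → ℂ} (hφ : ConvergesTo φ 1)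
    {R : ℝ} (hR : 1 < R) (ha : ConvergesTo a R) (hp : ConvergesTo p R) :
    ‖∑' q : ℕ × ℕ, p q.2 * ⟪φ (q.1 + q.2), a q.1⟫_ℂ‖ₑ ^ 2
      ≤ (∑' n, ‖fracCoeff (-α) p n‖ₑ ^ 2) * ∑' n, ‖fracCoeff α (hankelCoeff φ a) n‖ₑ ^ 2 := by
  rw [tsum_hankelForm hφ hR ha hp]
  refine (pow_le_pow_left₀ zero_le enorm_tsum_le_tsum_enorm 2).trans
    (le_trans (le_of_eq ?_) (tsum_mul_sq_le _ _))
  congr 1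
  refine tsum_congr fun n => ?_
  rw [← enorm_mul]
  congr 1
  simp only [fracCoeff, smul_eq_mul]
  have : (((1 + (n : ℝ)) ^ (-α) : ℝ) : ℂ) * (((1 + (n : ℝ)) ^ α : ℝ) : ℂ) = 1 := by
    rw [← Complex.ofReal_mul, ← Real.rpow_add (by positivity)]
    simp
  linear_combination -(p n * hankelCoeff φ a n) * this

theorem hasSum_inner_powerSum [CompleteSpace H] {c : ℕ → H} {R : ℝ} (hc : ConvergesTo c R) {w : ℂ}
    (hw : ‖w‖ < R) (x : H) :
    HasSum (fun k => star w ^ k * ⟪c k, x⟫_ℂ) ⟪powerSum c w, x⟫_ℂ := by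
  have h := ((innerSL ℂ x).hasSum (hc.hasSum hw)).star
  simp only [innerSL_apply_apply, Complex.star_def, inner_conj_symm] at h
  have e : (fun k => star w ^ k * ⟪c k, x⟫_ℂ) = fun k => ⟪w ^ k • c k, x⟫_ℂ := funext fun k => by
    rw [inner_smul_left, map_pow, Complex.star_def]
  rw [e]
  exact h

/-- Pointwise bound for the fractional derivative of the symbol. -/
theorem HankelBound.bloch [CompleteSpace H] {α : ℝ} (hα : 0 < α) {φ : ℕ → H}
    (hφ : ConvergesTo φ 1) {M : ℝ≥0∞} (hM : HankelBound α φ M) {w : ℂ} (hw : ‖w‖ < 1) (x : H) :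
    ‖⟪powerSum (fracCoeff (1 + α) φ) w, x⟫_ℂ‖ₑ ^ 2
      ≤ M * ENNReal.ofReal ((1 + α) ^ 2 * (1 - ‖w‖ ^ 2)⁻¹ ^ 2) * ‖x‖ₑ ^ 2 := by
  obtain ⟨R, hR, hwR⟩ := exists_one_lt_mul_le hw (norm_nonneg w)
  have hcw : ‖star w‖ * R ≤ 1 := by rwa [norm_star]
  -- The kernel is spread over both arguments: the differences in p sum over m + n = k to
  -- (1+k)^{1+α}, and each squared norm costs one factor 1/(1-|w|²). Putting the whole weight on p,
  -- with `a` constant, would give the worse power 3/2 in place of 1 after taking roots.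
  have ha : ConvergesTo (fun m : ℕ => star w ^ m • x) R := convergesTo_geometric hcw x
  have hp : ConvergesTo (fun n : ℕ => ((rpowDiff α n : ℝ) : ℂ) • (star w ^ n • (1 : ℂ))) R :=
    (convergesTo_geometric hcw (1 : ℂ)).smul_of_le (A := 1 + α) (β := α) fun n => by
      rw [Complex.norm_real, Real.norm_of_nonneg (rpowDiff_nonneg hα n)]
      exact rpowDiff_le hα n
  have hψ : ConvergesTo (fracCoeff (1 + α) φ) 1 := hφ.rpow_smul (1 + α)
  have e1 : ∑' q : ℕ × ℕ, (((rpowDiff α q.2 : ℝ) : ℂ) • (star w ^ q.2 • (1 : ℂ))) *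
      ⟪φ (q.1 + q.2), star w ^ q.1 • x⟫_ℂ = ⟪powerSum (fracCoeff (1 + α) φ) w, x⟫_ℂ := by
    have hs := (summable_inner_hankelForm hφ hR ha hp).of_norm
    have e : ∀ q : ℕ × ℕ, (((rpowDiff α q.2 : ℝ) : ℂ) • (star w ^ q.2 • (1 : ℂ))) *
      ⟪φ (q.1 + q.2), star w ^ q.1 • x⟫_ℂ = ((rpowDiff α q.2 : ℝ) : ℂ) *
        (fun k => star w ^ k * ⟪φ k, x⟫_ℂ) (q.1 + q.2) := by
      intro q
      simp only [smul_eq_mul, inner_smul_right, pow_add]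
      ring
    rw [tsum_congr e, tsum_prod_add (d := fun n => ((rpowDiff α n : ℝ) : ℂ))
      (g := fun k => star w ^ k * ⟪φ k, x⟫_ℂ) (hs.congr e),
      (hasSum_inner_powerSum hψ hw x).tsum_eq.symm]
    refine tsum_congr fun k => ?_
    rw [← Complex.ofReal_sum, sum_rpowDiff hα, fracCoeff, inner_smul_left, Complex.conj_ofReal]
    ring
  have hw2 : ‖w‖ ^ 2 < 1 := pow_lt_one₀ (norm_nonneg _) hw two_ne_zero
  have hg := tsum_ofReal_geometric (sq_nonneg ‖w‖) hw2
  have e2 : ∑' m : ℕ, ‖star w ^ m • x‖ₑ ^ 2 = ENNReal.ofReal (1 - ‖w‖ ^ 2)⁻¹ * ‖x‖ₑ ^ 2 := by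
    rw [← hg, ← ENNReal.tsum_mul_right]
    refine tsum_congr fun m => ?_
    rw [enorm_smul, mul_pow, ← ofReal_norm (star w ^ m), ← ENNReal.ofReal_pow (norm_nonneg _),
      norm_pow, norm_star, ← pow_mul, ← pow_mul, mul_comm 2 m]
  have e3 : ∑' n, ‖fracCoeff (-α) (fun n : ℕ => ((rpowDiff α n : ℝ) : ℂ) •
      (star w ^ n • (1 : ℂ))) n‖ₑ ^ 2 ≤ ENNReal.ofReal ((1 + α) ^ 2 * (1 - ‖w‖ ^ 2)⁻¹) := by
    rw [ENNReal.ofReal_mul (by positivity), ← hg, ← ENNReal.tsum_mul_left]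
    refine ENNReal.tsum_le_tsum fun n => ?_
    rw [← ENNReal.ofReal_mul (by positivity), ← ofReal_norm, ← ENNReal.ofReal_pow (norm_nonneg _)]
    apply ENNReal.ofReal_le_ofReal
    rw [fracCoeff, norm_smul, norm_smul, norm_smul, Complex.norm_real, Complex.norm_real,
      Real.norm_of_nonneg (rpowDiff_nonneg hα n), Real.norm_of_nonneg (by positivity), norm_one,
      norm_pow, norm_star, mul_one, ← pow_mul, mul_comm 2 n, pow_mul, ← mul_assoc, mul_pow]
    refine mul_le_mul_of_nonneg_right (pow_le_pow_left₀
      (mul_nonneg (by positivity) (rpowDiff_nonneg hα n)) ?_ 2) (by positivity)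
    calc (1 + (n : ℝ)) ^ (-α) * rpowDiff α n
        ≤ (1 + (n : ℝ)) ^ (-α) * ((1 + α) * (1 + (n : ℝ)) ^ α) := by gcongr; exact rpowDiff_le hα n
      _ = (1 + α) * ((1 + (n : ℝ)) ^ (-α) * (1 + (n : ℝ)) ^ α) := by ring
      _ = 1 + α := by rw [← Real.rpow_add (by positivity)]; simp
  have key := enorm_tsum_hankelForm_sq_le (α := α) hφ hR ha hp
  rw [e1] at key
  refine key.trans ((mul_le_mul' e3 (hM _ R hR ha)).trans (le_of_eq ?_))
  have hpos : 0 ≤ (1 - ‖w‖ ^ 2)⁻¹ := inv_nonneg.2 (by linarith)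
  rw [e2, sq (1 - ‖w‖ ^ 2)⁻¹, ← mul_assoc ((1 + α) ^ 2),
    ENNReal.ofReal_mul (p := (1 + α) ^ 2 * (1 - ‖w‖ ^ 2)⁻¹) (by positivity)]
  ring

end

/-! ### Double integral estimate for difference quotients -/

theorem one_sub_exp_neg_pos {x : ℝ} (hx : 0 < x) : 0 < 1 - Real.exp (-x) := by
  have := Real.exp_lt_one_iff.2 (show -x < 0 by linarith)
  linarith

theorem one_sub_exp_neg_le (x : ℝ) : 1 - Real.exp (-x) ≤ x := by
  have := Real.add_one_le_exp (-x)
  linarith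

theorem one_sub_exp_neg_rpow_le {σ x : ℝ} (h0 : 0 ≤ σ) (h1 : σ ≤ 1) (hx : 0 < x) :
    (1 - Real.exp (-x)) ^ (-σ) ≤ 1 + x ^ (-σ) := by
  have hp := one_sub_exp_neg_pos hx
  calc (1 - Real.exp (-x)) ^ (-σ) = ((1 - Real.exp (-x))⁻¹) ^ σ := by
        rw [Real.rpow_neg hp.le, Real.inv_rpow hp.le]
    _ ≤ (1 + x⁻¹) ^ σ := by gcongr; exact inv_one_sub_exp_neg_le hx
    _ ≤ 1 ^ σ + (x⁻¹) ^ σ := Real.rpow_add_le_add_rpow (by norm_num) (by positivity) h0 h1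
    _ = _ := by rw [Real.one_rpow, Real.inv_rpow hx.le, Real.rpow_neg hx.le]

/-- Bernoulli's inequality for the exponent 1-s ≤ 1 gives (1-s)(1+m)^{-s} ≤ (1+m)^{1-s} - m^{1-s},
which telescopes. -/
theorem sum_rpow_neg_le {s : ℝ} (h0 : 0 < s) (h1 : s < 1) (m : ℕ) :
    ∑ n ∈ Finset.range m, (1 + (n : ℝ)) ^ (-s) ≤ (m : ℝ) ^ (1 - s) / (1 - s) := by
  have hs : 0 < 1 - s := by linarith
  rw [le_div_iff₀ hs]
  induction m with
  | zero => simp [Real.zero_rpow hs.ne']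
  | succ m ih =>
    rw [Finset.sum_range_succ, add_mul]
    have hm : (0 : ℝ) < 1 + m := by positivity
    have h := rpow_one_add_le_one_add_mul_self (s := -(1 + (m : ℝ))⁻¹) (p := 1 - s)
      (by rw [neg_le_neg_iff]; exact inv_le_one_of_one_le₀ (by linarith [m.cast_nonneg (α := ℝ)]))
      hs.le (by linarith)
    have e : 1 + -(1 + (m : ℝ))⁻¹ = m / (1 + m) := by field_simp; ring
    rw [e, Real.div_rpow (by positivity) hm.le, div_le_iff₀ (by positivity)] at h
    have e2 : (1 + (m : ℝ)) ^ (1 - s) = (1 + m) * (1 + (m : ℝ)) ^ (-s) := by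
      rw [sub_eq_add_neg, Real.rpow_add hm, Real.rpow_one]
    have e3 : (1 + (1 - s) * -(1 + (m : ℝ))⁻¹) * (1 + (m : ℝ)) ^ (1 - s)
        = (1 + (m : ℝ)) ^ (1 - s) - (1 + (m : ℝ)) ^ (-s) * (1 - s) := by
      rw [e2]; field_simp; ring
    rw [e3] at h
    rw [Nat.cast_succ, add_comm (m : ℝ) 1]
    linarith

theorem sum_mul_inv_sq_le (m K : ℕ) :
    ∑ j ∈ Finset.range K, (m : ℝ) * ((1 + m + (j : ℝ)) ^ 2)⁻¹ ≤ 1 := by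
  rcases Nat.eq_zero_or_pos m with rfl | hm
  · simp
  have hm' : (0 : ℝ) < m := by exact_mod_cast hm
  -- The sharper bound is the telescoped sum of m/(m+j) - m/(m+j+1), each difference dominating the
  -- corresponding term.
  suffices h : ∑ j ∈ Finset.range K, (m : ℝ) * ((1 + m + (j : ℝ)) ^ 2)⁻¹ ≤ 1 - m / (m + K) by
    have : 0 < (m : ℝ) / (m + K) := by positivity
    linarith
  induction K with
  | zero => simp [hm'.ne']
  | succ K ih =>
    rw [Finset.sum_range_succ]
    have h1 : (m : ℝ) * ((1 + m + (K : ℝ)) ^ 2)⁻¹ ≤ m / (m + K) - m / (m + ((K + 1 : ℕ) : ℝ)) := by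
      have e : (m : ℝ) / (m + K) - m / (m + ((K + 1 : ℕ) : ℝ))
          = (m : ℝ) * (((m + K) * (1 + m + (K : ℝ)))⁻¹) := by
        push_cast
        field_simp
        ring
      rw [e]
      gcongr
      rw [sq]
      gcongr
      linarith
    linarith

/-- In the variable x this is the moment of |z|^{2k} for the weight (1-|z|²)^{-σ}. -/
theorem lintegral_exp_weight_le {σ : ℝ} (h0 : 0 < σ) (h1 : σ < 1) (k : ℕ) :
    ∫⁻ x in Set.Ioi (0 : ℝ), ENNReal.ofReal
        (Real.exp (-x) * (1 - Real.exp (-x)) ^ (-σ) * Real.exp (-(k * x)))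
      ≤ ENNReal.ofReal ((1 + Real.Gamma (1 - σ)) * (1 + k) ^ (-(1 - σ))) := by
  have hG := Real.Gamma_pos_of_pos (show 0 < 1 - σ by linarith)
  calc _ ≤ ∫⁻ x in Set.Ioi (0 : ℝ),
        (ENNReal.ofReal (Real.exp (-((1 + k) * x))) * ENNReal.ofReal (x ^ (0 : ℝ))
        + ENNReal.ofReal (Real.exp (-((1 + k) * x))) * ENNReal.ofReal (x ^ (-σ))) := by
        refine setLIntegral_mono' measurableSet_Ioi fun x hx => ?_
        have hx' : (0 : ℝ) < x := hx
        rw [← ENNReal.ofReal_mul (by positivity), ← ENNReal.ofReal_mul (by positivity),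
          ← ENNReal.ofReal_add (by positivity) (by positivity)]
        apply ENNReal.ofReal_le_ofReal
        rw [Real.rpow_zero, ← mul_add]
        calc Real.exp (-x) * (1 - Real.exp (-x)) ^ (-σ) * Real.exp (-(k * x))
            = (Real.exp (-x) * Real.exp (-(k * x))) * (1 - Real.exp (-x)) ^ (-σ) := by ring
          _ ≤ (Real.exp (-x) * Real.exp (-(k * x))) * (1 + x ^ (-σ)) := by
              gcongr; exact one_sub_exp_neg_rpow_le h0.le h1.le hx'
          _ = _ := by rw [← Real.exp_add]; congr 2; ring
    _ = ENNReal.ofReal (Real.Gamma (0 + 1) * (1 + k) ^ (-((0 : ℝ) + 1)))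
        + ENNReal.ofReal (Real.Gamma (-σ + 1) * (1 + k) ^ (-(-σ + 1))) := by
        rw [lintegral_add_left (by fun_prop), lintegral_exp_mul_rpow (by norm_num),
          lintegral_exp_mul_rpow (by linarith)]
    _ ≤ _ := by
        rw [zero_add, Real.Gamma_one, neg_add_eq_sub,
          ← ENNReal.ofReal_add (by positivity) (by positivity)]
        apply ENNReal.ofReal_le_ofReal
        rw [add_mul]
        gcongr <;> linarith [k.cast_nonneg (α := ℝ)]

/-- An additional factor 1-|z|² gains one power of 1 + k. -/
theorem lintegral_exp_weight_le' {σ : ℝ} (h1 : σ < 1) (k : ℕ) :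
    ∫⁻ x in Set.Ioi (0 : ℝ), ENNReal.ofReal
        (Real.exp (-x) * (1 - Real.exp (-x)) ^ (-σ) * (Real.exp (-(k * x)) * (1 - Real.exp (-x))))
      ≤ ENNReal.ofReal (Real.Gamma (2 - σ) * (1 + k) ^ (-(2 - σ))) := by
  have e := lintegral_exp_mul_rpow (β := 1 - σ) (by linarith) k
  rw [show (1 - σ) + 1 = 2 - σ by ring] at e
  rw [← e]
  refine setLIntegral_mono' measurableSet_Ioi fun x hx => ?_
  have hx' : (0 : ℝ) < x := hx
  have hp := one_sub_exp_neg_pos hx'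
  rw [← ENNReal.ofReal_mul (by positivity)]
  apply ENNReal.ofReal_le_ofReal
  calc _ = (Real.exp (-x) * Real.exp (-(k * x))) *
        ((1 - Real.exp (-x)) ^ (-σ) * (1 - Real.exp (-x))) := by ring
    _ = Real.exp (-((1 + k) * x)) * (1 - Real.exp (-x)) ^ (1 - σ) := by
        rw [← Real.exp_add]
        congr 1
        · congr 1; ring
        · rw [sub_eq_neg_add 1 σ, Real.rpow_add hp, Real.rpow_one]
    _ ≤ _ := mul_le_mul_of_nonneg_left
        (Real.rpow_le_rpow hp.le (one_sub_exp_neg_le x) (by linarith)) (Real.exp_pos _).le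

/-- Squared moduli of the Fourier coefficients of the difference quotient of `z ^ m`. -/
def diffWeight (m q : ℕ) (x : ℝ) : ℝ :=
  if q < m then Real.exp (-(((m + q : ℕ) : ℝ) * x))
  else Real.exp (-(((q - m : ℕ) : ℝ) * x)) * (1 - Real.exp (-(m * x))) ^ 2

theorem measurable_diffWeight (m q : ℕ) : Measurable (diffWeight m q) := by
  unfold diffWeight
  split_ifs <;> fun_prop

theorem one_sub_exp_neg_nat_mul_mem {x : ℝ} (hx : 0 < x) (m : ℕ) :
    0 ≤ 1 - Real.exp (-(m * x)) ∧ 1 - Real.exp (-(m * x)) ≤ 1 ∧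
      1 - Real.exp (-(m * x)) ≤ m * (1 - Real.exp (-x)) := by
  refine ⟨?_, ?_, ?_⟩
  · have : Real.exp (-(m * x)) ≤ 1 := Real.exp_le_one_iff.2 (by
      have : (0 : ℝ) ≤ m * x := by positivity
      linarith)
    linarith
  · linarith [Real.exp_pos (-(m * x))]
  · have h := one_add_mul_le_pow (a := Real.exp (-x) - 1)
      (by linarith [Real.exp_pos (-x)]) m
    rw [add_sub_cancel, ← Real.exp_nat_mul] at h
    have e : (m : ℝ) * -x = -(m * x) := by ring
    rw [e] at h
    linarith

/-- The sum over q is split at m and 2m. For q < m the integrals are ≲ (1+m)^{σ-1}, while the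
(1+q)^{-σ} sum to ≲ m^{1-σ}. For q = m + p with p < m, the prefactor is at most (1+m)^{-σ} and the
integrals, ≲ (1+p)^{σ-1}, sum to ≲ m^σ. For q = 2m + j the cancellation in `diffWeight` gives terms
≲ m(1+m+j)^{-2}, whose sum is bounded. -/
theorem exists_tsum_diffWeight_le {σ : ℝ} (h0 : 0 < σ) (h1 : σ < 1) : ∃ C : ℝ≥0, ∀ m : ℕ,
    ∑' q : ℕ, ENNReal.ofReal ((1 + q) ^ (-σ)) * ∫⁻ x in Set.Ioi (0 : ℝ), ENNReal.ofReal
      (Real.exp (-x) * (1 - Real.exp (-x)) ^ (-σ) * diffWeight m q x) ≤ C := by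
  have hG1 := Real.Gamma_pos_of_pos (show 0 < 1 - σ by linarith)
  have hG2 := Real.Gamma_pos_of_pos (show 0 < 2 - σ by linarith)
  have hs : 0 < 1 - σ := by linarith
  set c := 1 + Real.Gamma (1 - σ) with hc
  have hcp : 0 < c := by positivity
  refine ⟨(c / (1 - σ) + (c / σ + Real.Gamma (2 - σ))).toNNReal, fun m => ?_⟩
  set T : ℕ → ℝ≥0∞ := fun q => ENNReal.ofReal ((1 + q) ^ (-σ)) * ∫⁻ x in Set.Ioi (0 : ℝ),
    ENNReal.ofReal (Real.exp (-x) * (1 - Real.exp (-x)) ^ (-σ) * diffWeight m q x) with hT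
  have hA : ∀ q < m, T q ≤ ENNReal.ofReal ((1 + q) ^ (-σ) * (c * (1 + m) ^ (-(1 - σ)))) := by
    intro q hq
    rw [ENNReal.ofReal_mul (by positivity)]
    refine mul_le_mul' le_rfl ?_
    simp only [diffWeight, if_pos hq]
    refine (lintegral_exp_weight_le h0 h1 (m + q)).trans (ENNReal.ofReal_le_ofReal ?_)
    gcongr ?_ * ?_
    rw [Real.rpow_neg (by positivity), Real.rpow_neg (by positivity)]
    gcongr
    omega
  have hB : ∀ p < m, T (m + p) ≤ ENNReal.ofReal ((1 + m) ^ (-σ) * (c * (1 + p) ^ (-(1 - σ)))) := by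
    intro p _
    rw [ENNReal.ofReal_mul (by positivity)]
    have hn : ¬ m + p < m := by omega
    refine mul_le_mul' (ENNReal.ofReal_le_ofReal ?_) ?_
    · rw [Real.rpow_neg (by positivity), Real.rpow_neg (by positivity)]
      gcongr
      omega
    · simp only [diffWeight, if_neg hn, Nat.add_sub_cancel_left]
      refine le_trans (setLIntegral_mono' measurableSet_Ioi fun x hx => ?_)
        (lintegral_exp_weight_le h0 h1 p)
      have hp := one_sub_exp_neg_pos hx
      obtain ⟨u0, u1, -⟩ := one_sub_exp_neg_nat_mul_mem hx m
      apply ENNReal.ofReal_le_ofReal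
      refine mul_le_mul_of_nonneg_left ?_ (by positivity)
      exact mul_le_of_le_one_right (Real.exp_pos _).le (pow_le_one₀ u0 u1)
  have hC : ∀ j, T (j + (m + m)) ≤
      ENNReal.ofReal (Real.Gamma (2 - σ) * (m * ((1 + m + (j : ℝ)) ^ 2)⁻¹)) := by
    intro j
    have hn : ¬ j + (m + m) < m := by omega
    have hn2 : j + (m + m) - m = m + j := by omega
    have hI : ∫⁻ x in Set.Ioi (0 : ℝ), ENNReal.ofReal (Real.exp (-x) *
        (1 - Real.exp (-x)) ^ (-σ) * diffWeight m (j + (m + m)) x)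
        ≤ ENNReal.ofReal m * ENNReal.ofReal
          (Real.Gamma (2 - σ) * (1 + ((m + j : ℕ) : ℝ)) ^ (-(2 - σ))) := by
      simp only [diffWeight, if_neg hn, hn2]
      refine le_trans ?_ (mul_le_mul' le_rfl (lintegral_exp_weight_le' h1 (m + j)))
      rw [← lintegral_const_mul' _ _ ENNReal.ofReal_ne_top]
      refine setLIntegral_mono' measurableSet_Ioi fun x hx => ?_
      have hp := one_sub_exp_neg_pos hx
      obtain ⟨u0, u1, u2⟩ := one_sub_exp_neg_nat_mul_mem hx m
      rw [← ENNReal.ofReal_mul (by positivity)]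
      apply ENNReal.ofReal_le_ofReal
      -- One factor is bounded by 1, the other by Bernoulli.
      have : (1 - Real.exp (-(m * x))) ^ 2 ≤ m * (1 - Real.exp (-x)) := by nlinarith
      calc _ ≤ Real.exp (-x) * (1 - Real.exp (-x)) ^ (-σ) *
            (Real.exp (-(((m + j : ℕ) : ℝ) * x)) * (m * (1 - Real.exp (-x)))) := by gcongr
        _ = _ := by ring
    refine (mul_le_mul' (le_refl _) hI).trans ?_
    rw [← ENNReal.ofReal_mul (by positivity), ← ENNReal.ofReal_mul (by positivity)]
    apply ENNReal.ofReal_le_ofReal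
    have hb : (0 : ℝ) < 1 + m + j := by positivity
    have e : (((1 : ℝ) + m + j) ^ 2)⁻¹ = (1 + m + j) ^ (-σ) * (1 + m + j) ^ (-(2 - σ)) := by
      rw [← Real.rpow_add hb, ← Real.rpow_natCast, ← Real.rpow_neg hb.le]
      congr 1; push_cast; ring
    have e2 : (1 : ℝ) + ((m + j : ℕ) : ℝ) = 1 + m + j := by push_cast; ring
    rw [e, e2]
    have h3 : (1 + ((j + (m + m) : ℕ) : ℝ)) ^ (-σ) ≤ (1 + m + j : ℝ) ^ (-σ) := by
      rw [Real.rpow_neg (by positivity), Real.rpow_neg (by positivity)]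
      refine inv_anti₀ (by positivity) (Real.rpow_le_rpow hb.le ?_ h0.le)
      push_cast
      linarith [m.cast_nonneg (α := ℝ)]
    calc _ ≤ (1 + m + j : ℝ) ^ (-σ) *
          (m * (Real.Gamma (2 - σ) * (1 + m + j : ℝ) ^ (-(2 - σ)))) := by
          gcongr
      _ = _ := by ring
  have hm1 : (0 : ℝ) < 1 + m := by positivity
  have hmle : (m : ℝ) ≤ 1 + m := by linarith
  have hSA : ∑ q ∈ Finset.range m, T q ≤ ENNReal.ofReal (c / (1 - σ)) := by
    refine (Finset.sum_le_sum fun q hq => hA q (Finset.mem_range.1 hq)).trans ?_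
    rw [← ENNReal.ofReal_sum_of_nonneg fun _ _ => by positivity]
    apply ENNReal.ofReal_le_ofReal
    rw [← Finset.sum_mul]
    calc _ ≤ ((m : ℝ) ^ (1 - σ) / (1 - σ)) * (c * (1 + m) ^ (-(1 - σ))) := by
          gcongr; exact sum_rpow_neg_le h0 h1 m
      _ ≤ ((1 + m : ℝ) ^ (1 - σ) / (1 - σ)) * (c * (1 + m) ^ (-(1 - σ))) := by gcongr
      _ = (c / (1 - σ)) * ((1 + m : ℝ) ^ (1 - σ) * (1 + m) ^ (-(1 - σ))) := by ring
      _ = _ := by rw [← Real.rpow_add hm1]; simp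
  have hSB : ∑ p ∈ Finset.range m, T (m + p) ≤ ENNReal.ofReal (c / σ) := by
    refine (Finset.sum_le_sum fun p hp => hB p (Finset.mem_range.1 hp)).trans ?_
    rw [← ENNReal.ofReal_sum_of_nonneg fun _ _ => by positivity]
    apply ENNReal.ofReal_le_ofReal
    rw [← Finset.mul_sum, ← Finset.mul_sum]
    have h2 := sum_rpow_neg_le hs (by linarith) m
    rw [sub_sub_cancel] at h2
    calc _ ≤ (1 + m : ℝ) ^ (-σ) * (c * ((m : ℝ) ^ σ / σ)) := by gcongr
      _ ≤ (1 + m : ℝ) ^ (-σ) * (c * ((1 + m : ℝ) ^ σ / σ)) := by gcongr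
      _ = (c / σ) * ((1 + m : ℝ) ^ (-σ) * (1 + m) ^ σ) := by ring
      _ = _ := by rw [← Real.rpow_add hm1]; simp
  have hSC : ∑' j, T (j + (m + m)) ≤ ENNReal.ofReal (Real.Gamma (2 - σ)) := by
    refine (ENNReal.tsum_le_tsum hC).trans ?_
    rw [ENNReal.tsum_eq_iSup_nat]
    refine iSup_le fun K => ?_
    rw [← ENNReal.ofReal_sum_of_nonneg fun _ _ => by positivity]
    apply ENNReal.ofReal_le_ofReal
    rw [← Finset.mul_sum]
    exact mul_le_of_le_one_right hG2.le (sum_mul_inv_sq_le m K)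
  have hsplit := ENNReal.summable.sum_add_tsum_nat_add' (f := T) (k := m + m)
  rw [Finset.sum_range_add] at hsplit
  rw [← hsplit, add_assoc]
  refine (add_le_add hSA (add_le_add hSB hSC)).trans (le_of_eq ?_)
  rw [← ENNReal.ofReal_add (by positivity) (by positivity),
    ← ENNReal.ofReal_add (by positivity) (by positivity), ENNReal.ofReal]

section

variable {H : Type*} [NormedAddCommGroup H] [InnerProductSpace ℂ H]

/-- The Taylor coefficients in `w` of `(f z - f w) / (1 - z̄ w)`, where `f = ∑ aₘ zᵐ`. -/
def diffCoeff (a : ℕ → H) (z : ℂ) (q : ℕ) : H :=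
  star z ^ q • powerSum a z - ∑ m ∈ Finset.range (q + 1), star z ^ (q - m) • a m

theorem star_circleMap_pow (r θ : ℝ) (n : ℕ) :
    star (circleMap 0 r θ) ^ n = (r : ℂ) ^ n * Complex.exp (((-n : ℤ) : ℂ) * θ * Complex.I) := by
  rw [← star_pow, circleMap_pow, Complex.star_def, map_mul, map_pow, Complex.conj_ofReal,
    ← Complex.exp_conj]
  congr 2
  simp

/-- On a circle both z̄^q z^m and z̄^{q-m} have frequency m - q, so distinct m are orthogonal. The
subtracted term is present only for m ≤ q, where r^{m+q} - r^{q-m} = -r^{q-m}(1-r^{2m}); this yields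
the two cases of `diffWeight`. -/
theorem lintegral_circle_diffCoeff [CompleteSpace H] {a : ℕ → H} (ha : ConvergesTo a 1) (q : ℕ)
    {x : ℝ} (hx : 0 < x) :
    ∫⁻ θ, ‖diffCoeff a (circleMap 0 (Real.exp (-x / 2)) θ) q‖ₑ ^ 2 ∂angleMeasure
      = ∑' m, ENNReal.ofReal (diffWeight m q x) * ‖a m‖ₑ ^ 2 := by
  set r := Real.exp (-x / 2) with hr
  have hr0 : 0 < r := Real.exp_pos _
  have hr1 : r < 1 := Real.exp_lt_one_iff.2 (by linarith)
  let γ : ℕ → ℝ := fun m => r ^ (m + q) - if m < q + 1 then r ^ (q - m) else 0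
  have hser : ∀ θ, diffCoeff a (circleMap 0 r θ) q
      = ∑' m : ℕ, Complex.exp ((((m : ℤ) - q : ℤ) : ℂ) * θ * Complex.I) • ((γ m : ℂ) • a m) := by
    intro θ
    set z := circleMap 0 r θ with hz
    have hzn : ‖z‖ < 1 := by rwa [hz, norm_circleMap_zero_of_nonneg hr0.le]
    have h1 := (ha.hasSum hzn).const_smul (star z ^ q)
    have h2 : HasSum (fun m => if m < q + 1 then star z ^ (q - m) • a m else 0)
        (∑ m ∈ Finset.range (q + 1), star z ^ (q - m) • a m) := by
      rw [Finset.sum_congr rfl (g := fun m => if m < q + 1 then star z ^ (q - m) • a m else 0)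
        fun m hm => by rw [if_pos (Finset.mem_range.1 hm)]]
      refine hasSum_sum_of_ne_finset_zero fun m hm => ?_
      rw [if_neg fun h => hm (Finset.mem_range.2 h)]
    rw [diffCoeff, ← (h1.sub h2).tsum_eq]
    refine tsum_congr fun m => ?_
    have e1 : star z ^ q * z ^ m
        = Complex.exp ((((m : ℤ) - q : ℤ) : ℂ) * θ * Complex.I) * (r : ℂ) ^ (m + q) := by
      rw [hz, star_circleMap_pow, circleMap_pow, pow_add]
      have : Complex.exp ((((m : ℤ) - q : ℤ) : ℂ) * θ * Complex.I)
          = Complex.exp (((m : ℤ) : ℂ) * θ * Complex.I) *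
            Complex.exp (((-q : ℤ) : ℂ) * θ * Complex.I) := by
        rw [← Complex.exp_add]; congr 1; push_cast; ring
      rw [this]; ring
    rw [smul_smul, e1, smul_smul]
    simp only [γ]
    split_ifs with hm
    · have e2 : star z ^ (q - m)
          = Complex.exp ((((m : ℤ) - q : ℤ) : ℂ) * θ * Complex.I) * (r : ℂ) ^ (q - m) := by
        rw [hz, star_circleMap_pow, mul_comm]
        congr 3
        rw [Nat.cast_sub (by omega)]
        push_cast
        ring
      rw [e2, ← sub_smul]
      push_cast
      rw [mul_sub]
    · simp
  have hγ : ∀ m, γ m ^ 2 = diffWeight m q x := by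
    intro m
    have hpow : ∀ k : ℕ, (r ^ k) ^ 2 = Real.exp (-(k * x)) := fun k => by
      rw [← pow_mul, hr, ← Real.exp_nat_mul]
      congr 1; push_cast; ring
    simp only [γ, diffWeight]
    by_cases h : q < m
    · rw [if_pos h, if_neg (by omega), sub_zero, hpow]
    · rw [if_neg h, if_pos (by omega), ← hpow (q - m), ← hpow m, ← mul_pow]
      have : r ^ (m + q) = r ^ (q - m) * (r ^ m) ^ 2 := by
        rw [← pow_mul, ← pow_add]; congr 1; omega
      rw [this]
      ring
  have hγs : Summable fun m => ‖(γ m : ℂ) • a m‖ := by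
    have hs1 : Summable fun m => ‖a m‖ * r ^ m * r ^ q := (ha r hr0.le hr1).mul_right _
    have hs2 : Summable fun m => if m < q + 1 then ‖a m‖ * r ^ (q - m) else 0 :=
      summable_of_ne_finset_zero (s := Finset.range (q + 1)) fun m hm => by
        rw [if_neg fun h => hm (Finset.mem_range.2 h)]
    refine Summable.of_nonneg_of_le (fun _ => norm_nonneg _) (fun m => ?_) (hs1.add hs2)
    rw [norm_smul, Complex.norm_real]
    calc ‖γ m‖ * ‖a m‖ ≤ (r ^ (m + q) + if m < q + 1 then r ^ (q - m) else 0) * ‖a m‖ := by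
          gcongr
          refine (norm_sub_le _ _).trans (le_of_eq ?_)
          rw [Real.norm_of_nonneg (by positivity), Real.norm_of_nonneg]
          split_ifs <;> positivity
      _ = _ := by rw [pow_add]; split_ifs <;> ring
  have hinj : Function.Injective fun m : ℕ => ((m : ℤ) - q) := fun m n h => by
    simpa using h
  simp_rw [hser]
  refine (lintegral_enorm_sq_trigSeries hinj hγs).trans (tsum_congr fun m => ?_)
  rw [enorm_smul, mul_pow, ← hγ, ← ofReal_norm, Complex.norm_real,
    ← ENNReal.ofReal_pow (norm_nonneg _), Real.norm_eq_abs, sq_abs]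

theorem measurable_diffCoeff [CompleteSpace H] {a : ℕ → H} (ha : ConvergesTo a 1) (q : ℕ) :
    Measurable fun z : Metric.ball (0 : ℂ) 1 => ‖diffCoeff a z q‖ₑ := by
  have h : Continuous fun z : Metric.ball (0 : ℂ) 1 => powerSum a z :=
    ha.differentiableOn.continuousOn.domRestrict
  have : Continuous fun z : Metric.ball (0 : ℂ) 1 => diffCoeff a z q := by
    unfold diffCoeff
    fun_prop
  exact this.enorm.measurable

/-- Up to the factor πΓ(σ), the left side is the double integral of ‖f(z)-f(w)‖²/|1-z̄w|² against
(1-|z|²)^{-σ}(log 1/|w|²)^{σ-1}. By orthogonality it is diagonal in the aₘ, and `hC` bounds the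
diagonal entries. -/
theorem lintegral_ball_tsum_diffCoeff_le [CompleteSpace H] {σ : ℝ} {C : ℝ≥0∞}
    (hC : ∀ m : ℕ, ∑' q : ℕ, ENNReal.ofReal ((1 + q) ^ (-σ)) * ∫⁻ x in Set.Ioi (0 : ℝ),
      ENNReal.ofReal (Real.exp (-x) * (1 - Real.exp (-x)) ^ (-σ) * diffWeight m q x) ≤ C)
    {a : ℕ → H} (ha : ConvergesTo a 1) :
    ∫⁻ z in Metric.ball (0 : ℂ) 1, ∑' q : ℕ, ENNReal.ofReal ((1 + q) ^ (-σ)) *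
        (‖diffCoeff a z q‖ₑ ^ 2 * ENNReal.ofReal ((1 - ‖z‖ ^ 2) ^ (-σ)))
      ≤ ENNReal.ofReal Real.pi * C * ∑' m, ‖a m‖ₑ ^ 2 := by
  have hmz : Measurable fun z : ℂ => ENNReal.ofReal ((1 - ‖z‖ ^ 2) ^ (-σ)) := by fun_prop
  have hm : ∀ q, Measurable fun z : Metric.ball (0 : ℂ) 1 =>
      ‖diffCoeff a z q‖ₑ ^ 2 * ENNReal.ofReal ((1 - ‖(z : ℂ)‖ ^ 2) ^ (-σ)) := fun q =>
    ((measurable_diffCoeff ha q).pow_const 2).mul (hmz.comp measurable_subtype_coe)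
  rw [lintegral_tsum fun q => aemeasurable_restrict_of_measurable_subtype
    Metric.isOpen_ball.measurableSet ((hm q).const_mul _)]
  have hq : ∀ q : ℕ, ∫⁻ z in Metric.ball (0 : ℂ) 1, ENNReal.ofReal ((1 + q) ^ (-σ)) *
        (‖diffCoeff a z q‖ₑ ^ 2 * ENNReal.ofReal ((1 - ‖z‖ ^ 2) ^ (-σ)))
      = ENNReal.ofReal Real.pi * ∑' m, ‖a m‖ₑ ^ 2 * (ENNReal.ofReal ((1 + q) ^ (-σ)) *
        ∫⁻ x in Set.Ioi (0 : ℝ), ENNReal.ofReal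
          (Real.exp (-x) * (1 - Real.exp (-x)) ^ (-σ) * diffWeight m q x)) := by
    intro q
    have hmt : ∀ m, Measurable fun x => ENNReal.ofReal
          (Real.exp (-x) * (1 - Real.exp (-x)) ^ (-σ) * diffWeight m q x) := fun m => by
      have := measurable_diffWeight m q
      fun_prop
    rw [lintegral_const_mul' _ _ ENNReal.ofReal_ne_top, lintegral_ball_eq (hm q), mul_left_comm]
    congr 1
    rw [tsum_congr fun m => mul_left_comm _ _ _, ENNReal.tsum_mul_left]
    congr 1
    simp_rw [← lintegral_const_mul _ (hmt _)]
    rw [← lintegral_tsum fun m => ((hmt m).const_mul _).aemeasurable]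
    refine setLIntegral_congr_fun measurableSet_Ioi fun x hx => ?_
    have hx' : (0 : ℝ) < x := hx
    have hn : ∀ θ, ‖circleMap 0 (Real.exp (-x / 2)) θ‖ ^ 2 = Real.exp (-x) := fun θ => by
      rw [norm_circleMap_zero_of_nonneg (Real.exp_pos _).le, ← Real.exp_nat_mul]
      congr 1; push_cast; ring
    have hp := one_sub_exp_neg_pos hx'
    simp only [hn]
    rw [lintegral_mul_const' _ _ ENNReal.ofReal_ne_top, lintegral_circle_diffCoeff ha q hx',
      ← ENNReal.tsum_mul_right, ← ENNReal.tsum_mul_left]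
    refine tsum_congr fun m => ?_
    rw [ENNReal.ofReal_mul (by positivity), ENNReal.ofReal_mul (by positivity)]
    ring
  rw [tsum_congr hq, ENNReal.tsum_mul_left, ENNReal.tsum_comm, mul_assoc]
  gcongr
  rw [← ENNReal.tsum_mul_left]
  refine ENNReal.tsum_le_tsum fun m => ?_
  rw [ENNReal.tsum_mul_left, mul_comm]
  exact mul_le_mul' (hC m) le_rfl

end

/-! ### The Hankel operator controls the Carleson embedding -/

theorem ConvergesTo.sub {E : Type*} [NormedAddCommGroup E] {c d : ℕ → E} {R : ℝ}
    (hc : ConvergesTo c R) (hd : ConvergesTo d R) : ConvergesTo (fun n => c n - d n) R :=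
  fun r h0 hr => Summable.of_nonneg_of_le (fun _ => by positivity) (fun n => by
    rw [← add_mul]
    exact mul_le_mul_of_nonneg_right (norm_sub_le _ _) (by positivity))
    ((hc r h0 hr).add (hd r h0 hr))

/-- Clears the denominator 1 - z̄w, both in the kernel and in the difference quotient. -/
theorem one_sub_smul_powerSum {E : Type*} [NormedAddCommGroup E] [NormedSpace ℂ E]
    [CompleteSpace E] {c c' : ℕ → E} {R : ℝ} (hc : ConvergesTo c R) {w : ℂ} (hw : ‖w‖ < R) (t : ℂ)
    (h0 : c' 0 = c 0) (hs : ∀ n, c' (n + 1) = c (n + 1) - t • c n) :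
    (1 - t * w) • powerSum c w = powerSum c' w := by
  have h1 := hc.hasSum hw
  have h2 := (hasSum_nat_add_iff' 1).2 h1
  have h3 := h2.sub (h1.const_smul (t * w))
  have h4 : HasSum (fun n => w ^ (n + 1) • c' (n + 1))
      (powerSum c w - ∑ i ∈ Finset.range 1, w ^ i • c i - (t * w) • powerSum c w) := by
    convert h3 using 2 with n
    rw [hs, smul_sub, smul_smul, smul_smul, pow_succ]
    congr 2
    ring
  have h5 := (hasSum_nat_add_iff (f := fun n => w ^ n • c' n) 1).1 h4
  rw [powerSum, powerSum, h5.tsum_eq]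
  simp only [Finset.range_one, Finset.sum_singleton, pow_zero, one_smul, h0, sub_smul]
  rw [powerSum]
  abel

/-- With y = (1+n)(1-s) one has (1+n)^σ = (1-s)^{-σ}y^σ and y^σ ≤ 1 + y. The sums of s^n and of
(1-s)(1+n)s^n are both 1/(1-s), whence the 2. -/
theorem tsum_rpow_mul_geometric_le {σ s : ℝ} (h0 : 0 < σ) (h1 : σ < 1) (hs0 : 0 ≤ s)
    (hs1 : s < 1) : ∑' n : ℕ, ENNReal.ofReal ((1 + (n : ℝ)) ^ σ * s ^ n)
      ≤ ENNReal.ofReal (2 * (1 - s) ^ (-(1 + σ))) := by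
  have hp : 0 < 1 - s := by linarith
  have hn : ‖s‖ < 1 := by rwa [Real.norm_of_nonneg hs0]
  have hg := hasSum_geometric_of_lt_one hs0 hs1
  have hg2 := hasSum_coe_mul_geometric_of_norm_lt_one hn
  have hsum := ((hg.add ((hg.add hg2).mul_left (1 - s))).mul_left ((1 - s) ^ (-σ)))
  have hle : ∀ n : ℕ, (1 + (n : ℝ)) ^ σ * s ^ n
      ≤ (1 - s) ^ (-σ) * (s ^ n + (1 - s) * (s ^ n + n * s ^ n)) := by
    intro n
    have e1 : (1 + (n : ℝ)) ^ σ = (1 - s) ^ (-σ) * ((1 + n) * (1 - s)) ^ σ := by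
      rw [Real.mul_rpow (by positivity) hp.le, mul_left_comm, ← Real.rpow_add hp]
      simp
    have e2 : ((1 + (n : ℝ)) * (1 - s)) ^ σ ≤ 1 + (1 + n) * (1 - s) := by
      have hy : 0 ≤ (1 + (n : ℝ)) * (1 - s) := by positivity
      rcases le_total ((1 + (n : ℝ)) * (1 - s)) 1 with h | h
      · exact (Real.rpow_le_one hy h h0.le).trans (by linarith)
      · refine (Real.rpow_le_rpow_of_exponent_le h h1.le).trans ?_
        rw [Real.rpow_one]; linarith
    calc (1 + (n : ℝ)) ^ σ * s ^ n
        ≤ ((1 - s) ^ (-σ) * (1 + (1 + n) * (1 - s))) * s ^ n := by rw [e1]; gcongr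
      _ = _ := by ring
  have hval : (1 - s) ^ (-σ) * ((1 - s)⁻¹ + (1 - s) * ((1 - s)⁻¹ + s / (1 - s) ^ 2))
      = 2 * (1 - s) ^ (-(1 + σ)) := by
    rw [neg_add, Real.rpow_add hp, Real.rpow_neg_one]
    field_simp
    ring
  rw [hval] at hsum
  rw [← hsum.tsum_eq, ENNReal.ofReal_tsum_of_nonneg (fun n => by positivity) hsum.summable]
  exact ENNReal.tsum_le_tsum fun n => ENNReal.ofReal_le_ofReal (hle n)

section

variable {H : Type*} [NormedAddCommGroup H] [InnerProductSpace ℂ H]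

theorem diffCoeff_zero (a : ℕ → H) (z : ℂ) : diffCoeff a z 0 = powerSum a z - a 0 := by
  simp [diffCoeff]

theorem diffCoeff_succ (a : ℕ → H) (z : ℂ) (q : ℕ) :
    diffCoeff a z (q + 1) = star z • diffCoeff a z q - a (q + 1) := by
  rw [diffCoeff, diffCoeff, Finset.sum_range_succ, smul_sub, smul_smul, ← pow_succ',
    Finset.smul_sum, Nat.sub_self, pow_zero, one_smul, sub_add_eq_sub_sub]
  congr 2
  refine Finset.sum_congr rfl fun m hm => ?_
  rw [smul_smul, ← pow_succ']
  congr 2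
  have := Finset.mem_range.1 hm
  omega

theorem convergesTo_diffCoeff {a : ℕ → H} {R : ℝ} (hR : 1 < R) (ha : ConvergesTo a R) {z : ℂ}
    (hz : ‖z‖ < 1) : ConvergesTo (diffCoeff a z) 1 := by
  have hs : Summable fun m => ‖a m‖ := by simpa using ha 1 zero_le_one hR
  refine ConvergesTo.of_bounded fun r h0 hr =>
    ⟨‖powerSum a z‖ + ∑' m, ‖a m‖, fun q => ?_⟩
  have hz' : ‖star z‖ ≤ 1 := by rw [norm_star]; exact hz.le
  have hb : ‖diffCoeff a z q‖ ≤ ‖powerSum a z‖ + ∑' m, ‖a m‖ := by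
    refine (norm_sub_le _ _).trans (add_le_add ?_ ?_)
    · rw [norm_smul, norm_pow]
      exact mul_le_of_le_one_left (norm_nonneg _) (pow_le_one₀ (norm_nonneg _) hz')
    · refine (norm_sum_le _ _).trans ((Finset.sum_le_sum fun m _ => ?_).trans
        (hs.sum_le_tsum _ fun _ _ => norm_nonneg _))
      rw [norm_smul, norm_pow]
      exact mul_le_of_le_one_left (norm_nonneg _) (pow_le_one₀ (norm_nonneg _) hz')
  calc ‖diffCoeff a z q‖ * r ^ q ≤ ‖diffCoeff a z q‖ * 1 := by
        gcongr; exact pow_le_one₀ h0 hr.le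
    _ ≤ _ := by rwa [mul_one]

theorem summable_inner_shift {φ a : ℕ → H} (hφ : ConvergesTo φ 1) {R : ℝ} (hR : 1 < R)
    (ha : ConvergesTo a R) (n : ℕ) : Summable fun m => ⟪φ (m + n), a m⟫_ℂ := by
  have hp : ConvergesTo (fun k : ℕ => if k = n then (1 : ℂ) else 0) R :=
    convergesTo_of_finite (K := n + 1) (fun k hk => if_neg (by omega)) R
  have h := (summable_inner_hankelForm hφ hR ha hp).of_norm.comp_injective
    (i := fun m : ℕ => (m, n)) (fun _ _ h => (Prod.mk.inj h).1)
  simpa [Function.comp_def] using h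

theorem convergesTo_rpowDiff {α : ℝ} (hα : 0 < α) {z : ℂ} {R : ℝ} (hz : ‖z‖ * R ≤ 1) :
    ConvergesTo (fun n : ℕ => ((rpowDiff α n : ℝ) : ℂ) • (star z ^ n • (1 : ℂ))) R :=
  (convergesTo_geometric (by rwa [norm_star]) (1 : ℂ)).smul_of_le (A := 1 + α) (β := α) fun n => by
    rw [Complex.norm_real, Real.norm_of_nonneg (rpowDiff_nonneg hα n)]
    exact rpowDiff_le hα n

/-- Multiplication by 1 - z̄w replaces the weights (1+n)^{1+α} by their differences, a gain of one
order in n. -/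
theorem one_sub_smul_powerSum_fracCoeff {α : ℝ} (hα : 0 < α) {z w : ℂ} (hz : ‖z‖ < 1)
    (hw : ‖w‖ < 1) :
    (1 - star z * w) • powerSum (fracCoeff (1 + α) fun n => star z ^ n • (1 : ℂ)) w
      = powerSum (fun n : ℕ => ((rpowDiff α n : ℝ) : ℂ) • (star z ^ n • (1 : ℂ))) w := by
  have hp : ConvergesTo (fracCoeff (1 + α) fun n => star z ^ n • (1 : ℂ)) 1 :=
    (convergesTo_geometric (by rw [norm_star, mul_one]; exact hz.le) (1 : ℂ)).rpow_smul (1 + α)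
  refine one_sub_smul_powerSum hp hw (star z) ?_ fun n => ?_
  · simp [fracCoeff, rpowDiff, Real.zero_rpow (show 1 + α ≠ 0 by linarith)]
  · simp only [fracCoeff, rpowDiff, smul_eq_mul, pow_succ]
    push_cast
    rw [add_comm (n : ℝ) 1]
    ring

theorem convergesTo_hankelCoeff {φ a : ℕ → H} (hφ : ConvergesTo φ 1) {R : ℝ} (hR : 1 < R)
    (ha : ConvergesTo a R) : ConvergesTo (hankelCoeff φ a) 1 := by
  intro r h0 hr
  obtain ⟨R', hR', hrR'⟩ := exists_one_lt_mul_le hr h0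
  have hp : ConvergesTo (fun n : ℕ => (r : ℂ) ^ n • (1 : ℂ)) R' :=
    convergesTo_geometric (by rwa [Complex.norm_real, Real.norm_of_nonneg h0]) 1
  have h := summable_mul_hankelCoeff hφ (lt_min hR hR') (ha.mono (min_le_left R R'))
    (hp.mono (min_le_right R R'))
  refine h.congr fun n => ?_
  rw [smul_eq_mul, mul_one, norm_mul, norm_pow, Complex.norm_real, Real.norm_of_nonneg h0, mul_comm]

/-- The coefficients of the function `w ↦ f z - f w`. -/
def incrCoeff (a : ℕ → H) (z : ℂ) (m : ℕ) : H := (if m = 0 then powerSum a z else 0) - a m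

theorem convergesTo_incrCoeff {a : ℕ → H} {R : ℝ} (ha : ConvergesTo a R) (z : ℂ) :
    ConvergesTo (incrCoeff a z) R :=
  (convergesTo_of_finite (K := 1) (fun m hm => if_neg (by omega)) R).sub ha

theorem hankelCoeff_incrCoeff {φ a : ℕ → H} (hφ : ConvergesTo φ 1) {R : ℝ} (hR : 1 < R)
    (ha : ConvergesTo a R) (z : ℂ) (n : ℕ) :
    hankelCoeff φ (incrCoeff a z) n = ⟪φ n, powerSum a z⟫_ℂ - hankelCoeff φ a n := by
  have h1 : HasSum (fun m => ⟪φ (m + n), if m = 0 then powerSum a z else 0⟫_ℂ)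
      ⟪φ n, powerSum a z⟫_ℂ := by
    convert hasSum_single 0 (f := fun m => ⟪φ (m + n), if m = 0 then powerSum a z else 0⟫_ℂ)
      (fun m hm => by rw [if_neg hm, inner_zero_right]) using 1
    simp
  have h2 := h1.sub (summable_inner_shift hφ hR ha n).hasSum
  rw [hankelCoeff, hankelCoeff, ← h2.tsum_eq]
  exact tsum_congr fun m => by rw [incrCoeff, inner_sub_right]

/-- The antianalytic function `∑ (1 + n)^{1+α} bₙ z̄ⁿ`, where `bₙ` are the coefficients of the
image of `∑ aₘ zᵐ` under the Hankel operator. -/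
def coHankel (α : ℝ) (φ a : ℕ → H) (z : ℂ) : ℂ :=
  ∑' n, fracCoeff (1 + α) (fun n => star z ^ n • (1 : ℂ)) n * hankelCoeff φ a n

/-- The conjugate of `coHankel` is analytic. As 1-|z|² ≤ x and the moments of x are Γ(2)(1+n)^{-2},
one order of differentiation is absorbed and D^α remains. -/
theorem lintegral_coHankel_le {α : ℝ} {φ a : ℕ → H} (hφ : ConvergesTo φ 1) {R : ℝ} (hR : 1 < R)
    (ha : ConvergesTo a R) :
    (Measurable fun z : Metric.ball (0 : ℂ) 1 => ‖coHankel α φ a z‖ₑ) ∧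
    ∫⁻ z in Metric.ball (0 : ℂ) 1, ‖coHankel α φ a z‖ₑ ^ 2 * ENNReal.ofReal (1 - ‖z‖ ^ 2)
      ≤ ENNReal.ofReal Real.pi * ∑' n, ‖fracCoeff α (hankelCoeff φ a) n‖ₑ ^ 2 := by
  set B : ℕ → ℂ := fun n => star (fracCoeff (1 + α) (hankelCoeff φ a) n) with hB
  have hBc : ConvergesTo B 1 := by
    have := (convergesTo_hankelCoeff hφ hR ha).rpow_smul (1 + α)
    intro r h0 hr
    refine (this r h0 hr).congr fun n => ?_
    rw [hB, norm_star, fracCoeff]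
  have he : ∀ z, ‖coHankel α φ a z‖ₑ = ‖powerSum B z‖ₑ := by
    intro z
    have : powerSum B z = star (coHankel α φ a z) := by
      rw [coHankel, Complex.star_def, Complex.conj_tsum, powerSum]
      refine tsum_congr fun n => ?_
      simp only [B, fracCoeff, smul_eq_mul, Complex.star_def, map_mul, map_pow, Complex.conj_ofReal,
        Complex.conj_conj, mul_one]
      ring
    rw [this, ← ofReal_norm, ← ofReal_norm, norm_star]
  simp_rw [he]
  refine ⟨measurable_powerSum hBc, ?_⟩
  have h1 : ∫⁻ z in Metric.ball (0 : ℂ) 1, ‖powerSum B z‖ₑ ^ 2 * ENNReal.ofReal (1 - ‖z‖ ^ 2)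
      ≤ ∫⁻ z in Metric.ball (0 : ℂ) 1, ‖powerSum B z‖ₑ ^ 2 *
        (fun x : ℝ => ENNReal.ofReal (x ^ (1 : ℝ))) (-2 * Real.log ‖z‖) := by
    refine lintegral_mono_ae ?_
    filter_upwards [ae_ball_ne_zero] with z hz
    refine mul_le_mul' le_rfl (ENNReal.ofReal_le_ofReal ?_)
    rw [norm_sq_eq_exp_of_mem_ball hz.2, Real.rpow_one]
    exact one_sub_exp_neg_le _
  refine h1.trans ?_
  rw [lintegral_ball_powerSum (W := fun x => ENNReal.ofReal (x ^ (1 : ℝ))) hBc (by fun_prop)]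
  gcongr with n
  rw [lintegral_exp_mul_rpow (by norm_num), hB, ← ofReal_norm, ← ofReal_norm, norm_star,
    ← ENNReal.ofReal_pow (norm_nonneg _), ← ENNReal.ofReal_pow (norm_nonneg _),
    ← ENNReal.ofReal_mul (by positivity)]
  apply ENNReal.ofReal_le_ofReal
  have hn : (0 : ℝ) < 1 + n := by positivity
  rw [fracCoeff, fracCoeff, norm_smul, norm_smul, Complex.norm_real, Complex.norm_real,
    Real.norm_of_nonneg (by positivity), Real.norm_of_nonneg (by positivity),
    Real.rpow_add hn, Real.rpow_one, show (1 : ℝ) + 1 = 2 by norm_num, Real.Gamma_two,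
    Real.rpow_neg hn.le, Real.rpow_two]
  apply le_of_eq
  field_simp

variable [CompleteSpace H]

theorem one_sub_smul_powerSum_diffCoeff {a : ℕ → H} {R : ℝ} (hR : 1 < R) (ha : ConvergesTo a R)
    {z w : ℂ} (hz : ‖z‖ < 1) (hw : ‖w‖ < 1) :
    (1 - star z * w) • powerSum (diffCoeff a z) w = powerSum (incrCoeff a z) w :=
  one_sub_smul_powerSum (convergesTo_diffCoeff hR ha hz) hw (star z)
    (by simp [incrCoeff, diffCoeff_zero]) fun n => by
      rw [diffCoeff_succ, incrCoeff, if_neg n.succ_ne_zero]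
      abel

/-- The constant f(z) sits at m = 0, so the kernel reproduces D^{1+α}φ(z) against it; the part -f(w)
contributes `coHankel`. -/
theorem tsum_hankelForm_incrCoeff {α : ℝ} {φ a : ℕ → H} (hφ : ConvergesTo φ 1) {R : ℝ}
    (hR : 1 < R) (ha : ConvergesTo a R) {z : ℂ} (hz : ‖z‖ < 1)
    (hp : ConvergesTo (fracCoeff (1 + α) fun n => star z ^ n • (1 : ℂ)) R) :
    ∑' q : ℕ × ℕ, fracCoeff (1 + α) (fun n => star z ^ n • (1 : ℂ)) q.2 *
        ⟪φ (q.1 + q.2), incrCoeff a z q.1⟫_ℂ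
      = ⟪powerSum (fracCoeff (1 + α) φ) z, powerSum a z⟫_ℂ - coHankel α φ a z := by
  have hψ : ConvergesTo (fracCoeff (1 + α) φ) 1 := hφ.rpow_smul (1 + α)
  rw [tsum_hankelForm hφ hR (convergesTo_incrCoeff ha z) hp]
  have h1 := (hasSum_inner_powerSum hψ hz (powerSum a z)).sub
    (summable_mul_hankelCoeff hφ hR ha hp).of_norm.hasSum
  rw [coHankel, ← h1.tsum_eq]
  refine tsum_congr fun n => ?_
  rw [hankelCoeff_incrCoeff hφ hR ha, mul_sub]
  congr 1
  simp only [fracCoeff, smul_eq_mul, inner_smul_left, Complex.conj_ofReal]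
  ring

/-- The squared coefficients are ≲ (1+n)^{2α}|z|^{2n} and the moments ≲ (1+n)^{σ-2α}, leaving
∑(1+n)^σ|z|^{2n}. The condition σ < 2α makes x^{2α-1-σ} integrable at 0. -/
theorem lintegral_rpowDiff_le {α σ : ℝ} (hα : 0 < α) (h0 : 0 < σ) (h1 : σ < 1) (h2 : σ < 2 * α)
    {z : ℂ} (hz : ‖z‖ < 1)
    (hd : ConvergesTo (fun n : ℕ => ((rpowDiff α n : ℝ) : ℂ) • (star z ^ n • (1 : ℂ))) 1) :
    ∫⁻ w in Metric.ball (0 : ℂ) 1,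
        ‖powerSum (fun n : ℕ => ((rpowDiff α n : ℝ) : ℂ) • (star z ^ n • (1 : ℂ))) w‖ₑ ^ 2 *
        ENNReal.ofReal (2 * (-2 * Real.log ‖w‖) ^ (2 * α + 1 - σ) +
          2 * (-2 * Real.log ‖w‖) ^ (2 * α - 1 - σ))
      ≤ ENNReal.ofReal (Real.pi * (2 * Real.Gamma (2 * α + 2 - σ) + 2 * Real.Gamma (2 * α - σ)) *
        (1 + α) ^ 2 * 2) * ENNReal.ofReal ((1 - ‖z‖ ^ 2) ^ (-(1 + σ))) := by
  have hG1 := Real.Gamma_pos_of_pos (show 0 < 2 * α + 2 - σ by linarith)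
  have hG2 := Real.Gamma_pos_of_pos (show 0 < 2 * α - σ by linarith)
  have hpi := Real.pi_pos
  set K := 2 * Real.Gamma (2 * α + 2 - σ) + 2 * Real.Gamma (2 * α - σ) with hK
  have hz2 : ‖z‖ ^ 2 < 1 := pow_lt_one₀ (norm_nonneg _) hz two_ne_zero
  rw [lintegral_ball_powerSum (W := fun x => ENNReal.ofReal
    (2 * x ^ (2 * α + 1 - σ) + 2 * x ^ (2 * α - 1 - σ))) hd (by fun_prop)]
  have hmom : ∀ n : ℕ, ∫⁻ x in Set.Ioi (0 : ℝ), ENNReal.ofReal (Real.exp (-((1 + n) * x))) *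
      ENNReal.ofReal (2 * x ^ (2 * α + 1 - σ) + 2 * x ^ (2 * α - 1 - σ))
      ≤ ENNReal.ofReal (K * (1 + n) ^ (-(2 * α - σ))) := by
    intro n
    calc _ ≤ ∫⁻ x in Set.Ioi (0 : ℝ), (2 * (ENNReal.ofReal (Real.exp (-((1 + n) * x))) *
            ENNReal.ofReal (x ^ (2 * α + 1 - σ))) + 2 * (ENNReal.ofReal
            (Real.exp (-((1 + n) * x))) * ENNReal.ofReal (x ^ (2 * α - 1 - σ)))) := by
          refine lintegral_mono fun x => ?_
          simp only
          refine (mul_le_mul' le_rfl ENNReal.ofReal_add_le).trans (le_of_eq ?_)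
          rw [ENNReal.ofReal_mul two_pos.le, ENNReal.ofReal_mul two_pos.le, ENNReal.ofReal_ofNat]
          ring
      _ = ENNReal.ofReal (2 * (Real.Gamma (2 * α + 2 - σ) * (1 + n) ^ (-(2 * α + 2 - σ)))) +
            ENNReal.ofReal (2 * (Real.Gamma (2 * α - σ) * (1 + n) ^ (-(2 * α - σ)))) := by
          rw [lintegral_add_left (by fun_prop), lintegral_const_mul _ (by fun_prop),
            lintegral_const_mul _ (by fun_prop), lintegral_exp_mul_rpow (by linarith),
            lintegral_exp_mul_rpow (by linarith), ENNReal.ofReal_mul two_pos.le,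
            ENNReal.ofReal_mul two_pos.le, ENNReal.ofReal_ofNat,
            show 2 * α + 1 - σ + 1 = 2 * α + 2 - σ by ring,
            show 2 * α - 1 - σ + 1 = 2 * α - σ by ring]
      _ ≤ _ := by
          rw [← ENNReal.ofReal_add (by positivity) (by positivity)]
          apply ENNReal.ofReal_le_ofReal
          have : (1 + (n : ℝ)) ^ (-(2 * α + 2 - σ)) ≤ (1 + (n : ℝ)) ^ (-(2 * α - σ)) :=
            Real.rpow_le_rpow_of_exponent_le (by linarith [n.cast_nonneg (α := ℝ)]) (by linarith)
          rw [hK, add_mul, ← mul_assoc, ← mul_assoc]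
          gcongr
  have hterm : ∀ n : ℕ, ‖((rpowDiff α n : ℝ) : ℂ) • (star z ^ n • (1 : ℂ))‖ₑ ^ 2 *
      ENNReal.ofReal (K * (1 + n) ^ (-(2 * α - σ)))
      ≤ ENNReal.ofReal (K * (1 + α) ^ 2) *
        ENNReal.ofReal ((1 + (n : ℝ)) ^ σ * (‖z‖ ^ 2) ^ n) := by
    intro n
    rw [← ofReal_norm, ← ENNReal.ofReal_pow (norm_nonneg _), ← ENNReal.ofReal_mul (by positivity),
      ← ENNReal.ofReal_mul (by positivity)]
    apply ENNReal.ofReal_le_ofReal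
    rw [norm_smul, norm_smul, norm_one, mul_one, norm_pow, norm_star, Complex.norm_real,
      Real.norm_of_nonneg (rpowDiff_nonneg hα n), mul_pow, ← pow_mul, ← pow_mul, mul_comm n 2]
    have h3 : rpowDiff α n ^ 2 ≤ (1 + α) ^ 2 * (1 + (n : ℝ)) ^ (2 * α) := by
      have := pow_le_pow_left₀ (rpowDiff_nonneg hα n) (rpowDiff_le hα n) 2
      rwa [mul_pow, ← Real.rpow_natCast ((1 + (n : ℝ)) ^ α), ← Real.rpow_mul (by positivity),
        show α * ((2 : ℕ) : ℝ) = 2 * α by push_cast; ring] at this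
    have h4 : (1 + (n : ℝ)) ^ (2 * α) * (1 + (n : ℝ)) ^ (-(2 * α - σ)) = (1 + (n : ℝ)) ^ σ := by
      rw [← Real.rpow_add (by positivity)]; congr 1; ring
    calc rpowDiff α n ^ 2 * ‖z‖ ^ (2 * n) * (K * (1 + (n : ℝ)) ^ (-(2 * α - σ)))
        ≤ ((1 + α) ^ 2 * (1 + (n : ℝ)) ^ (2 * α)) * ‖z‖ ^ (2 * n) *
          (K * (1 + (n : ℝ)) ^ (-(2 * α - σ))) := by gcongr
      _ = K * (1 + α) ^ 2 * (((1 + (n : ℝ)) ^ (2 * α) * (1 + (n : ℝ)) ^ (-(2 * α - σ))) *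
          ‖z‖ ^ (2 * n)) := by ring
      _ = _ := by rw [h4]
  calc _ ≤ ENNReal.ofReal Real.pi * ∑' n : ℕ, ENNReal.ofReal (K * (1 + α) ^ 2) *
        ENNReal.ofReal ((1 + (n : ℝ)) ^ σ * (‖z‖ ^ 2) ^ n) := by
        refine mul_le_mul' le_rfl (ENNReal.tsum_le_tsum fun n => ?_)
        exact (mul_le_mul' le_rfl (hmom n)).trans (hterm n)
    _ ≤ ENNReal.ofReal Real.pi * (ENNReal.ofReal (K * (1 + α) ^ 2) *
        ENNReal.ofReal (2 * (1 - ‖z‖ ^ 2) ^ (-(1 + σ)))) := by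
        rw [ENNReal.tsum_mul_left]
        gcongr
        exact tsum_rpow_mul_geometric_le h0 h1 (by positivity) hz2
    _ = _ := by
        rw [← ENNReal.ofReal_mul (by positivity), ← ENNReal.ofReal_mul (by positivity),
          ← ENNReal.ofReal_mul (by positivity)]
        congr 1
        ring

/-- Cauchy-Schwarz in w between d and the difference quotient, after φ has been removed by the Bloch
bound. The parameter σ distributes the radial weight so that both integrals converge. -/
theorem exists_enorm_sub_coHankel_le {α σ : ℝ} (hα : 0 < α) (h0 : 0 < σ) (h1 : σ < 1)
    (h2 : σ < 2 * α) : ∃ C : ℝ≥0,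
    ∀ {H : Type u} [NormedAddCommGroup H] [InnerProductSpace ℂ H] [CompleteSpace H]
      {φ a : ℕ → H} {R : ℝ} {M : ℝ≥0∞}, ConvergesTo φ 1 → HankelBound α φ M → 1 < R →
      ConvergesTo a R → ∀ {z : ℂ}, ‖z‖ < 1 →
      ‖⟪powerSum (fracCoeff (1 + α) φ) z, powerSum a z⟫_ℂ - coHankel α φ a z‖ₑ ^ 2 *
          ENNReal.ofReal (1 - ‖z‖ ^ 2)
        ≤ C * M * ∑' q : ℕ, ENNReal.ofReal ((1 + q) ^ (-σ)) *
          (‖diffCoeff a z q‖ₑ ^ 2 * ENNReal.ofReal ((1 - ‖z‖ ^ 2) ^ (-σ))) := by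
  have hG := Real.Gamma_pos_of_pos (show 0 < α + 1 by linarith)
  have hG0 := Real.Gamma_pos_of_pos h0
  have hG1 := Real.Gamma_pos_of_pos (show 0 < 2 * α + 2 - σ by linarith)
  have hG2 := Real.Gamma_pos_of_pos (show 0 < 2 * α - σ by linarith)
  have hpi := Real.pi_pos
  set c₀ : ℝ := Real.pi * Real.Gamma (α + 1) with hc₀
  set c₁ : ℝ := Real.pi * (2 * Real.Gamma (2 * α + 2 - σ) + 2 * Real.Gamma (2 * α - σ)) *
        (1 + α) ^ 2 * 2 with hc₁
  set c₂ : ℝ := Real.pi * (1 + α) ^ 2 * Real.Gamma σ with hc₂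
  have hc₀p : 0 < c₀ := by positivity
  have hc₁p : 0 < c₁ := by positivity
  have hc₂p : 0 < c₂ := by positivity
  refine ⟨((c₀ ^ 2)⁻¹ * (c₁ * c₂)).toNNReal,
    fun {H} _ _ _ {φ a R M} hφ hM hR ha {z} hz => ?_⟩
  obtain ⟨R', hR', hzR'⟩ := exists_one_lt_mul_le hz (norm_nonneg z)
  have hz2 : ‖z‖ ^ 2 < 1 := pow_lt_one₀ (norm_nonneg _) hz two_ne_zero
  have hs : 0 < 1 - ‖z‖ ^ 2 := by linarith
  have ha1 := ha.mono hR.le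
  have hψ : ConvergesTo (fracCoeff (1 + α) φ) 1 := hφ.rpow_smul (1 + α)
  set p := fracCoeff (1 + α) fun n => star z ^ n • (1 : ℂ) with hpdef
  set d := fun n : ℕ => ((rpowDiff α n : ℝ) : ℂ) • (star z ^ n • (1 : ℂ)) with hddef
  have hp' : ConvergesTo p R' :=
    (convergesTo_geometric (by rwa [norm_star]) (1 : ℂ)).rpow_smul (1 + α)
  have hd : ConvergesTo d 1 := convergesTo_rpowDiff hα (by rw [mul_one]; exact hz.le)
  have hRR : 1 < min R R' := lt_min hR hR'
  have ham := ha.mono (min_le_left R R')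
  have hp := hp'.mono (min_le_right R R')
  have hi := convergesTo_incrCoeff ham z
  have hq := convergesTo_diffCoeff hR ha hz
  have key := enorm_hankelForm_le hα hφ hRR hi hp
  rw [tsum_hankelForm_incrCoeff hφ hRR ham hz hp] at key
  have hGmeas : Measurable fun x : ℝ => M * (ENNReal.ofReal ((1 + α) ^ 2) *
    ENNReal.ofReal (x ^ (σ - 1))) := by fun_prop
  have cs := lintegral_sq_le_mul (μ := volume.restrict (Metric.ball (0 : ℂ) 1))
    (h := fun w => ‖powerSum p w‖ₑ *
      ‖⟪powerSum (fracCoeff (1 + α) φ) w, powerSum (incrCoeff a z) w⟫_ℂ‖ₑ *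
          ENNReal.ofReal ((-2 * Real.log ‖w‖) ^ α))
    (F := fun w => ‖powerSum d w‖ₑ ^ 2 * ENNReal.ofReal
      (2 * (-2 * Real.log ‖w‖) ^ (2 * α + 1 - σ) + 2 * (-2 * Real.log ‖w‖) ^ (2 * α - 1 - σ)))
    (G := fun w => ‖powerSum (diffCoeff a z) w‖ₑ ^ 2 * (fun x : ℝ => M *
      (ENNReal.ofReal ((1 + α) ^ 2) * ENNReal.ofReal (x ^ (σ - 1)))) (-2 * Real.log ‖w‖))
    (aemeasurable_restrict_of_measurable_subtype Metric.isOpen_ball.measurableSet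
      (((measurable_powerSum hd).pow_const 2).mul (by fun_prop)))
    (aemeasurable_restrict_of_measurable_subtype Metric.isOpen_ball.measurableSet
      (((measurable_powerSum hq).pow_const 2).mul (hGmeas.comp (by fun_prop)))) ?_
  · have hGval : ∫⁻ w in Metric.ball (0 : ℂ) 1, ‖powerSum (diffCoeff a z) w‖ₑ ^ 2 *
        (fun x : ℝ => M * (ENNReal.ofReal ((1 + α) ^ 2) * ENNReal.ofReal (x ^ (σ - 1))))
          (-2 * Real.log ‖w‖)
        = ENNReal.ofReal c₂ * M * ∑' q : ℕ, ENNReal.ofReal ((1 + q) ^ (-σ)) *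
          ‖diffCoeff a z q‖ₑ ^ 2 := by
      rw [lintegral_ball_powerSum hq hGmeas, hc₂, mul_assoc Real.pi, ENNReal.ofReal_mul hpi.le,
        mul_assoc, mul_assoc]
      congr 1
      rw [← ENNReal.tsum_mul_left, ← ENNReal.tsum_mul_left]
      refine tsum_congr fun n => ?_
      have e : ∫⁻ x in Set.Ioi (0 : ℝ), ENNReal.ofReal (Real.exp (-((1 + n) * x))) *
          (M * (ENNReal.ofReal ((1 + α) ^ 2) * ENNReal.ofReal (x ^ (σ - 1))))
          = M * (ENNReal.ofReal ((1 + α) ^ 2) *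
            ENNReal.ofReal (Real.Gamma σ * (1 + n) ^ (-σ))) := by
        have := lintegral_exp_mul_rpow (β := σ - 1) (by linarith) n
        rw [sub_add_cancel] at this
        rw [← this, ← lintegral_const_mul _ (by fun_prop), ← lintegral_const_mul _ (by fun_prop)]
        refine lintegral_congr fun x => ?_
        ring
      rw [e, ENNReal.ofReal_mul hG0.le, ENNReal.ofReal_mul (by positivity)]
      ring
    have hF := lintegral_rpowDiff_le hα h0 h1 h2 hz hd
    have hkey := (pow_le_pow_left₀ zero_le key 2).trans (cs.trans (mul_le_mul' hF hGval.le))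
    set D := ‖⟪powerSum (fracCoeff (1 + α) φ) z, powerSum a z⟫_ℂ - coHankel α φ a z‖ₑ with hD
    have hc0ne : ENNReal.ofReal (c₀ ^ 2) ≠ 0 :=
      (ENNReal.ofReal_pos.2 (by positivity)).ne'
    have hrw : ∑' q : ℕ, ENNReal.ofReal ((1 + q) ^ (-σ)) *
          (‖diffCoeff a z q‖ₑ ^ 2 * ENNReal.ofReal ((1 - ‖z‖ ^ 2) ^ (-σ)))
        = (∑' q : ℕ, ENNReal.ofReal ((1 + q) ^ (-σ)) * ‖diffCoeff a z q‖ₑ ^ 2) *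
          ENNReal.ofReal ((1 - ‖z‖ ^ 2) ^ (-σ)) := by
      rw [← ENNReal.tsum_mul_right]
      exact tsum_congr fun q => (mul_assoc _ _ _).symm
    -- The factor 1-|z|² of the Carleson measure turns the loss (1-|z|²)^{-(1+σ)} into the
    -- integrable weight (1-|z|²)^{-σ}.
    have hpow : ENNReal.ofReal ((1 - ‖z‖ ^ 2) ^ (-(1 + σ))) * ENNReal.ofReal (1 - ‖z‖ ^ 2)
        = ENNReal.ofReal ((1 - ‖z‖ ^ 2) ^ (-σ)) := by
      rw [← ENNReal.ofReal_mul (by positivity)]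
      congr 1
      nth_rewrite 2 [← Real.rpow_one (1 - ‖z‖ ^ 2)]
      rw [← Real.rpow_add hs]
      congr 1
      ring
    rw [hrw]
    set S₁ := ∑' q : ℕ, ENNReal.ofReal ((1 + q) ^ (-σ)) * ‖diffCoeff a z q‖ₑ ^ 2 with hS₁
    have hC : ((((c₀ ^ 2)⁻¹ * (c₁ * c₂)).toNNReal : ℝ≥0) : ℝ≥0∞)
        = (ENNReal.ofReal (c₀ ^ 2))⁻¹ * (ENNReal.ofReal c₁ * ENNReal.ofReal c₂) := by
      rw [← ENNReal.ofReal_inv_of_pos (by positivity), ← ENNReal.ofReal_mul (by positivity),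
        ← ENNReal.ofReal_mul (by positivity), ENNReal.ofReal]
    rw [hC]
    calc D ^ 2 * ENNReal.ofReal (1 - ‖z‖ ^ 2)
        = (ENNReal.ofReal (c₀ ^ 2))⁻¹ * ((ENNReal.ofReal c₀ * D) ^ 2) *
          ENNReal.ofReal (1 - ‖z‖ ^ 2) := by
          rw [mul_pow (ENNReal.ofReal c₀) D, ← ENNReal.ofReal_pow hc₀p.le, ← mul_assoc,
            ENNReal.inv_mul_cancel hc0ne ENNReal.ofReal_ne_top, one_mul]
      _ ≤ (ENNReal.ofReal (c₀ ^ 2))⁻¹ * (ENNReal.ofReal c₁ *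
          ENNReal.ofReal ((1 - ‖z‖ ^ 2) ^ (-(1 + σ))) * (ENNReal.ofReal c₂ * M * S₁)) *
          ENNReal.ofReal (1 - ‖z‖ ^ 2) := by gcongr
      _ = (ENNReal.ofReal (c₀ ^ 2))⁻¹ * (ENNReal.ofReal c₁ * ENNReal.ofReal c₂) * M * (S₁ *
          (ENNReal.ofReal ((1 - ‖z‖ ^ 2) ^ (-(1 + σ))) * ENNReal.ofReal (1 - ‖z‖ ^ 2))) := by
          ring
      _ = _ := by rw [hpow]
  · filter_upwards [ae_ball_ne_zero] with w hw
    have hω := neg_two_mul_log_norm_pos hw.2 hw.1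
    have hsq := norm_sq_eq_exp_of_mem_ball hw.2
    have hb := hM.bloch hα hφ hw.1 (powerSum (incrCoeff a z) w)
    rw [hsq] at hb
    set x := -2 * Real.log ‖w‖ with hx
    have hx1 := one_sub_exp_neg_pos hω
    -- The denominator of the kernel derivative passes to the increment: the factors 1 - z̄w cancel
    -- in the product.
    have hfac : ‖powerSum p w‖ₑ ^ 2 * ‖powerSum (incrCoeff a z) w‖ₑ ^ 2
        = ‖powerSum d w‖ₑ ^ 2 * ‖powerSum (diffCoeff a z) w‖ₑ ^ 2 := by
      rw [← one_sub_smul_powerSum_diffCoeff hR ha hz hw.1,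
        ← one_sub_smul_powerSum_fracCoeff hα hz hw.1, enorm_smul, enorm_smul]
      ring
    -- The Bloch factor is at most 2 + 2x^{-2} up to (1+α)²; taking x^{σ-1} out of x^{2α}(2+2x^{-2})
    -- leaves the weight of `F`.
    have hreal : ENNReal.ofReal ((1 + α) ^ 2 * (1 - Real.exp (-x))⁻¹ ^ 2) *
        ENNReal.ofReal (x ^ α) ^ 2
        ≤ ENNReal.ofReal (2 * x ^ (2 * α + 1 - σ) + 2 * x ^ (2 * α - 1 - σ)) *
          (ENNReal.ofReal ((1 + α) ^ 2) * ENNReal.ofReal (x ^ (σ - 1))) := by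
      rw [← ENNReal.ofReal_pow (by positivity), ← ENNReal.ofReal_mul (by positivity),
        ← ENNReal.ofReal_mul (by positivity), ← ENNReal.ofReal_mul (by positivity)]
      apply ENNReal.ofReal_le_ofReal
      have h3 : (1 - Real.exp (-x))⁻¹ ^ 2 ≤ (1 + x⁻¹) ^ 2 :=
        pow_le_pow_left₀ (by positivity) (inv_one_sub_exp_neg_le hω) 2
      have h4 : (1 + x⁻¹) ^ 2 ≤ 2 + 2 * x⁻¹ ^ 2 := by nlinarith [sq_nonneg (1 - x⁻¹)]
      have h5 : (x ^ α) ^ 2 = x ^ (2 * α) := by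
        rw [← Real.rpow_natCast, ← Real.rpow_mul hω.le]
        congr 1; push_cast; ring
      have h6 : x ^ (2 * α + 1 - σ) * x ^ (σ - 1) = x ^ (2 * α) := by
        rw [← Real.rpow_add hω]; congr 1; ring
      have h7 : x ^ (2 * α - 1 - σ) * x ^ (σ - 1) = x⁻¹ ^ 2 * x ^ (2 * α) := by
        rw [← Real.rpow_add hω, inv_pow, ← Real.rpow_natCast, ← Real.rpow_neg hω.le,
          ← Real.rpow_add hω]
        congr 1; push_cast; ring
      calc (1 + α) ^ 2 * (1 - Real.exp (-x))⁻¹ ^ 2 * (x ^ α) ^ 2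
          ≤ (1 + α) ^ 2 * (2 + 2 * x⁻¹ ^ 2) * x ^ (2 * α) := by
            rw [h5]; gcongr; exact h3.trans h4
        _ = (1 + α) ^ 2 * (2 * x ^ (2 * α) + 2 * (x⁻¹ ^ 2 * x ^ (2 * α))) := by ring
        _ = (1 + α) ^ 2 * (2 * (x ^ (2 * α + 1 - σ) * x ^ (σ - 1)) +
              2 * (x ^ (2 * α - 1 - σ) * x ^ (σ - 1))) := by rw [h6, h7]
        _ = _ := by ring
    calc _ = ‖powerSum p w‖ₑ ^ 2 *
          ‖⟪powerSum (fracCoeff (1 + α) φ) w, powerSum (incrCoeff a z) w⟫_ℂ‖ₑ ^ 2 *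
          ENNReal.ofReal (x ^ α) ^ 2 := by ring
      _ ≤ ‖powerSum p w‖ₑ ^ 2 * (M * ENNReal.ofReal ((1 + α) ^ 2 * (1 - Real.exp (-x))⁻¹ ^ 2) *
          ‖powerSum (incrCoeff a z) w‖ₑ ^ 2) * ENNReal.ofReal (x ^ α) ^ 2 := by gcongr
      _ = (‖powerSum p w‖ₑ ^ 2 * ‖powerSum (incrCoeff a z) w‖ₑ ^ 2) * M *
          (ENNReal.ofReal ((1 + α) ^ 2 * (1 - Real.exp (-x))⁻¹ ^ 2) *
          ENNReal.ofReal (x ^ α) ^ 2) := by ring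
      _ ≤ (‖powerSum p w‖ₑ ^ 2 * ‖powerSum (incrCoeff a z) w‖ₑ ^ 2) * M *
          (ENNReal.ofReal (2 * x ^ (2 * α + 1 - σ) + 2 * x ^ (2 * α - 1 - σ)) *
          (ENNReal.ofReal ((1 + α) ^ 2) * ENNReal.ofReal (x ^ (σ - 1)))) := by gcongr
      _ = _ := by rw [hfac]; ring

/-- Boundedness of the Hankel operator implies the Carleson embedding. -/
theorem exists_carleson_le_hankel {α : ℝ} (hα : 0 < α) : ∃ C : ℝ≥0,
    ∀ {H : Type u} [NormedAddCommGroup H] [InnerProductSpace ℂ H] [CompleteSpace H]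
      {φ a : ℕ → H} {R : ℝ} {M : ℝ≥0∞}, ConvergesTo φ 1 → HankelBound α φ M → 1 < R →
      ConvergesTo a R →
      ∫⁻ z in Metric.ball (0 : ℂ) 1,
        ‖⟪powerSum (fracCoeff (1 + α) φ) z, powerSum a z⟫_ℂ‖ₑ ^ 2 *
          ENNReal.ofReal (1 - ‖z‖ ^ 2) ≤ C * M * ∑' m, ‖a m‖ₑ ^ 2 := by
  -- Any exponent strictly between 0 and min(1, 2α) would serve.
  have hσ0 : 0 < min α (1 / 2) := lt_min hα (by norm_num)
  have hσ1 : min α (1 / 2) < 1 := (min_le_right _ _).trans_lt (by norm_num)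
  have hσ2 : min α (1 / 2) < 2 * α := (min_le_left _ _).trans_lt (by linarith)
  set σ := min α (1 / 2)
  obtain ⟨C₁, hC₁⟩ := exists_tsum_diffWeight_le hσ0 hσ1
  obtain ⟨C₂, hC₂⟩ := exists_enorm_sub_coHankel_le.{u} hα hσ0 hσ1 hσ2
  refine ⟨2 * Real.pi.toNNReal + 2 * C₂ * (Real.pi.toNNReal * C₁),
    fun {H} _ _ _ {φ a R M} hφ hM hR ha => ?_⟩
  obtain ⟨hum, hu⟩ := lintegral_coHankel_le (α := α) hφ hR ha
  have hpt : ∀ z ∈ Metric.ball (0 : ℂ) 1,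
      ‖⟪powerSum (fracCoeff (1 + α) φ) z, powerSum a z⟫_ℂ‖ₑ ^ 2 * ENNReal.ofReal (1 - ‖z‖ ^ 2)
      ≤ 2 * (‖coHankel α φ a z‖ₑ ^ 2 * ENNReal.ofReal (1 - ‖z‖ ^ 2)) +
        2 * (C₂ * M * ∑' q : ℕ, ENNReal.ofReal ((1 + q) ^ (-σ)) *
          (‖diffCoeff a z q‖ₑ ^ 2 * ENNReal.ofReal ((1 - ‖z‖ ^ 2) ^ (-σ)))) := by
    intro z hz
    have hz' : ‖z‖ < 1 := by simpa using hz
    refine le_trans ?_ (add_le_add_right (mul_le_mul' le_rfl (hC₂ hφ hM hR ha hz')) _)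
    set x := ⟪powerSum (fracCoeff (1 + α) φ) z, powerSum a z⟫_ℂ
    set y := coHankel α φ a z
    rw [← mul_assoc, ← mul_assoc, ← add_mul]
    gcongr
    have h1 : ‖x‖ₑ ≤ ‖y‖ₑ + ‖x - y‖ₑ := by
      calc ‖x‖ₑ = ‖y + (x - y)‖ₑ := by rw [add_sub_cancel]
        _ ≤ _ := enorm_add_le _ _
    calc ‖x‖ₑ ^ 2 ≤ (‖y‖ₑ + ‖x - y‖ₑ) ^ 2 := by gcongr
      _ ≤ 2 * (‖y‖ₑ ^ 2 + ‖x - y‖ₑ ^ 2) := by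
        have := ENNReal.rpow_add_le_mul_rpow_add_rpow ‖y‖ₑ ‖x - y‖ₑ (one_le_two (α := ℝ))
        rw [show (2 : ℝ) - 1 = 1 by norm_num] at this
        simpa only [ENNReal.rpow_one, ENNReal.rpow_ofNat] using this
      _ = _ := by ring
  refine (setLIntegral_mono' Metric.isOpen_ball.measurableSet hpt).trans ?_
  have hmu : AEMeasurable (fun z => 2 * (‖coHankel α φ a z‖ₑ ^ 2 * ENNReal.ofReal (1 - ‖z‖ ^ 2)))
      (volume.restrict (Metric.ball (0 : ℂ) 1)) :=
    aemeasurable_restrict_of_measurable_subtype Metric.isOpen_ball.measurableSet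
      (((hum.pow_const 2).mul (by fun_prop)).const_mul 2)
  have hmd : AEMeasurable (fun z => ∑' q : ℕ, ENNReal.ofReal ((1 + q) ^ (-σ)) *
          (‖diffCoeff a z q‖ₑ ^ 2 * ENNReal.ofReal ((1 - ‖z‖ ^ 2) ^ (-σ))))
      (volume.restrict (Metric.ball (0 : ℂ) 1)) :=
    aemeasurable_restrict_of_measurable_subtype Metric.isOpen_ball.measurableSet
      (Measurable.tsum fun q => (((measurable_diffCoeff (ha.mono hR.le) q).pow_const 2).mul
        (by fun_prop)).const_mul _)
  rw [lintegral_add_left' hmu, lintegral_const_mul' _ _ ENNReal.ofNat_ne_top,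
    lintegral_const_mul' _ _ ENNReal.ofNat_ne_top, lintegral_const_mul'' _ hmd]
  have h3 := lintegral_ball_tsum_diffCoeff_le hC₁ (ha.mono hR.le)
  calc _ ≤ 2 * (ENNReal.ofReal Real.pi * (M * ∑' m, ‖a m‖ₑ ^ 2)) +
        2 * (C₂ * M * (ENNReal.ofReal Real.pi * C₁ * ∑' m, ‖a m‖ₑ ^ 2)) := by
        gcongr
        exact hu.trans (mul_le_mul' le_rfl (hM a R hR ha))
    _ = _ := by
        rw [ENNReal.ofReal]
        push_cast
        ring

end

/-! ### From coefficient sequences to functions -/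

theorem hardyNorm_congr {E : Type*} [NormedAddCommGroup E] {f g : ℂ → E}
    (h : Set.EqOn f g (Metric.ball 0 1)) : hardyNorm f = hardyNorm g := by
  refine iSup_congr fun r => iSup_congr fun hr => ?_
  congr 1
  funext θ
  exact h (by rw [mem_ball_zero_iff, norm_circleMap_zero_of_nonneg hr.1.le]; exact hr.2)

theorem extendsAnalytically_powerSum {E : Type*} [NormedAddCommGroup E] [NormedSpace ℂ E]
    [CompleteSpace E] {c : ℕ → E} {R : ℝ} (hR : 1 < R) (hc : ConvergesTo c R) :
    ExtendsAnalytically (powerSum c) :=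
  ⟨R, hR, powerSum c, hc.differentiableOn, fun _ _ => rfl⟩

theorem summable_norm_sq_of_tsum_enorm_ne_top {E : Type*} [NormedAddCommGroup E] {c : ℕ → E}
    (h : ∑' n, ‖c n‖ₑ ^ 2 ≠ ∞) : Summable fun n => ‖c n‖ ^ 2 := by
  have e : ∀ n, ‖c n‖ₑ ^ 2 = ENNReal.ofReal (‖c n‖ ^ 2) := fun n => by
    rw [ENNReal.ofReal_pow (norm_nonneg _), ofReal_norm]
  simp_rw [e] at h
  refine (ENNReal.summable_toReal h).congr fun n => ?_
  rw [ENNReal.toReal_ofReal (by positivity)]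

theorem tsum_enorm_sq_ne_top {E : Type*} [NormedAddCommGroup E] {c : ℕ → E} {R : ℝ} (hR : 1 < R)
    (hc : ConvergesTo c R) : ∑' n, ‖c n‖ₑ ^ 2 ≠ ∞ := by
  have hs : Summable fun n => ‖c n‖ := by simpa using hc 1 zero_le_one hR
  have h2 : Summable fun n => ‖c n‖ ^ 2 := by
    obtain ⟨A, hA0, hA⟩ := hc.bounded zero_le_one hR
    refine Summable.of_nonneg_of_le (fun _ => by positivity) (fun n => ?_) (hs.mul_left A)
    rw [sq]
    have := hA n
    rw [one_pow, mul_one] at this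
    gcongr
  rw [tsum_enorm_sq_eq h2]
  exact ENNReal.ofReal_ne_top

/-- The truncation of a sequence. -/
def truncate {E : Type*} [NormedAddCommGroup E] (a : ℕ → E) (K m : ℕ) : E :=
  if m < K then a m else 0

theorem convergesTo_truncate {E : Type*} [NormedAddCommGroup E] (a : ℕ → E) (K : ℕ)
    (R : ℝ) : ConvergesTo (truncate a K) R :=
  convergesTo_of_finite (K := K) (fun _ hm => if_neg (not_lt.2 hm)) R

theorem tsum_enorm_sq_truncate {E : Type*} [NormedAddCommGroup E] (a : ℕ → E) (K : ℕ) :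
    ∑' m, ‖truncate a K m‖ₑ ^ 2 = ∑ m ∈ Finset.range K, ‖a m‖ₑ ^ 2 := by
  rw [tsum_eq_sum (s := Finset.range K)]
  · exact Finset.sum_congr rfl fun m hm => by rw [truncate, if_pos (Finset.mem_range.1 hm)]
  · intro m hm
    rw [truncate, if_neg fun h => hm (Finset.mem_range.2 h)]
    simp

section

variable {H : Type u} [NormedAddCommGroup H] [InnerProductSpace ℂ H]

theorem hankelCoeff_smul (φ a : ℕ → H) (c : ℂ) (n : ℕ) :
    hankelCoeff φ (fun m => c • a m) n = c * hankelCoeff φ a n := by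
  simp only [hankelCoeff, inner_smul_right, tsum_mul_left]

theorem summable_inner_of_sq {φ a : ℕ → H} (hφ : Summable fun m => ‖φ m‖ ^ 2)
    (ha : Summable fun m => ‖a m‖ ^ 2) (n : ℕ) : Summable fun m => ⟪φ (m + n), a m⟫_ℂ := by
  refine Summable.of_norm_bounded (((summable_nat_add_iff n).2 hφ).add ha) fun m => ?_
  refine (norm_inner_le_norm _ _).trans ?_
  nlinarith [sq_nonneg (‖φ (m + n)‖ - ‖a m‖), sq_nonneg ‖φ (m + n)‖, sq_nonneg ‖a m‖]

theorem hankelCoeff_truncate (φ a : ℕ → H) (K n : ℕ) :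
    hankelCoeff φ (truncate a K) n = ∑ m ∈ Finset.range K, ⟪φ (m + n), a m⟫_ℂ := by
  rw [hankelCoeff, tsum_eq_sum (s := Finset.range K)]
  · exact Finset.sum_congr rfl fun m hm => by rw [truncate, if_pos (Finset.mem_range.1 hm)]
  · intro m hm
    rw [truncate, if_neg fun h => hm (Finset.mem_range.2 h), inner_zero_right]

/-- Testing on a truncation of φ itself, the coefficient of index 0 of the image is s = ∑‖φₘ‖², so
s² ≤ Ms; s is finite and can be cancelled. -/
theorem HankelBound.tsum_symbol_le {α : ℝ} {φ : ℕ → H} {M : ℝ≥0∞} (hM : HankelBound α φ M) :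
    ∑' m, ‖φ m‖ₑ ^ 2 ≤ M := by
  rw [ENNReal.tsum_eq_iSup_nat]
  refine iSup_le fun K => ?_
  have h := (ENNReal.le_tsum 0).trans (hM _ 2 one_lt_two (convergesTo_truncate φ K 2))
  rw [tsum_enorm_sq_truncate, fracCoeff, hankelCoeff_truncate] at h
  set s := ∑ m ∈ Finset.range K, ‖φ m‖ₑ ^ 2 with hs
  have e : ‖∑ m ∈ Finset.range K, ⟪φ (m + 0), φ m⟫_ℂ‖ₑ = s := by
    have : ∑ m ∈ Finset.range K, ⟪φ (m + 0), φ m⟫_ℂ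
        = ((∑ m ∈ Finset.range K, ‖φ m‖ ^ 2 : ℝ) : ℂ) := by
      rw [Complex.ofReal_sum]
      refine Finset.sum_congr rfl fun m _ => ?_
      rw [add_zero, inner_self_eq_norm_sq_to_K]
      push_cast
      rfl
    rw [this, ← ofReal_norm, Complex.norm_real, Real.norm_of_nonneg
      (Finset.sum_nonneg fun _ _ => by positivity),
      ENNReal.ofReal_sum_of_nonneg fun _ _ => by positivity]
    exact Finset.sum_congr rfl fun m _ => by rw [ENNReal.ofReal_pow (norm_nonneg _), ofReal_norm]
  simp only [Nat.cast_zero, add_zero, Real.one_rpow, Complex.ofReal_one, one_smul] at h e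
  rw [e] at h
  have hst : s ≠ ∞ := by
    rw [hs]
    exact (ENNReal.sum_lt_top.2 fun m _ => ENNReal.pow_lt_top enorm_lt_top).ne
  rcases eq_or_ne s 0 with h0 | h0
  · rw [h0]; exact zero_le
  · rw [sq] at h
    exact (ENNReal.mul_le_mul_iff_left h0 hst).1 h

/-- Since φ is square summable, each Hankel coefficient converges for every square summable `a` and
is the limit along truncations. The bound passes to the limit in finitely many coefficients at a
time. -/
theorem HankelBound.of_square_summable {α : ℝ} {φ : ℕ → H} {M : ℝ≥0∞} (hM : HankelBound α φ M)
    (hMt : M ≠ ∞) {a : ℕ → H} (ha : ∑' m, ‖a m‖ₑ ^ 2 ≠ ∞) :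
    ∑' n, ‖fracCoeff α (hankelCoeff φ a) n‖ₑ ^ 2 ≤ M * ∑' m, ‖a m‖ₑ ^ 2 := by
  have hφs := summable_norm_sq_of_tsum_enorm_ne_top (hM.tsum_symbol_le.trans_lt hMt.lt_top).ne
  have has := summable_norm_sq_of_tsum_enorm_ne_top ha
  rw [ENNReal.tsum_eq_iSup_sum]
  refine iSup_le fun s => ?_
  have hlim : Filter.Tendsto
      (fun K => ∑ n ∈ s, ‖fracCoeff α (hankelCoeff φ (truncate a K)) n‖ₑ ^ 2) Filter.atTop
      (nhds (∑ n ∈ s, ‖fracCoeff α (hankelCoeff φ a) n‖ₑ ^ 2)) := by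
    refine tendsto_finsetSum s fun n _ => ?_
    have h1 : Filter.Tendsto (fun K => hankelCoeff φ (truncate a K) n) Filter.atTop
        (nhds (hankelCoeff φ a n)) := by
      simp_rw [hankelCoeff_truncate]
      exact (summable_inner_of_sq hφs has n).hasSum.tendsto_sum_nat
    exact ENNReal.Tendsto.pow ((h1.const_smul _).enorm)
  refine le_of_tendsto' hlim fun K => ?_
  refine (ENNReal.sum_le_tsum s).trans ((hM _ 2 one_lt_two (convergesTo_truncate a K 2)).trans ?_)
  rw [tsum_enorm_sq_truncate]
  gcongr
  exact ENNReal.sum_le_tsum _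

variable [CompleteSpace H]

/-- The conjugate linearity of x ↦ x^* undoes the conjugation of the variable, so φ^# is analytic.
-/
theorem taylorCoeff_sharp {φ : ℂ → H} (hφ : IsHol φ) :
    taylorCoeff (sharp φ) = fun n => innerSL ℂ (taylorCoeff φ n) := by
  have hc := convergesTo_taylorCoeff hφ
  refine taylorCoeff_eq_of_hasSum one_pos (fun r h0 hr => ?_) fun z hz => ?_
  · simpa only [innerSL_apply_norm] using hc r h0 hr
  · have hz' : ‖starRingEnd ℂ z‖ < 1 := by
      rw [RCLike.norm_conj]; simpa using hz
    have h := (innerSL ℂ (E := H)).hasSum (IsHol.hasSum hφ hz')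
    rw [sharp, powerSum, ← h.tsum_eq]
    refine tsum_congr fun n => ?_
    rw [map_smulₛₗ, map_pow, Complex.conj_conj]

theorem fracD_hankel_eq {φ f : ℂ → H} (α : ℝ) (hφ : IsHol φ)
    (hb : ConvergesTo (hankelCoeff (taylorCoeff φ) (taylorCoeff f)) 1) :
    fracD α (hankel (sharp φ) f)
      = powerSum (fracCoeff α (hankelCoeff (taylorCoeff φ) (taylorCoeff f))) := by
  have h : hankel (sharp φ) f = powerSum (hankelCoeff (taylorCoeff φ) (taylorCoeff f)) := by
    funext z
    rw [hankel, powerSum, taylorCoeff_sharp hφ]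
    rfl
  rw [fracD_eq, h, taylorCoeff_powerSum one_pos hb]
  rfl

theorem hardyNorm_fracD_hankel_sq {φ f : ℂ → H} (α : ℝ) (hφ : IsHol φ)
    (hf : ExtendsAnalytically f) :
    hardyNorm (fracD α (hankel (sharp φ) f)) ^ 2
      = ∑' n, ‖fracCoeff α (hankelCoeff (taylorCoeff φ) (taylorCoeff f)) n‖ₑ ^ 2 := by
  obtain ⟨R, hR, ha⟩ := hf.convergesTo
  have hb := convergesTo_hankelCoeff (convergesTo_taylorCoeff hφ) hR ha
  have hc : ConvergesTo (fracCoeff α (hankelCoeff (taylorCoeff φ) (taylorCoeff f))) 1 :=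
    hb.rpow_smul α
  rw [fracD_hankel_eq α hφ hb, hardyNorm_sq hc.differentiableOn, taylorCoeff_powerSum one_pos hc]

theorem carleson_integral_eq {φ f : ℂ → H} (α : ℝ) (hf : IsHol f) :
    ∫⁻ z in Metric.ball (0 : ℂ) 1, ‖⟪fracD (1 + α) φ z, f z⟫_ℂ‖ₑ ^ 2 * ENNReal.ofReal (1 - ‖z‖ ^ 2)
      = ∫⁻ z in Metric.ball (0 : ℂ) 1,
        ‖⟪powerSum (fracCoeff (1 + α) (taylorCoeff φ)) z, powerSum (taylorCoeff f) z⟫_ℂ‖ₑ ^ 2 *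
          ENNReal.ofReal (1 - ‖z‖ ^ 2) := by
  refine setLIntegral_congr_fun Metric.isOpen_ball.measurableSet fun z hz => ?_
  rw [IsHol.eq_powerSum hf (by simpa using hz), fracD_eq]
  rfl

theorem hankelBound_hardyOpNorm {φ : ℂ → H} (α : ℝ) (hφ : IsHol φ) :
    HankelBound α (taylorCoeff φ)
      (hardyOpNorm (fun f : ℂ → H => fracD α (hankel (sharp φ) f)) ^ 2) := by
  intro a R hR ha
  have hst := tsum_enorm_sq_ne_top hR ha
  set s := ∑' m, ‖a m‖ₑ ^ 2 with hs
  -- The operator norm only sees functions of norm one; the zero sequence cannot be normalized and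
  -- is treated apart.
  rcases eq_or_ne s 0 with h0 | h0
  · have ha0 : ∀ m, a m = 0 := fun m => by
      have := ENNReal.tsum_eq_zero.1 h0 m
      simpa using this
    have : ∀ n, hankelCoeff (taylorCoeff φ) a n = 0 := fun n => by simp [hankelCoeff, ha0]
    simp [fracCoeff, this]
  · set t : ℝ := Real.sqrt s.toReal with ht
    have htpos : 0 < t := Real.sqrt_pos.2 (ENNReal.toReal_pos h0 hst)
    have hts : ENNReal.ofReal (t ^ 2) = s := by
      rw [ht, Real.sq_sqrt ENNReal.toReal_nonneg, ENNReal.ofReal_toReal hst]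
    have htn : ‖((t⁻¹ : ℝ) : ℂ)‖ₑ ^ 2 = s⁻¹ := by
      rw [← ofReal_norm, Complex.norm_real, Real.norm_of_nonneg (by positivity),
        ← ENNReal.ofReal_pow (by positivity), inv_pow, ENNReal.ofReal_inv_of_pos (by positivity),
        hts]
    have hca : ConvergesTo (fun m => ((t⁻¹ : ℝ) : ℂ) • a m) R :=
      ha.smul_of_le (m := fun _ => ((t⁻¹ : ℝ) : ℂ)) (β := 0) (A := ‖((t⁻¹ : ℝ) : ℂ)‖) fun n => by
        rw [Real.rpow_zero, mul_one]
    set f : ℂ → H := powerSum fun m => ((t⁻¹ : ℝ) : ℂ) • a m with hf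
    have hext : ExtendsAnalytically f := extendsAnalytically_powerSum hR hca
    have htc : taylorCoeff f = fun m => ((t⁻¹ : ℝ) : ℂ) • a m :=
      taylorCoeff_powerSum (one_pos.trans hR) hca
    have hn : hardyNorm f ^ 2 = 1 := by
      rw [hardyNorm_sq hext.isHol, htc]
      simp_rw [enorm_smul, mul_pow, htn]
      rw [ENNReal.tsum_mul_left, ← hs, ENNReal.inv_mul_cancel h0 hst]
    have hn1 : hardyNorm f = 1 := by
      refine le_antisymm ?_ ?_
      · rw [← ENNReal.pow_le_pow_left_iff two_ne_zero, hn, one_pow]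
      · rw [← ENNReal.pow_le_pow_left_iff two_ne_zero, hn, one_pow]
    have hle : hardyNorm (fracD α (hankel (sharp φ) f))
        ≤ hardyOpNorm (fun f : ℂ → H => fracD α (hankel (sharp φ) f)) :=
      le_iSup₂ (f := fun (f : ℂ → H) (_ : f ∈ unitAnalytic H) =>
        hardyNorm (fracD α (hankel (sharp φ) f))) f ⟨hext, hn1⟩
    have h2 := pow_le_pow_left₀ zero_le hle 2
    rw [hardyNorm_fracD_hankel_sq α hφ hext, htc] at h2
    have e : ∀ n, ‖fracCoeff α (hankelCoeff (taylorCoeff φ) fun m => ((t⁻¹ : ℝ) : ℂ) • a m) n‖ₑ ^ 2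
        = s⁻¹ * ‖fracCoeff α (hankelCoeff (taylorCoeff φ) a) n‖ₑ ^ 2 := by
      intro n
      rw [fracCoeff, fracCoeff, hankelCoeff_smul, smul_eq_mul, smul_eq_mul, mul_left_comm,
        enorm_mul, mul_pow, htn]
    simp_rw [e] at h2
    rw [ENNReal.tsum_mul_left] at h2
    rw [mul_comm]
    exact (ENNReal.inv_mul_le_iff h0 hst).1 h2

theorem taylorCoeff_add {f g : ℂ → H} (hf : IsHol f) (hg : IsHol g) :
    taylorCoeff (f + g) = fun n => taylorCoeff f n + taylorCoeff g n := by
  have h := fun {z : ℂ} (hz : ‖z‖ < 1) => (IsHol.hasSum hf hz).add (IsHol.hasSum hg hz)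
  refine taylorCoeff_eq_of_hasSum one_pos ?_ fun z hz => ?_
  · have h1 := convergesTo_taylorCoeff hf
    have h2 := convergesTo_taylorCoeff hg
    intro r h0 hr
    refine Summable.of_nonneg_of_le (fun _ => by positivity) (fun n => ?_)
      ((h1 r h0 hr).add (h2 r h0 hr))
    rw [← add_mul]
    exact mul_le_mul_of_nonneg_right (norm_add_le _ _) (by positivity)
  · rw [Pi.add_apply, ← (h (by simpa using hz)).tsum_eq, powerSum]
    exact tsum_congr fun n => (smul_add _ _ _).symm

theorem taylorCoeff_smul {f : ℂ → H} (hf : IsHol f) (c : ℂ) :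
    taylorCoeff (c • f) = fun n => c • taylorCoeff f n := by
  refine taylorCoeff_eq_of_hasSum one_pos ((convergesTo_taylorCoeff hf).smul_of_le
    (m := fun _ => c) (β := 0) (A := ‖c‖) fun n => by rw [Real.rpow_zero, mul_one]) fun z hz => ?_
  rw [Pi.smul_apply, ← ((IsHol.hasSum hf (by simpa using hz)).const_smul c).tsum_eq, powerSum]
  exact tsum_congr fun n => smul_comm _ _ _

theorem hardySpace_tsum_ne_top (f : hardySpace H) :
    ∑' m, ‖taylorCoeff (f : ℂ → H) m‖ₑ ^ 2 ≠ ∞ := by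
  rw [← hardyNorm_sq f.2.1]
  exact (ENNReal.pow_lt_top f.2.2).ne

/-- A bound on `𝒪(H)` yields a bounded extension to the Hardy space. -/
theorem isHardyBounded_of_hankelBound {φ : ℂ → H} {α : ℝ} (hφ : IsHol φ) {L : ℝ≥0}
    (hM : HankelBound α (taylorCoeff φ) ((L : ℝ≥0∞) ^ 2)) :
    IsHardyBounded (fun f : ℂ → H => fracD α (hankel (sharp φ) f)) := by
  have hMt : (L : ℝ≥0∞) ^ 2 ≠ ∞ := ENNReal.pow_ne_top ENNReal.coe_ne_top
  have hφs := summable_norm_sq_of_tsum_enorm_ne_top (hM.tsum_symbol_le.trans_lt hMt.lt_top).ne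
  let B : (ℂ → H) → ℕ → ℂ := fun f =>
    fracCoeff α (hankelCoeff (taylorCoeff φ) (taylorCoeff f))
  have hB : ∀ f : hardySpace H, ∑' n, ‖B f n‖ₑ ^ 2 ≤ (L : ℝ≥0∞) ^ 2 * hardyNorm (f : ℂ → H) ^ 2 :=
    fun f => by
      rw [hardyNorm_sq f.2.1]
      exact hM.of_square_summable hMt (hardySpace_tsum_ne_top f)
  have hBc : ∀ f : hardySpace H, ConvergesTo (B f) 1 := fun f => by
    have hne : ∑' n, ‖B f n‖ₑ ^ 2 ≠ ∞ :=
      ((hB f).trans_lt (ENNReal.mul_lt_top hMt.lt_top (ENNReal.pow_lt_top f.2.2))).ne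
    have hs := summable_norm_sq_of_tsum_enorm_ne_top hne
    refine ConvergesTo.of_bounded fun r h0 hr => ⟨1 + ∑' n, ‖B f n‖ ^ 2, fun n => ?_⟩
    have h1 := hs.le_tsum n fun _ _ => by positivity
    calc ‖B f n‖ * r ^ n ≤ ‖B f n‖ * 1 := by gcongr; exact pow_le_one₀ h0 hr.le
      _ ≤ 1 + ‖B f n‖ ^ 2 := by nlinarith [sq_nonneg (‖B f n‖ - 1)]
      _ ≤ _ := by linarith
  -- Elements of `hardySpace` are functions on the whole plane, and off the disc a divergent `tsum`
  -- need not be additive. The value 0 there makes the extension linear everywhere.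
  let T₀ : (ℂ → H) → ℂ → ℂ := fun f z => if ‖z‖ < 1 then powerSum (B f) z else 0
  have hT₀ : ∀ f, Set.EqOn (T₀ f) (powerSum (B f)) (Metric.ball 0 1) := fun f z hz =>
    if_pos (by simpa using hz)
  have hT₀n : ∀ f : hardySpace H, hardyNorm (T₀ f) ≤ L * hardyNorm (f : ℂ → H) := fun f => by
    rw [← ENNReal.pow_le_pow_left_iff two_ne_zero, mul_pow, hardyNorm_congr (hT₀ f),
      hardyNorm_sq (hBc f).differentiableOn, taylorCoeff_powerSum one_pos (hBc f)]
    exact hB f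
  have hmem : ∀ f : hardySpace H, T₀ f ∈ hardySpace ℂ := fun f =>
    ⟨(hBc f).differentiableOn.congr (hT₀ f),
      (hT₀n f).trans_lt (ENNReal.mul_lt_top ENNReal.coe_lt_top f.2.2)⟩
  refine ⟨{ toFun := fun f => ⟨T₀ f, hmem f⟩, map_add' := ?_, map_smul' := ?_ },
    ⟨L, hT₀n⟩, ?_⟩
  · intro f g
    apply Subtype.ext
    funext z
    change T₀ ((f : ℂ → H) + g) z = T₀ f z + T₀ g z
    simp only [T₀]
    split_ifs with hz
    · rw [← ((hBc f).hasSum hz).tsum_eq.trans rfl, ← ((hBc g).hasSum hz).tsum_eq.trans rfl,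
        ← ((hBc f).hasSum hz).summable.tsum_add ((hBc g).hasSum hz).summable, powerSum]
      refine tsum_congr fun n => ?_
      rw [← smul_add]
      congr 1
      simp only [B, fracCoeff]
      rw [← smul_add, taylorCoeff_add f.2.1 g.2.1]
      congr 1
      have h1 := summable_inner_of_sq hφs
        (summable_norm_sq_of_tsum_enorm_ne_top (hardySpace_tsum_ne_top f)) n
      have h2 := summable_inner_of_sq hφs
        (summable_norm_sq_of_tsum_enorm_ne_top (hardySpace_tsum_ne_top g)) n
      rw [hankelCoeff, hankelCoeff, hankelCoeff, ← h1.tsum_add h2]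
      exact tsum_congr fun m => inner_add_right _ _ _
    · simp
  · intro c f
    apply Subtype.ext
    funext z
    change T₀ (c • (f : ℂ → H)) z = c • T₀ f z
    simp only [T₀]
    split_ifs with hz
    · rw [powerSum, powerSum, ← ((hBc f).hasSum hz).summable.tsum_const_smul c]
      refine tsum_congr fun n => ?_
      simp only [B, fracCoeff]
      rw [taylorCoeff_smul f.2.1, hankelCoeff_smul]
      simp only [smul_eq_mul]
      ring
    · simp
  · intro f hf
    obtain ⟨R, hR, ha⟩ := hf.convergesTo
    change Set.EqOn (T₀ f) (fracD α (hankel (sharp φ) f)) (Metric.ball 0 1)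
    rw [fracD_hankel_eq α hφ (convergesTo_hankelCoeff (convergesTo_taylorCoeff hφ) hR ha)]
    exact hT₀ f

theorem hardyOpNorm_lt_top_of_isHardyBounded {E F : Type*} [NormedAddCommGroup E] [NormedSpace ℂ E]
    [NormedAddCommGroup F] [NormedSpace ℂ F] {S : (ℂ → E) → ℂ → F} (h : IsHardyBounded S) :
    hardyOpNorm S < ∞ := by
  obtain ⟨T, ⟨M, hM⟩, hT⟩ := h
  refine lt_of_le_of_lt (iSup₂_le fun f hf => ?_) (ENNReal.coe_lt_top (r := M))
  let f' : hardySpace E := ⟨f, hf.1.isHol, by rw [hf.2]; exact ENNReal.one_lt_top⟩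
  have h1 := hM f'
  rw [hardyNorm_congr (hT f' hf.1)] at h1
  refine h1.trans (le_of_eq ?_)
  change (M : ℝ≥0∞) * hardyNorm f = M
  rw [hf.2, mul_one]

end

end

/-! ### The equivalence with two-sided bounds -/

theorem mainTheorem7 (α : ℝ) (hα : 0 < α) :
    ∃ C : ℝ≥0, 0 < C ∧
      ∀ (H : Type*) [NormedAddCommGroup H] [InnerProductSpace ℂ H] [CompleteSpace H]
        [TopologicalSpace.SeparableSpace H] (φ : ℂ → H), IsHol φ →
        (IsHardyBounded (fun f : ℂ → H => fracD α (hankel (sharp φ) f)) ↔ carlesonSup α φ < ∞) ∧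
        carlesonSup α φ ≤ C * hardyOpNorm (fun f : ℂ → H => fracD α (hankel (sharp φ) f)) ^ 2 ∧
        hardyOpNorm (fun f : ℂ → H => fracD α (hankel (sharp φ) f)) ^ 2 ≤ C * carlesonSup α φ := by
  obtain ⟨C₁, hC₁⟩ := exists_carleson_le_hankel hα
  obtain ⟨C₂, hC₂⟩ := exists_hankel_le_carleson hα
  -- The sum serves both inequalities; the 1 ensures positivity.
  refine ⟨C₁ + C₂ + 1, by positivity, fun H _ _ _ _ φ hφ => ?_⟩
  set N := hardyOpNorm (fun f : ℂ → H => fracD α (hankel (sharp φ) f)) with hN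
  have hφc := convergesTo_taylorCoeff hφ
  have h1 : carlesonSup α φ ≤ C₁ * N ^ 2 := by
    refine iSup₂_le fun f hf => ?_
    obtain ⟨R, hR, ha⟩ := hf.1.convergesTo
    rw [carleson_integral_eq α hf.1.isHol]
    refine (hC₁ hφc (hankelBound_hardyOpNorm α hφ) hR ha).trans (le_of_eq ?_)
    rw [← hardyNorm_sq hf.1.isHol, hf.2, one_pow, mul_one]
  have h2 : N ^ 2 ≤ C₂ * carlesonSup α φ := by
    -- The square is moved to the right as a root, so that the supremum can be bounded one function
    -- at a time.
    rw [← ENNReal.rpow_ofNat, ← ENNReal.le_rpow_inv_iff two_pos]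
    refine iSup₂_le fun f hf => ?_
    rw [ENNReal.le_rpow_inv_iff two_pos, ENNReal.rpow_ofNat]
    obtain ⟨R, hR, ha⟩ := hf.1.convergesTo
    rw [hardyNorm_fracD_hankel_sq α hφ hf.1]
    refine (hC₂ hφc hR ha).trans ?_
    rw [← carleson_integral_eq α hf.1.isHol]
    gcongr
    exact le_iSup₂ (f := fun (f : ℂ → H) (_ : f ∈ unitAnalytic H) =>
      ∫⁻ z in Metric.ball (0 : ℂ) 1,
        ‖⟪fracD (1 + α) φ z, f z⟫_ℂ‖ₑ ^ 2 * ENNReal.ofReal (1 - ‖z‖ ^ 2)) f hf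
  refine ⟨⟨fun h => ?_, fun h => ?_⟩, h1.trans ?_, h2.trans ?_⟩
  · exact h1.trans_lt (ENNReal.mul_lt_top ENNReal.coe_lt_top
      (ENNReal.pow_lt_top (hardyOpNorm_lt_top_of_isHardyBounded h)))
  · have hNt : N ≠ ∞ := by
      intro hc
      rw [hc] at h2
      have := h2.trans_lt (ENNReal.mul_lt_top ENNReal.coe_lt_top h)
      simp at this
    refine isHardyBounded_of_hankelBound hφ (L := N.toNNReal) ?_
    rw [ENNReal.coe_toNNReal hNt]
    exact hankelBound_hardyOpNorm α hφ
  · gcongr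
    rw [add_assoc]
    exact le_self_add
  · gcongr
    rw [add_comm C₁, add_assoc]
    exact le_self_add
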